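/- Let $p$ be a prime and let $\mathcal H_p$ be the Heisenberg group of order $p^3$: the set of triples $(x,y,z)\in\mathbb F_p^3$ with $(x_1,y_1,z_1)(x_2,y_2,z_2)=(x_1+x_2,\,y_1+y_2,\,z_1+z_2+x_1y_2)$. Let $\omega\in\mathbb C$ be a primitive $p$-th root of unity, put $\chi_{a,b}(x,y,z)=\omega^{ax+by}$ for $a,b\in\mathbb F_p$, and for $k\in\mathbb F_p^\ast$ let $\rho_k(x,y,z)=\omega^{kz}\sum_{c\in\mathbb F_p}\omega^{kyc}\,|c\rangle\langle c+x|$, a $p\times p$ matrix. Let $N_\infty=\{(0,y,z):y,z\in\mathbb F_p\}$. The family $\mathrm{Irr}(\mathcal H_p)=\{\chi_{a,b}:a,b\in\mathbb F_p\}\cup\{\rho_k:k\in\mathbb F_p^\ast\}$ is a complete set of pairwise inequivalent irreducible unitary representations of $\mathcal H_p$. It is adapted to the subgroup tower $\{1\}\lhd N_\infty\lhd\mathcal H_p$: the subgroup $N_\infty$ is normal, and every representation of the family takes diagonal values on $N_\infty$. The quantum Fourier transform of $\mathcal H_p$ with respect to $\mathrm{Irr}(\mathcal H_p)$ is the linear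 map $$|g\rangle\mapsto\sum_{\rho\in\mathrm{Irr}(\mathcal H_p)}\sqrt{\frac{d_\rho}{|\mathcal H_p|}}\sum_{i,j}\rho(g)_{ij}\,|\rho,i,j\rangle ,$$ where $d_\rho$ is the dimension of $\rho$. Let $n$ be the smallest integer with $p<2^n$. Encode triples of elements of $\mathbb F_p$ in $3n$ qubits, writing the representative in $\{0,\dots,p-1\}$ of each component in binary; encode $g=(x,y,z)$ by the triple $(x,y,z)$, the label of $\chi_{a,b}$ by $(0,a,b)$, and the label $(\rho_k,i,j)$ by $(k,i,j)$. Then there is an absolute constant $K$ such that for every prime $p$ and every such $\omega$ there is a quantum circuit on these $3n$ qubits and some ancilla qubits, consisting of at most $K\log^3 p$ elementary gates (arbitrary one-qubit unitaries and CNOT gates), which on every encoded basis state $|g\rangle$, with the ancillas initially $|0\rangle$, outputs exactly the encoded quantum Fourier transform of $|g\rangle$, with the ancillas returned to $|0\rangle$. -/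

import Mathlib

open scoped Matrix

noncomputable section

/-! ### The Heisenberg group -/

/-- The Heisenberg group over `ℤ/p`: the triple `(x, y, z)` stands for the unitriangular matrix
with rows `1 x z`, `0 1 y`, `0 0 1`. -/
@[ext]
structure Heisenberg (p : ℕ) where
  x : ZMod p
  y : ZMod p
  z : ZMod p

namespace Heisenberg

variable {p : ℕ}

instance : One (Heisenberg p) := ⟨⟨0, 0, 0⟩⟩

instance : Mul (Heisenberg p) := ⟨fun g h => ⟨g.x + h.x, g.y + h.y, g.z + h.z + g.x * h.y⟩⟩

instance : Inv (Heisenberg p) := ⟨fun g => ⟨-g.x, -g.y, g.x * g.y - g.z⟩⟩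

@[simp] theorem one_x : (1 : Heisenberg p).x = 0 := rfl
@[simp] theorem one_y : (1 : Heisenberg p).y = 0 := rfl
@[simp] theorem one_z : (1 : Heisenberg p).z = 0 := rfl
@[simp] theorem mul_x (g h : Heisenberg p) : (g * h).x = g.x + h.x := rfl
@[simp] theorem mul_y (g h : Heisenberg p) : (g * h).y = g.y + h.y := rfl
@[simp] theorem mul_z (g h : Heisenberg p) : (g * h).z = g.z + h.z + g.x * h.y := rfl
@[simp] theorem inv_x (g : Heisenberg p) : (g⁻¹).x = -g.x := rfl
@[simp] theorem inv_y (g : Heisenberg p) : (g⁻¹).y = -g.y := rfl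
@[simp] theorem inv_z (g : Heisenberg p) : (g⁻¹).z = g.x * g.y - g.z := rfl

instance : Group (Heisenberg p) :=
  Group.ofLeftAxioms
    (fun a b c => by ext <;> simp <;> ring)
    (fun a => by ext <;> simp)
    (fun a => by ext <;> simp)

/-- The matrix encoded by a triple; products of triples are products of matrices. -/
def toMatrix (g : Heisenberg p) : Matrix (Fin 3) (Fin 3) (ZMod p) :=
  !![1, g.x, g.z; 0, 1, g.y; 0, 0, 1]

theorem toMatrix_mul (g h : Heisenberg p) : (g * h).toMatrix = g.toMatrix * h.toMatrix := by
  ext i j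
  fin_cases i <;> fin_cases j <;> simp [toMatrix, Matrix.mul_apply, Fin.sum_univ_three] <;> ring

/-- The subgroup `N_∞ = {(0, y, z)}`. -/
def NInfty (p : ℕ) : Subgroup (Heisenberg p) where
  carrier := {g | g.x = 0}
  mul_mem' := by
    intro a b ha hb
    simp only [Set.mem_ofPred_eq] at ha hb ⊢
    simp [ha, hb]
  one_mem' := by simp
  inv_mem' := by
    intro a ha
    simp only [Set.mem_ofPred_eq] at ha ⊢
    simp [ha]

end Heisenberg

/-! ### Fourier transform with respect to a family of unitary matrix representations -/

/-- The linear representation on column vectors given by a unitary matrix representation. -/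
def matrixRep {G κ : Type} [Group G] [Fintype κ] [DecidableEq κ]
    (ρ : G →* Matrix.unitaryGroup κ ℂ) : Representation ℂ G (κ → ℂ) where
  toFun g := Matrix.toLin' (ρ g : Matrix κ κ ℂ)
  map_one' := by
    rw [map_one]
    exact Matrix.toLin'_one
  map_mul' g h := by
    rw [map_mul]
    exact Matrix.toLin'_mul _ _

/-- `ρ` is a complete set of pairwise inequivalent irreducible unitary representations of `G`. -/
structure IsCompleteIrreps {G ι : Type} [Group G] {κ : ι → Type}
    [∀ i, Fintype (κ i)] [∀ i, DecidableEq (κ i)]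
    (ρ : ∀ i, G →* Matrix.unitaryGroup (κ i) ℂ) : Prop where
  irreducible : ∀ i, (matrixRep (ρ i)).IsIrreducible
  inequivalent : ∀ i j, Nonempty ((matrixRep (ρ i)).Equiv (matrixRep (ρ j))) → i = j
  complete : ∀ (d : ℕ) (σ : Representation ℂ G (Fin d → ℂ)), σ.IsIrreducible →
    ∃ i, Nonempty (σ.Equiv (matrixRep (ρ i)))

/-- The labels `(ρ, i, j)`: a representation of the family, a row index and a column index. -/
abbrev FourierLabel {ι : Type} (κ : ι → Type) : Type := Σ r : ι, κ r × κ r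

/-- The matrix of the quantum Fourier transform
`|g⟩ ↦ ∑_ρ √(d_ρ / |G|) ∑_{i,j} ρ(g)_{ij} |ρ, i, j⟩`. -/
def qftMatrix {G ι : Type} [Group G] {κ : ι → Type}
    [∀ i, Fintype (κ i)] [∀ i, DecidableEq (κ i)]
    (ρ : ∀ i, G →* Matrix.unitaryGroup (κ i) ℂ) : Matrix (FourierLabel κ) G ℂ :=
  fun l g => (Real.sqrt ((Fintype.card (κ l.1) : ℝ) / (Nat.card G : ℝ)) : ℂ) *
    (ρ l.1 g : Matrix (κ l.1) (κ l.1) ℂ) l.2.1 l.2.2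

/-! ### The irreducible representations of the Heisenberg group -/

namespace Heisenberg

variable {p : ℕ}

/-- Names of the irreducible representations: `Sum.inl (a, b)` is `χ_{a,b}` and
`Sum.inr k` is `ρ_k`. -/
abbrev IrrepName (p : ℕ) : Type := (ZMod p × ZMod p) ⊕ (ZMod p)ˣ

/-- Index sets of the representation matrices: one point for `χ_{a,b}`, and `ℤ/p` for `ρ_k`. -/
def IrrepIndex : IrrepName p → Type
  | Sum.inl _ => Unit
  | Sum.inr _ => ZMod p

instance [NeZero p] : ∀ r : IrrepName p, Fintype (IrrepIndex r)
  | Sum.inl _ => inferInstanceAs (Fintype Unit)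
  | Sum.inr _ => inferInstanceAs (Fintype (ZMod p))

instance : ∀ r : IrrepName p, DecidableEq (IrrepIndex r)
  | Sum.inl _ => inferInstanceAs (DecidableEq Unit)
  | Sum.inr _ => inferInstanceAs (DecidableEq (ZMod p))

/-- The `1 × 1` matrix `χ_{a,b}(x, y, z) = ω^{ax + by}`; here `e t = ω^t`. -/
def chiMatrix (e : AddChar (ZMod p) ℂ) (a b : ZMod p) (g : Heisenberg p) : Matrix Unit Unit ℂ :=
  fun _ _ => e (a * g.x + b * g.y)

/-- The matrix `ρ_k(x, y, z) = ω^{kz} ∑_c ω^{kyc} |c⟩⟨c + x|`; here `e t = ω^t`. -/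
def rhoMatrix (e : AddChar (ZMod p) ℂ) (k : ZMod p) (g : Heisenberg p) :
    Matrix (ZMod p) (ZMod p) ℂ :=
  fun c d => if d = c + g.x then e (k * g.z) * e (k * g.y * c) else 0

theorem chiMatrix_one (e : AddChar (ZMod p) ℂ) (a b : ZMod p) : chiMatrix e a b 1 = 1 := by
  ext
  simp [chiMatrix]

theorem chiMatrix_mul (e : AddChar (ZMod p) ℂ) (a b : ZMod p) (g h : Heisenberg p) :
    chiMatrix e a b (g * h) = chiMatrix e a b g * chiMatrix e a b h := by
  ext
  simp only [chiMatrix, Matrix.mul_apply, Finset.univ_unique, Finset.sum_singleton, mul_x, mul_y,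
    ← AddChar.map_add_eq_mul]
  congr 1
  ring

theorem chiMatrix_star [NeZero p] (e : AddChar (ZMod p) ℂ) (a b : ZMod p) (g : Heisenberg p) :
    star (chiMatrix e a b g) = chiMatrix e a b g⁻¹ := by
  ext
  simp only [chiMatrix, Matrix.star_apply, inv_x, inv_y, ← starRingEnd_apply,
    ← AddChar.map_neg_eq_conj]
  congr 1
  ring

theorem rhoMatrix_one (e : AddChar (ZMod p) ℂ) (k : ZMod p) : rhoMatrix e k 1 = 1 := by
  ext c d
  simp [rhoMatrix, Matrix.one_apply, eq_comm]

theorem rhoMatrix_mul [NeZero p] (e : AddChar (ZMod p) ℂ) (k : ZMod p) (g h : Heisenberg p) :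
    rhoMatrix e k (g * h) = rhoMatrix e k g * rhoMatrix e k h := by
  ext c d
  rw [Matrix.mul_apply, Finset.sum_eq_single (c + g.x)]
  · simp only [rhoMatrix, mul_x, mul_y, mul_z, add_assoc, if_true]
    split_ifs
    · simp only [← AddChar.map_add_eq_mul]
      congr 1
      ring
    · simp
  · intro b _ hb
    simp [rhoMatrix, hb]
  · simp

theorem rhoMatrix_star [NeZero p] (e : AddChar (ZMod p) ℂ) (k : ZMod p) (g : Heisenberg p) :
    star (rhoMatrix e k g) = rhoMatrix e k g⁻¹ := by
  ext c d
  simp only [rhoMatrix, Matrix.star_apply, inv_x, inv_y, inv_z]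
  by_cases h : c = d + g.x
  · subst h
    rw [if_pos rfl, if_pos (by ring), ← AddChar.map_add_eq_mul, ← starRingEnd_apply,
      ← AddChar.map_neg_eq_conj, ← AddChar.map_add_eq_mul]
    congr 1
    ring
  · rw [if_neg h, if_neg (fun h' => h (by rw [h']; ring)), star_zero]

/-- The representation `χ_{a,b}`. -/
def chi [NeZero p] (e : AddChar (ZMod p) ℂ) (a b : ZMod p) : Heisenberg p →* Matrix.unitaryGroup Unit ℂ where
  toFun g := ⟨chiMatrix e a b g, Matrix.mem_unitaryGroup_iff'.2 (by
    rw [chiMatrix_star, ← chiMatrix_mul, inv_mul_cancel, chiMatrix_one])⟩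
  map_one' := Subtype.ext (chiMatrix_one e a b)
  map_mul' g h := Subtype.ext (chiMatrix_mul e a b g h)

/-- The representation `ρ_k`. -/
def rho [NeZero p] (e : AddChar (ZMod p) ℂ) (k : ZMod p) :
    Heisenberg p →* Matrix.unitaryGroup (ZMod p) ℂ where
  toFun g := ⟨rhoMatrix e k g, Matrix.mem_unitaryGroup_iff'.2 (by
    rw [rhoMatrix_star, ← rhoMatrix_mul, inv_mul_cancel, rhoMatrix_one])⟩
  map_one' := Subtype.ext (rhoMatrix_one e k)
  map_mul' g h := Subtype.ext (rhoMatrix_mul e k g h)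

/-- The family `{χ_{a,b}} ∪ {ρ_k : k ≠ 0}` for a `p`-th root of unity `ω`. -/
def irrep [NeZero p] (ω : ℂ) (hω : ω ^ p = 1) :
    ∀ r : IrrepName p, Heisenberg p →* Matrix.unitaryGroup (IrrepIndex r) ℂ
  | Sum.inl ab => chi (AddChar.zmodChar p hω) ab.1 ab.2
  | Sum.inr k => rho (AddChar.zmodChar p hω) k

end Heisenberg

/-! ### Quantum circuits -/

/-- Elementary gates on a register whose qubits are indexed by `Q`: an arbitrary one-qubit unitary,
or a controlled NOT. -/
inductive Gate (Q : Type) where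
  | single (q : Q) (U : Matrix.unitaryGroup Bool ℂ) : Gate Q
  | cnot (control target : Q) (h : control ≠ target) : Gate Q

/-- The unitary matrix of a gate, in the computational basis `Q → Bool`. -/
def Gate.matrix {Q : Type} [Fintype Q] [DecidableEq Q] : Gate Q → Matrix (Q → Bool) (Q → Bool) ℂ
  | .single q U => fun s t =>
      if ∀ r, r ≠ q → s r = t r then (U : Matrix Bool Bool ℂ) (s q) (t q) else 0
  | .cnot c q _ => fun s t =>
      if s = Function.update t q (xor (t q) (t c)) then 1 else 0

/-- The matrix of a circuit: the gates of the list are applied one after the other, the head of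
the list first. -/
def circuitMatrix {Q : Type} [Fintype Q] [DecidableEq Q] :
    List (Gate Q) → Matrix (Q → Bool) (Q → Bool) ℂ
  | [] => 1
  | g :: C => circuitMatrix C * g.matrix

/-- The computational basis vector `|s⟩`. -/
def ket {Q : Type} [Fintype Q] [DecidableEq Q] (s : Q → Bool) : (Q → Bool) → ℂ := Pi.single s 1

namespace Heisenberg

variable {p : ℕ}

/-- Number of qubits per component: `Nat.size p` is the smallest `n` with `p < 2 ^ n`. -/
abbrev wordSize (p : ℕ) : ℕ := Nat.size p

theorem wordSize_isLeast (p : ℕ) : IsLeast {n : ℕ | p < 2 ^ n} (wordSize p) :=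
  ⟨Nat.lt_size_self p, fun _ h => Nat.size_le.2 h⟩

/-- Three words of `wordSize p` qubits, and `m` ancilla qubits. -/
abbrev Register (p m : ℕ) : Type := (Fin 3 × Fin (wordSize p)) ⊕ Fin m

/-- The bit string of a triple of residues: the bits of the representatives in `{0, …, p - 1}`,
all ancillas being `0`. -/
def encodeTriple (m : ℕ) (v : Fin 3 → ZMod p) : Register p m → Bool
  | Sum.inl (c, j) => (v c).val.testBit j
  | Sum.inr _ => false

/-- The triple of a group element. -/
def groupTriple (g : Heisenberg p) : Fin 3 → ZMod p := ![g.x, g.y, g.z]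

/-- The triple of a Fourier label: `(0, a, b)` for `χ_{a,b}`, and `(k, i, j)` for the entry
`(i, j)` of `ρ_k`. -/
def labelTriple : FourierLabel (IrrepIndex (p := p)) → (Fin 3 → ZMod p)
  | ⟨Sum.inl (a, b), _⟩ => ![0, a, b]
  | ⟨Sum.inr k, (i, j)⟩ => ![(k : ZMod p), (i : ZMod p), (j : ZMod p)]

/-- The circuit `C` computes (exactly) the linear map with matrix `F`: it takes `|g⟩|0…0⟩` to
`∑_l F_{l g} |l⟩|0…0⟩` for every group element `g`. -/
def Computes [NeZero p] {m : ℕ} (C : List (Gate (Register p m)))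
    (F : Matrix (FourierLabel (IrrepIndex (p := p))) (Heisenberg p) ℂ) : Prop :=
  ∀ g : Heisenberg p, circuitMatrix C *ᵥ ket (encodeTriple m (groupTriple g)) =
    ∑ l, F l g • ket (encodeTriple m (labelTriple l))

end Heisenberg

end

open scoped Matrix

set_option linter.unusedSectionVars false

noncomputable section

/-! ### Irreducible representations -/

/-! The transform of the group reduces to the Fourier transform F modulo p. On (x, y, z) the
amplitude of χ_{a,b} is p^(-3/2) ω^(ax+by), and that of the entry (i, j) of ρ_k is p^(-1) ω^(kz+kyi)
if j = i + x and 0 otherwise. Hence one applies F to z, obtaining k; replaces y by ky if k ≠ 0;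
applies F to that word, obtaining i; applies F to x only if k = 0; and rearranges the words, forming
j = x + i if k ≠ 0. For k = 0 the transform of z contributes just the missing factor p^(-1/2). Apart
from F this is reversible arithmetic on n-bit words; undoing y ↦ ky uses k^(p-2), a cubic
computation.

The main point is that F itself has an exact circuit with O(n³) gates, although p is not a power of
two. The transform modulo N = 2^n is exact. Write ω = exp(2πih/p). From x, with shifts r and t in
uniform superposition, form b = h(x + r) mod p, apply the transform modulo N to ⌊Nb/p⌋, and add t
modulo p to the output a when a < p. With suitable correction phases (`prepares_approx`), the inner
product with the uniform superposition of the states |y, r, t⟩ picks out a = y - t and equals ω^(xy)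
times a normalised sum over r and t of phases that depend only on (a, b) (`approxAngle_eq`). Since
(r, t) ↦ (a, b) is a bijection (`sum_shift_val`), this sum does not depend on x or y. Thus the
approximate transform, followed by the inverse of the reference preparation, has the block zF with a
scalar z: random shifts turn the rounding error into a common factor. Centring a at p/2 and rounding
symmetrically gives |z| ≥ 1/2 (`norm_sum_phase_ge`, `half_le_norm_block`).

An extra qubit lowers the factor to exactly 1/2, and then a single round of amplitude amplification
reaches amplitude 1, because sin(3·30°) = 1 (`amplification`, `Prepares.amplify`). The uniform
superposition of the p residues is obtained in the same way from that of the 2^n words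
(`prepares_uniform`).

Gate counts rest on straight-line Boolean programs (`Reach`), compiled into reversible circuits by
computing, copying and uncomputing. `Impl` describes an operator on all states of its qubits, with
ancillas always restored; `Prepares` claims the restoration only for the encoded inputs, which is
all that amplification gives, and also bounds the number of extra qubits.

The representations are treated separately: irreducibility comes from separating coordinates by the
characters of y, inequivalence from traces, and completeness from the fact that the characters
weighted by dimension add up to the regular character. -/

theorem Representation.isIrreducible_of_forall_eq_top {G V : Type} [Group G] [AddCommGroup V]
    [Module ℂ V] [Nontrivial V] (σ : Representation ℂ G V)
    (h : ∀ U : Subrepresentation σ, ∀ v ∈ U.toSubmodule, v ≠ 0 → U.toSubmodule = ⊤) :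
    σ.IsIrreducible := by
  have : Nontrivial (Subrepresentation σ) := by
    refine ⟨⊥, ⊤, fun hbt => ?_⟩
    have : (⊥ : Submodule ℂ V) = ⊤ := congrArg Subrepresentation.toSubmodule hbt
    exact bot_ne_top this
  refine ⟨fun U => ?_⟩
  by_cases hU : U.toSubmodule = ⊥
  · exact Or.inl (Subrepresentation.toSubmodule_injective hU)
  · obtain ⟨v, hv, hv0⟩ := (Submodule.ne_bot_iff _).1 hU
    exact Or.inr (Subrepresentation.toSubmodule_injective (h U v hv hv0))

theorem matrixRep_apply {G κ : Type} [Group G] [Fintype κ] [DecidableEq κ]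
    (ρ : G →* Matrix.unitaryGroup κ ℂ) (g : G) (v : κ → ℂ) :
    matrixRep ρ g v = (ρ g : Matrix κ κ ℂ) *ᵥ v :=
  Matrix.toLin'_apply _ _

theorem trace_matrixRep {G κ : Type} [Group G] [Fintype κ] [DecidableEq κ]
    (ρ : G →* Matrix.unitaryGroup κ ℂ) (g : G) :
    LinearMap.trace ℂ _ (matrixRep ρ g) = (ρ g : Matrix κ κ ℂ).trace :=
  Matrix.trace_toLin'_eq _

theorem trace_eq_of_equiv {G κ κ' : Type} [Group G] [Fintype κ] [DecidableEq κ]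
    [Fintype κ'] [DecidableEq κ'] (ρ : G →* Matrix.unitaryGroup κ ℂ)
    (ρ' : G →* Matrix.unitaryGroup κ' ℂ) (h : Nonempty ((matrixRep ρ).Equiv (matrixRep ρ')))
    (g : G) : (ρ g : Matrix κ κ ℂ).trace = (ρ' g : Matrix κ' κ' ℂ).trace := by
  obtain ⟨φ⟩ := h
  rw [← trace_matrixRep, ← trace_matrixRep, ← Representation.Equiv.conj_apply_self g φ,
    LinearMap.trace_conj']

/-- Averaging a matrix coefficient against `σ` gives an intertwining map. -/
theorem exists_equiv_of_sum_ne_zero {G κ : Type} [Group G] [Fintype G] [Fintype κ] [DecidableEq κ]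
    (ρ : G →* Matrix.unitaryGroup κ ℂ) (hρ : (matrixRep ρ).IsIrreducible) {V : Type}
    [AddCommGroup V] [Module ℂ V] (σ : Representation ℂ G V) (hσ : σ.IsIrreducible) (a b : κ)
    (h : ∑ g, (ρ g⁻¹ : Matrix κ κ ℂ) a b • σ g ≠ 0) :
    Nonempty (σ.Equiv (matrixRep ρ)) := by
  obtain ⟨w, hw⟩ : ∃ w, (∑ g, (ρ g⁻¹ : Matrix κ κ ℂ) a b • σ g) w ≠ 0 := by
    by_contra! hc
    exact h (LinearMap.ext hc)
  -- Replacing the summation variable k by gk shows that T intertwines. Its value at the basis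
  -- vector of index b is the operator of the hypothesis applied to w, so T ≠ 0 and Schur's lemma
  -- makes it bijective.
  let T : (κ → ℂ) →ₗ[ℂ] V :=
    { toFun := fun f => ∑ g, ((ρ g⁻¹ : Matrix κ κ ℂ) *ᵥ f) a • σ g w
      map_add' := by
        intro f f'
        simp [Matrix.mulVec_add, add_smul, Finset.sum_add_distrib]
      map_smul' := by
        intro c f
        simp [Matrix.mulVec_smul, Finset.smul_sum, smul_smul] }
  have hT : ∀ g f, T (matrixRep ρ g f) = σ g (T f) := by
    intro g f
    change ∑ k, _ = σ g (∑ k, _)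
    rw [map_sum, ← Equiv.sum_comp (Equiv.mulLeft g)]
    refine Finset.sum_congr rfl fun k _ => ?_
    have hmul : (ρ (g * k)⁻¹ : Matrix κ κ ℂ) * (ρ g : Matrix κ κ ℂ) = ρ k⁻¹ := by
      rw [← Submonoid.coe_mul, ← map_mul, mul_inv_rev, inv_mul_cancel_right]
    rw [map_smul, matrixRep_apply, Equiv.coe_mulLeft, Matrix.mulVec_mulVec, hmul, map_mul]
    rfl
  let φ : (matrixRep ρ).IntertwiningMap σ := T.intertwiningMap_of_isIntertwiningMap _ _ hT
  have hφ : φ ≠ 0 := by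
    intro h0
    apply hw
    have : φ (Pi.single b 1) = 0 := by rw [h0]; rfl
    rw [← this]
    change _ = ∑ g, _
    simp [LinearMap.sum_apply]
  have hb := (Representation.IsIrreducible.bijective_or_eq_zero φ).resolve_right hφ
  exact ⟨(φ.ofBijective hb).symm⟩

/-- A family of irreducible representations whose weighted characters add up to the character of
the regular representation is complete. -/
theorem exists_equiv_of_regular_character {G ι : Type} [Group G] [Fintype G] [DecidableEq G]
    [Fintype ι] {κ : ι → Type}
    [∀ i, Fintype (κ i)] [∀ i, DecidableEq (κ i)] (ρ : ∀ i, G →* Matrix.unitaryGroup (κ i) ℂ)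
    (hρ : ∀ i, (matrixRep (ρ i)).IsIrreducible) (w : ι → ℂ)
    (hreg : ∀ g, ∑ i, w i * (ρ i g : Matrix (κ i) (κ i) ℂ).trace =
      if g = 1 then (Fintype.card G : ℂ) else 0)
    {V : Type} [AddCommGroup V] [Module ℂ V] (σ : Representation ℂ G V) (hσ : σ.IsIrreducible) :
    ∃ i, Nonempty (σ.Equiv (matrixRep (ρ i))) := by
  by_contra! hc
  have hV : Nontrivial V := by
    by_contra hV
    rw [not_nontrivial_iff_subsingleton] at hV
    have hbt : (⊥ : Subrepresentation σ) = ⊤ :=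
      Subrepresentation.toSubmodule_injective (Subsingleton.elim _ _)
    exact bot_ne_top hbt
  have h0 : ∀ i a, ∑ g, (ρ i g⁻¹ : Matrix (κ i) (κ i) ℂ) a a • σ g = 0 := by
    intro i a
    by_contra hne
    exact (not_nonempty_iff.2 (hc i)) (exists_equiv_of_sum_ne_zero (ρ i) (hρ i) σ hσ a a hne)
  -- Weighting and adding the vanishing averages of the diagonal coefficients produces the regular
  -- character, whose only surviving term is |G| σ(1). This cannot vanish on a nonzero space.
  have h1 : ∑ g, (∑ i, w i * (ρ i g⁻¹ : Matrix (κ i) (κ i) ℂ).trace) • σ g = 0 := by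
    simp_rw [Finset.sum_smul]
    rw [Finset.sum_comm]
    refine Finset.sum_eq_zero fun i _ => ?_
    simp_rw [mul_smul, ← Finset.smul_sum, Matrix.trace, Matrix.diag, Finset.sum_smul]
    rw [Finset.sum_comm, Finset.sum_eq_zero fun a _ => h0 i a, smul_zero]
  simp_rw [hreg] at h1
  rw [Finset.sum_eq_single 1] at h1
  · obtain ⟨v, hv⟩ := exists_ne (0 : V)
    have := LinearMap.congr_fun h1 v
    simp at this
    exact hv this
  · intro g _ hg
    simp [hg]
  · simp

/-! ### The representations of the Heisenberg group form a complete family -/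

namespace Heisenberg

variable {p : ℕ}

/-- A group element as a triple of coordinates. -/
def equivProd : Heisenberg p ≃ ZMod p × ZMod p × ZMod p where
  toFun g := (g.x, g.y, g.z)
  invFun t := ⟨t.1, t.2.1, t.2.2⟩
  left_inv _ := rfl
  right_inv _ := rfl

instance [NeZero p] : Fintype (Heisenberg p) := Fintype.ofEquiv _ equivProd.symm

instance : DecidableEq (Heisenberg p) := equivProd.decidableEq

theorem card_eq [NeZero p] : Fintype.card (Heisenberg p) = p ^ 3 := by
  rw [Fintype.card_congr equivProd]
  simp only [Fintype.card_prod, ZMod.card]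
  ring

theorem nInfty_normal : (NInfty p).Normal := by
  refine ⟨fun a ha g => ?_⟩
  change (g * a * g⁻¹).x = 0
  have : a.x = 0 := ha
  simp [this]

theorem irrep_isDiag [NeZero p] (ω : ℂ) (hω : ω ^ p = 1) (r : IrrepName p) (g : Heisenberg p)
    (hg : g ∈ NInfty p) : (irrep ω hω r g : Matrix (IrrepIndex r) (IrrepIndex r) ℂ).IsDiag := by
  have hx : g.x = 0 := hg
  cases r with
  | inl ab =>
    intro i j hij
    exact absurd (Subsingleton.elim (α := Unit) i j) hij
  | inr k =>
    intro i j hij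
    change rhoMatrix _ _ _ _ _ = 0
    refine if_neg fun h => hij ?_
    rw [hx] at h
    exact (h.trans (add_zero (M := ZMod p) i)).symm

variable [NeZero p]

theorem rho_mulVec (e : AddChar (ZMod p) ℂ) (k : ZMod p) (g : Heisenberg p) (f : ZMod p → ℂ)
    (c : ZMod p) : (rhoMatrix e k g *ᵥ f) c = e (k * g.z) * e (k * g.y * c) * f (c + g.x) := by
  simp [Matrix.mulVec, dotProduct, rhoMatrix]

theorem chi_irreducible (e : AddChar (ZMod p) ℂ) (a b : ZMod p) :
    (matrixRep (chi e a b)).IsIrreducible := by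
  refine Representation.isIrreducible_of_forall_eq_top _ fun U v hv hv0 => ?_
  have h : v () ≠ 0 := fun h => hv0 (funext fun _ => h)
  refine (Submodule.eq_top_iff').2 fun w => ?_
  have : w = (w () / v ()) • v := by
    ext
    simp [h]
  rw [this]
  exact U.toSubmodule.smul_mem _ hv

theorem rho_irreducible [Fact p.Prime] {e : AddChar (ZMod p) ℂ} (he : e.IsPrimitive) {k : ZMod p}
    (hk : k ≠ 0) : (matrixRep (rho e k)).IsIrreducible := by
  refine Representation.isIrreducible_of_forall_eq_top _ fun U v hv hv0 => ?_
  obtain ⟨c₀, hc₀⟩ := Function.ne_iff.1 hv0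
  have hp : (p : ℂ) ≠ 0 := NeZero.ne _
  -- The elements (0, y, 0) act diagonally by e(kyc). As k ≠ 0 these characters of y are distinct
  -- for distinct c, so averaging against the one of c₀ projects onto that coordinate, where v does
  -- not vanish.
  have key : Pi.single c₀ 1 ∈ U.toSubmodule := by
    have hmem : ((p : ℂ) * v c₀)⁻¹ • ∑ y, e (-(k * y * c₀)) • matrixRep (rho e k) ⟨0, y, 0⟩ v ∈
        U.toSubmodule :=
      U.toSubmodule.smul_mem _ (Submodule.sum_mem _ fun y _ =>
        U.toSubmodule.smul_mem _ (U.apply_mem_toSubmodule _ hv))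
    convert hmem using 1
    ext c
    have h1 : ∀ y, (e (-(k * y * c₀)) • matrixRep (rho e k) ⟨0, y, 0⟩ v) c =
        e (y * (k * (c - c₀))) * v c := by
      intro y
      rw [Pi.smul_apply, matrixRep_apply]
      change _ • (rhoMatrix e k _ *ᵥ v) c = _
      rw [rho_mulVec, smul_eq_mul, mul_zero, AddChar.map_zero_eq_one, one_mul, ← mul_assoc,
        ← AddChar.map_add_eq_mul, add_zero]
      ring_nf
    rw [Pi.smul_apply, Finset.sum_apply, Finset.sum_congr rfl fun y _ => h1 y, ← Finset.sum_mul,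
      AddChar.sum_mulShift _ he]
    by_cases hc : c = c₀
    · subst hc
      simp only [Pi.single_eq_same, sub_self, mul_zero, if_true, ZMod.card, smul_eq_mul]
      rw [inv_mul_cancel₀ (mul_ne_zero hp hc₀)]
    · rw [Pi.single_eq_of_ne hc, if_neg (mul_ne_zero hk (sub_ne_zero.2 hc))]
      simp
  -- The elements (x, 0, 0) permute the basis vectors transitively.
  have key2 : ∀ c, Pi.single c 1 ∈ U.toSubmodule := by
    intro c
    convert U.apply_mem_toSubmodule ⟨c₀ - c, 0, 0⟩ key using 1
    ext d
    rw [matrixRep_apply]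
    change _ = (rhoMatrix e k _ *ᵥ _) d
    rw [rho_mulVec]
    simp only [mul_zero, zero_mul, AddChar.map_zero_eq_one, one_mul, Pi.single_apply]
    congr 1
    rw [eq_iff_iff]
    constructor
    · rintro rfl; ring
    · intro h
      linear_combination h
  refine (Submodule.eq_top_iff').2 fun w => ?_
  rw [pi_eq_sum_univ' w]
  exact Submodule.sum_mem _ fun c _ => U.toSubmodule.smul_mem _ (key2 c)

theorem trace_chi (e : AddChar (ZMod p) ℂ) (a b : ZMod p) (g : Heisenberg p) :
    (chi e a b g : Matrix Unit Unit ℂ).trace = e (a * g.x + b * g.y) := by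
  change (chiMatrix e a b g).trace = _
  simp [Matrix.trace, chiMatrix]

/-- For x ≠ 0 the diagonal is zero; for x = 0 and y ≠ 0 the trace is a complete sum of a nontrivial
character. -/
theorem trace_rho {e : AddChar (ZMod p) ℂ} (he : e.IsPrimitive) [Fact p.Prime] {k : ZMod p}
    (hk : k ≠ 0) (g : Heisenberg p) : (rho e k g : Matrix (ZMod p) (ZMod p) ℂ).trace =
      if g.x = 0 ∧ g.y = 0 then p * e (k * g.z) else 0 := by
  change (rhoMatrix e k g).trace = _
  simp only [Matrix.trace, Matrix.diag, rhoMatrix, left_eq_add]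
  by_cases hx : g.x = 0
  · simp only [hx, if_true, true_and, ← Finset.mul_sum]
    have : ∀ c, e (k * g.y * c) = e (c * (k * g.y)) := fun c => by rw [mul_comm]
    simp_rw [this]
    rw [AddChar.sum_mulShift _ he, ZMod.card]
    simp [hk, mul_comm]
  · simp [hx]

/-- Off the centre x = y = 0 both sums vanish. On it the one-dimensional characters contribute p²,
exactly the term k = 0 missing from the sum of p² e(kz) over k ≠ 0; the completed sum detects z = 0.
-/
theorem sum_weighted_traces [Fact p.Prime] {e : AddChar (ZMod p) ℂ} (he : e.IsPrimitive)
    (g : Heisenberg p) :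
    ∑ ab : ZMod p × ZMod p, (chi e ab.1 ab.2 g : Matrix Unit Unit ℂ).trace +
      ∑ k : (ZMod p)ˣ, (p : ℂ) * (rho e k g : Matrix (ZMod p) (ZMod p) ℂ).trace =
      if g = 1 then (p : ℂ) ^ 3 else 0 := by
  have h1 : ∑ ab : ZMod p × ZMod p, (chi e ab.1 ab.2 g : Matrix Unit Unit ℂ).trace =
      if g.x = 0 ∧ g.y = 0 then (p : ℂ) ^ 2 else 0 := by
    simp_rw [trace_chi, AddChar.map_add_eq_mul]
    rw [Fintype.sum_prod_type]
    simp_rw [← Finset.mul_sum, ← Finset.sum_mul]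
    rw [AddChar.sum_mulShift _ he, AddChar.sum_mulShift _ he, ZMod.card]
    split_ifs <;> simp_all [pow_two]
  have h2 : ∑ k : (ZMod p)ˣ, (p : ℂ) * (rho e k g : Matrix (ZMod p) (ZMod p) ℂ).trace =
      if g.x = 0 ∧ g.y = 0 then (p : ℂ) ^ 2 * ((∑ k : ZMod p, e (k * g.z)) - 1) else 0 := by
    simp_rw [fun k : (ZMod p)ˣ => trace_rho he k.ne_zero g]
    split_ifs with h
    · rw [← Finset.mul_sum, ← Finset.mul_sum, ← mul_assoc, ← pow_two]
      congr 1
      rw [eq_sub_iff_add_eq, ← Fintype.sum_subtype_add_sum_subtype (fun k : ZMod p => k ≠ 0)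
        (fun k => e (k * g.z)), ← Equiv.sum_comp unitsEquivNeZero]
      congr 1
      have : ∀ k : {k : ZMod p // ¬ k ≠ 0}, e (k * g.z) = 1 := by
        rintro ⟨k, hk⟩
        obtain rfl := not_not.1 hk
        simp
      simp [this]
    · simp
  rw [h1, h2, AddChar.sum_mulShift _ he, ZMod.card]
  have h3 : g = 1 ↔ (g.x = 0 ∧ g.y = 0) ∧ g.z = 0 := by
    constructor
    · rintro rfl; simp
    · rintro ⟨⟨h1, h2⟩, h3⟩; ext <;> simpa
  simp only [h3]
  (split_ifs <;> simp_all); ring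

/-- Traces separate the family: the identity distinguishes dimension 1 from dimension p, (1, 0, 0)
and (0, 1, 0) determine a and b, and the central element (0, 0, 1) determines k. -/
theorem irrep_isCompleteIrreps [Fact p.Prime] (ω : ℂ) (hω : IsPrimitiveRoot ω p) :
    IsCompleteIrreps (irrep ω hω.pow_eq_one) := by
  have hp1 : p ≠ 1 := (Fact.out : p.Prime).ne_one
  have he : (AddChar.zmodChar p hω.pow_eq_one).IsPrimitive :=
    AddChar.zmodChar_primitive_of_primitive_root p hω
  set e := AddChar.zmodChar p hω.pow_eq_one with hedef
  have hinj : ∀ a b : ZMod p, e a = e b → a = b := by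
    intro a b hab
    rw [hedef, AddChar.zmodChar_apply, AddChar.zmodChar_apply] at hab
    exact ZMod.val_injective p (hω.pow_inj (ZMod.val_lt a) (ZMod.val_lt b) hab)
  have hirr : ∀ r, (matrixRep (irrep ω hω.pow_eq_one r)).IsIrreducible := by
    rintro (⟨a, b⟩ | k)
    · exact chi_irreducible e a b
    · exact rho_irreducible he k.ne_zero
  have hdim : ∀ (a b : ZMod p) (k : (ZMod p)ˣ) ,
      (chi e a b 1 : Matrix Unit Unit ℂ).trace ≠
        (rho e k 1 : Matrix (ZMod p) (ZMod p) ℂ).trace := by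
    intro a b k h
    rw [trace_chi, trace_rho he k.ne_zero] at h
    simp only [one_x, one_y, one_z, mul_zero, add_zero, AddChar.map_zero_eq_one, and_self, if_true,
      mul_one] at h
    exact hp1 (by exact_mod_cast h.symm)
  refine ⟨hirr, ?_, ?_⟩
  · rintro (⟨a, b⟩ | k) (⟨a', b'⟩ | k') h
    · have h := trace_eq_of_equiv (chi e a b) (chi e a' b') h
      simp_rw [trace_chi] at h
      have hx := hinj _ _ (h ⟨1, 0, 0⟩)
      have hy := hinj _ _ (h ⟨0, 1, 0⟩)
      simp only [mul_one, mul_zero, add_zero, zero_add] at hx hy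
      rw [hx, hy]
    · exact absurd (trace_eq_of_equiv (chi e a b) (rho e k') h 1) (hdim _ _ _)
    · exact absurd (trace_eq_of_equiv (rho e k) (chi e a' b') h 1).symm (hdim _ _ _)
    · have h := trace_eq_of_equiv (rho e k) (rho e k') h ⟨0, 0, 1⟩
      rw [trace_rho he k.ne_zero, trace_rho he k'.ne_zero] at h
      simp only [and_self, if_true, mul_one] at h
      have := hinj _ _ (mul_left_cancel₀ (NeZero.ne (p : ℂ)) h)
      rw [Units.ext this]
  · intro d σ hσ
    refine exists_equiv_of_regular_character _ hirr (Sum.elim (fun _ => 1) fun _ => (p : ℂ))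
      (fun g => ?_) σ hσ
    have := sum_weighted_traces he g
    rw [Fintype.sum_sum_type, card_eq]
    simp only [Sum.elim_inl, Sum.elim_inr, one_mul]
    push_cast
    exact this

end Heisenberg

/-! ### Circuits and their matrices -/

section Circuits

variable {Q D E : Type} [Fintype Q] [DecidableEq Q] [Fintype D] [DecidableEq D]
  [Fintype E] [DecidableEq E]

theorem mulVec_ket_apply (M : Matrix (Q → Bool) (Q → Bool) ℂ) (s t : Q → Bool) :
    (M *ᵥ ket s) t = M t s := by
  simp [ket]

theorem ket_apply (s t : Q → Bool) : ket s t = if t = s then 1 else 0 := by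
  simp [ket, Pi.single_apply]

theorem sum_smul_ket (ψ : (Q → Bool) → ℂ) : ∑ s, ψ s • ket s = ψ := by
  ext t
  simp [ket_apply]

theorem mulVec_ket (M : Matrix (Q → Bool) (Q → Bool) ℂ) (s : Q → Bool) :
    M *ᵥ ket s = ∑ t, M t s • ket t := by
  rw [sum_smul_ket fun t => M t s]
  ext t
  exact mulVec_ket_apply M s t

theorem matrix_ext_ket {M N : Matrix (Q → Bool) (Q → Bool) ℂ}
    (h : ∀ s, M *ᵥ ket s = N *ᵥ ket s) : M = N := by
  ext t s
  rw [← mulVec_ket_apply M, ← mulVec_ket_apply N, h]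

theorem mulVec_sum_smul {ι : Type} (S : Finset ι) (M : Matrix (Q → Bool) (Q → Bool) ℂ) (c : ι → ℂ)
    (ψ : ι → (Q → Bool) → ℂ) : M *ᵥ ∑ i ∈ S, c i • ψ i = ∑ i ∈ S, c i • (M *ᵥ ψ i) := by
  rw [← Matrix.mulVecLin_apply, map_sum]
  simp

/-- The matrix of a map of basis states. -/
def permMat (φ : (Q → Bool) → (Q → Bool)) : Matrix (Q → Bool) (Q → Bool) ℂ :=
  fun t s => if t = φ s then 1 else 0

theorem permMat_mulVec_ket (φ : (Q → Bool) → (Q → Bool)) (s : Q → Bool) :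
    permMat φ *ᵥ ket s = ket (φ s) := by
  ext t
  rw [mulVec_ket_apply, ket_apply, permMat]

/-- The matrix of a diagonal operator. -/
theorem diagonal_mulVec_ket (f : (Q → Bool) → ℂ) (s : Q → Bool) :
    Matrix.diagonal f *ᵥ ket s = f s • ket s := by
  ext t
  rw [mulVec_ket_apply, Matrix.diagonal_apply, Pi.smul_apply, ket_apply]
  split_ifs with h <;> simp_all

theorem cnot_mulVec_ket (c q : Q) (h : c ≠ q) (s : Q → Bool) :
    (Gate.cnot c q h).matrix *ᵥ ket s = ket (Function.update s q (xor (s q) (s c))) :=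
  permMat_mulVec_ket (fun t => Function.update t q (xor (t q) (t c))) s

theorem single_mulVec_ket (q : Q) (U : Matrix.unitaryGroup Bool ℂ) (s : Q → Bool) :
    (Gate.single q U).matrix *ᵥ ket s =
      ∑ b, (U : Matrix Bool Bool ℂ) b (s q) • ket (Function.update s q b) := by
  ext t
  rw [mulVec_ket_apply, Finset.sum_apply]
  simp only [Pi.smul_apply, ket_apply, Gate.matrix, smul_eq_mul, mul_ite, mul_one, mul_zero]
  have h : ∀ b, t = Function.update s q b ↔ (∀ r, r ≠ q → t r = s r) ∧ b = t q := by
    intro b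
    constructor
    · rintro rfl
      exact ⟨fun r hr => Function.update_of_ne hr _ _, by simp⟩
    · rintro ⟨h, rfl⟩
      ext r
      by_cases hr : r = q
      · subst hr; simp
      · rw [Function.update_of_ne hr, h r hr]
  rw [Finset.sum_eq_single (t q) (fun b _ hb => if_neg fun hh => hb ((h b).1 hh).2) (by simp)]
  simp only [h, and_true]

theorem single_mul (q : Q) (U V : Matrix.unitaryGroup Bool ℂ) :
    (Gate.single q U).matrix * (Gate.single q V).matrix = (Gate.single q (U * V)).matrix := by
  refine matrix_ext_ket fun s => ?_
  rw [← Matrix.mulVec_mulVec]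
  simp only [single_mulVec_ket, mulVec_sum_smul, Function.update_self, Function.update_idem,
    Finset.smul_sum, smul_smul]
  rw [Finset.sum_comm]
  simp only [← Finset.sum_smul]
  refine Finset.sum_congr rfl fun b _ => ?_
  rw [Submonoid.coe_mul, Matrix.mul_apply]
  congr 1
  exact Finset.sum_congr rfl fun c _ => mul_comm _ _

theorem single_one (q : Q) : (Gate.single q 1).matrix = 1 := by
  refine matrix_ext_ket fun s => ?_
  rw [single_mulVec_ket, Matrix.one_mulVec, Finset.sum_eq_single (s q)]
  · simp
  · intro b _ hb
    simp [Matrix.one_apply_ne hb]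
  · simp

theorem cnot_mul_self (c q : Q) (h : c ≠ q) :
    (Gate.cnot c q h).matrix * (Gate.cnot c q h).matrix = 1 := by
  refine matrix_ext_ket fun s => ?_
  rw [← Matrix.mulVec_mulVec, cnot_mulVec_ket, cnot_mulVec_ket, Matrix.one_mulVec]
  simp [Function.update_of_ne h]

/-- The inverse of a gate. -/
def Gate.inv {Q : Type} : Gate Q → Gate Q
  | .single q U => .single q U⁻¹
  | .cnot c q h => .cnot c q h

theorem Gate.inv_matrix_mul (g : Gate Q) : g.inv.matrix * g.matrix = 1 := by
  cases g with
  | single q U => rw [Gate.inv, single_mul, inv_mul_cancel, single_one]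
  | cnot c q h => exact cnot_mul_self c q h

theorem Gate.inv_matrix (g : Gate Q) : g.inv.matrix = g.matrixᴴ := by
  cases g with
  | single q U =>
    ext s t
    rw [Matrix.conjTranspose_apply, Gate.inv]
    simp only [Gate.matrix, eq_comm]
    split_ifs
    · rfl
    · simp
  | cnot c q h =>
    ext s t
    rw [Matrix.conjTranspose_apply, Gate.inv]
    have : s = Function.update t q (xor (t q) (t c)) ↔
        t = Function.update s q (xor (s q) (s c)) := by
      constructor <;> rintro rfl <;> simp [Function.update_of_ne h]
    simp only [Gate.matrix, this]
    split_ifs <;> simp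

theorem circuitMatrix_append (C C' : List (Gate Q)) :
    circuitMatrix (C ++ C') = circuitMatrix C' * circuitMatrix C := by
  induction C with
  | nil => simp [circuitMatrix]
  | cons g C ih => simp [circuitMatrix, ih, Matrix.mul_assoc]

theorem circuitMatrix_singleton (g : Gate Q) : circuitMatrix [g] = g.matrix := by
  simp [circuitMatrix]

/-- The inverse of a circuit. -/
def circuitInv {Q : Type} (C : List (Gate Q)) : List (Gate Q) := (C.map Gate.inv).reverse

theorem circuitInv_length {Q : Type} (C : List (Gate Q)) : (circuitInv C).length = C.length := by
  simp [circuitInv]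

theorem circuitMatrix_inv (C : List (Gate Q)) :
    circuitMatrix (circuitInv C) = (circuitMatrix C)ᴴ := by
  induction C with
  | nil => simp [circuitInv, circuitMatrix]
  | cons g C ih =>
    rw [circuitInv] at ih
    rw [circuitInv, List.map_cons, List.reverse_cons, circuitMatrix_append, ih,
      circuitMatrix_singleton, circuitMatrix, Matrix.conjTranspose_mul, Gate.inv_matrix]

theorem circuitMatrix_unitary (C : List (Gate Q)) :
    (circuitMatrix C)ᴴ * circuitMatrix C = 1 := by
  induction C with
  | nil => simp [circuitMatrix]
  | cons g C ih =>
    rw [circuitMatrix, Matrix.conjTranspose_mul, Matrix.mul_assoc,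
      ← Matrix.mul_assoc _ (circuitMatrix C), ih, Matrix.one_mul, ← Gate.inv_matrix,
      Gate.inv_matrix_mul]

theorem circuitInv_mulVec {C : List (Gate Q)} {ψ φ : (Q → Bool) → ℂ}
    (h : circuitMatrix C *ᵥ ψ = φ) : circuitMatrix (circuitInv C) *ᵥ φ = ψ := by
  rw [← h, circuitMatrix_inv, Matrix.mulVec_mulVec, circuitMatrix_unitary, Matrix.one_mulVec]

/-! ### Operators on some of the qubits -/

/-- The operator `M` acting on the qubits `j d`. -/
def liftMat (j : D → Q) (M : Matrix (D → Bool) (D → Bool) ℂ) :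
    Matrix (Q → Bool) (Q → Bool) ℂ :=
  fun t s => if t = Function.extend j (t ∘ j) s then M (t ∘ j) (s ∘ j) else 0

theorem extend_comp_self {j : D → Q} (s : Q → Bool) : Function.extend j (s ∘ j) s = s := by
  classical
  ext q
  by_cases h : ∃ d, j d = q
  · rw [Function.extend_def, dif_pos h]
    exact congrArg s h.choose_spec
  · rw [Function.extend_apply' _ _ _ h]

theorem extend_comp {j : D → Q} (hj : j.Injective) (u : D → Bool) (s : Q → Bool) :
    Function.extend j u s ∘ j = u :=
  funext fun d => hj.extend_apply u s d

theorem extend_extend {j : D → Q} (hj : j.Injective) (s : Q → Bool) (u v : D → Bool) :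
    Function.extend j v (Function.extend j u s) = Function.extend j v s := by
  ext q
  by_cases h : ∃ d, j d = q
  · obtain ⟨d, rfl⟩ := h
    rw [hj.extend_apply, hj.extend_apply]
  · rw [Function.extend_apply' _ _ _ h, Function.extend_apply' _ _ _ h,
      Function.extend_apply' _ _ _ h]

theorem liftMat_mulVec_ket {j : D → Q} (hj : j.Injective) (M : Matrix (D → Bool) (D → Bool) ℂ)
    (s : Q → Bool) :
    liftMat j M *ᵥ ket s = ∑ u, M u (s ∘ j) • ket (Function.extend j u s) := by
  ext t
  rw [mulVec_ket_apply, Finset.sum_apply]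
  simp only [Pi.smul_apply, ket_apply, smul_eq_mul, mul_ite, mul_one, mul_zero, liftMat]
  have h : ∀ u, t = Function.extend j u s ↔ (t = Function.extend j (t ∘ j) s ∧ u = t ∘ j) := by
    intro u
    constructor
    · intro h
      have : t ∘ j = u := by
        rw [h]
        exact extend_comp hj u s
      exact ⟨by rw [this]; exact h, this.symm⟩
    · rintro ⟨h, rfl⟩
      exact h
  rw [Finset.sum_eq_single (t ∘ j) (fun b _ hb => if_neg fun hh => hb ((h b).1 hh).2) (by simp)]

/-- The linear map on states given by a map of basis states. -/
def ketMap (f : (D → Bool) → (Q → Bool)) : ((D → Bool) → ℂ) →ₗ[ℂ] ((Q → Bool) → ℂ) where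
  toFun ψ := ∑ u, ψ u • ket (f u)
  map_add' ψ φ := by simp [add_smul, Finset.sum_add_distrib]
  map_smul' c ψ := by simp [Finset.smul_sum, smul_smul]

theorem ketMap_ket (f : (D → Bool) → (Q → Bool)) (u : D → Bool) : ketMap f (ket u) = ket (f u) := by
  change ∑ v, _ = _
  simp [ket_apply]

theorem ketMap_mulVec_ket (f : (D → Bool) → (Q → Bool)) (M : Matrix (D → Bool) (D → Bool) ℂ)
    (s : D → Bool) : ketMap f (M *ᵥ ket s) = ∑ t, M t s • ket (f t) := by
  rw [mulVec_ket, map_sum]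
  simp only [map_smul, ketMap_ket]

/-- The embedding of states of the qubits `j d`, the other qubits being as in `s`. -/
def overlay (j : D → Q) (s : Q → Bool) : ((D → Bool) → ℂ) →ₗ[ℂ] ((Q → Bool) → ℂ) :=
  ketMap fun u => Function.extend j u s

theorem overlay_ket (j : D → Q) (s : Q → Bool) (u : D → Bool) :
    overlay j s (ket u) = ket (Function.extend j u s) :=
  ketMap_ket _ _

theorem liftMat_mulVec_overlay {j : D → Q} (hj : j.Injective) (M : Matrix (D → Bool) (D → Bool) ℂ)
    (s : Q → Bool) (ψ : (D → Bool) → ℂ) :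
    liftMat j M *ᵥ overlay j s ψ = overlay j s (M *ᵥ ψ) := by
  have key : ∀ u, liftMat j M *ᵥ overlay j s (ket u) = overlay j s (M *ᵥ ket u) := by
    intro u
    rw [overlay_ket, liftMat_mulVec_ket hj, mulVec_ket M u, map_sum]
    simp only [map_smul, overlay_ket, extend_extend hj, extend_comp hj]
  conv_lhs => rw [← sum_smul_ket ψ]
  conv_rhs => rw [← sum_smul_ket ψ]
  rw [map_sum, mulVec_sum_smul, map_sum]
  simp only [map_smul]
  rw [mulVec_sum_smul]
  exact Finset.sum_congr rfl fun u _ => by rw [key]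

/-- The action of a lifted operator on a basis state is read off on the qubits it acts on. -/
theorem liftMat_mulVec_of {ι : Type} {S : Finset ι} {j : D → Q} (hj : j.Injective)
    {M : Matrix (D → Bool) (D → Bool) ℂ} {c : ι → ℂ} {w : ι → (D → Bool)} (s : Q → Bool)
    (h : M *ᵥ ket (s ∘ j) = ∑ i ∈ S, c i • ket (w i)) :
    liftMat j M *ᵥ ket s = ∑ i ∈ S, c i • ket (Function.extend j (w i) s) := by
  have := liftMat_mulVec_overlay hj M s (ket (s ∘ j))
  rw [overlay_ket, extend_comp_self, h, map_sum] at this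
  rw [this]
  simp only [map_smul, overlay_ket]

theorem liftMat_mulVec_of_eq {j : D → Q} (hj : j.Injective)
    {M : Matrix (D → Bool) (D → Bool) ℂ} {w : D → Bool} (s : Q → Bool)
    (h : M *ᵥ ket (s ∘ j) = ket w) :
    liftMat j M *ᵥ ket s = ket (Function.extend j w s) := by
  have := liftMat_mulVec_overlay hj M s (ket (s ∘ j))
  rwa [overlay_ket, extend_comp_self, h, overlay_ket] at this

theorem liftMat_mul {j : D → Q} (hj : j.Injective) (M N : Matrix (D → Bool) (D → Bool) ℂ) :
    liftMat j (M * N) = liftMat j M * liftMat j N := by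
  refine matrix_ext_ket fun s => ?_
  have := liftMat_mulVec_overlay hj N s (ket (s ∘ j))
  rw [overlay_ket, extend_comp_self] at this
  rw [← Matrix.mulVec_mulVec, this, liftMat_mulVec_overlay hj, Matrix.mulVec_mulVec,
    ← liftMat_mulVec_overlay hj, overlay_ket, extend_comp_self]

theorem liftMat_one {j : D → Q} (hj : j.Injective) : liftMat j 1 = 1 := by
  refine matrix_ext_ket fun s => ?_
  rw [liftMat_mulVec_of_eq hj s (Matrix.one_mulVec _), extend_comp_self, Matrix.one_mulVec]

/-- A gate moved along an injection of qubits. -/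
def Gate.map {D Q : Type} (j : D → Q) (hj : j.Injective) : Gate D → Gate Q
  | .single q U => .single (j q) U
  | .cnot c q h => .cnot (j c) (j q) (hj.ne h)

theorem extend_update {j : D → Q} (hj : j.Injective) (s : Q → Bool) (d : D) (b : Bool) :
    Function.extend j (Function.update (s ∘ j) d b) s = Function.update s (j d) b := by
  ext q
  by_cases h : ∃ d, j d = q
  · obtain ⟨d', rfl⟩ := h
    rw [hj.extend_apply]
    by_cases hd : d' = d
    · subst hd; simp
    · rw [Function.update_of_ne hd, Function.update_of_ne (hj.ne hd), Function.comp_apply]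
  · rw [Function.extend_apply' _ _ _ h, Function.update_of_ne]
    rintro rfl
    exact h ⟨d, rfl⟩

theorem Gate.map_matrix {j : D → Q} (hj : j.Injective) (g : Gate D) :
    (g.map j hj).matrix = liftMat j g.matrix := by
  refine matrix_ext_ket fun s => ?_
  cases g with
  | single q U =>
    rw [liftMat_mulVec_of hj s (single_mulVec_ket q U (s ∘ j)), Gate.map, single_mulVec_ket]
    simp [extend_update hj]
  | cnot c q h =>
    rw [liftMat_mulVec_of_eq hj s (cnot_mulVec_ket c q h (s ∘ j)), Gate.map, cnot_mulVec_ket,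
      extend_update hj]
    rfl

theorem circuitMatrix_map {j : D → Q} (hj : j.Injective) (C : List (Gate D)) :
    circuitMatrix (C.map (Gate.map j hj)) = liftMat j (circuitMatrix C) := by
  induction C with
  | nil => simp [circuitMatrix, liftMat_one hj]
  | cons g C ih => simp [circuitMatrix, ih, liftMat_mul hj, Gate.map_matrix]

end Circuits

/-! ### Operators implemented with ancillas -/

section Impl

variable {Q D E : Type} [Fintype Q] [DecidableEq Q] [Fintype D] [DecidableEq D]
  [Fintype E] [DecidableEq E]

/-- The state `s` together with ancillas `0`. -/
abbrev pad (E : Type) {D : Type} (s : D → Bool) : D ⊕ E → Bool := Sum.elim s fun _ => false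

/-- The operator `M` is computed, with ancillas that start and end in state `0`, by a circuit of at
most `k` gates. -/
def Impl (D : Type) [Fintype D] [DecidableEq D] (k : ℕ) (M : Matrix (D → Bool) (D → Bool) ℂ) :
    Prop :=
  ∃ (A : Type) (_ : Fintype A) (_ : DecidableEq A) (C : List (Gate (D ⊕ A))), C.length ≤ k ∧
    ∀ s, circuitMatrix C *ᵥ ket (pad A s) = ∑ t, M t s • ket (pad A t)

theorem Impl.mono {k l : ℕ} {M : Matrix (D → Bool) (D → Bool) ℂ} (h : Impl D k M) (hkl : k ≤ l) :
    Impl D l M := by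
  obtain ⟨A, _, _, C, hC, h⟩ := h
  exact ⟨A, _, _, C, hC.trans hkl, h⟩

theorem Impl.of_circuit (C : List (Gate D)) : Impl D C.length (circuitMatrix C) := by
  refine ⟨Empty, inferInstance, inferInstance, C.map (Gate.map Sum.inl Sum.inl_injective),
    by simp, fun s => ?_⟩
  rw [circuitMatrix_map, liftMat_mulVec_of Sum.inl_injective _ (mulVec_ket _ _)]
  refine Finset.sum_congr rfl fun t _ => ?_
  congr 2
  ext (d | e)
  · exact Sum.inl_injective.extend_apply _ _ _
  · exact e.elim

theorem pad_injective : Function.Injective (pad E : (D → Bool) → D ⊕ E → Bool) := by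
  intro s t h
  ext d
  exact congrFun h (Sum.inl d)

theorem extend_sumMap_left {A : Type} {j : D → Q} (hj : j.Injective) (t : D → Bool) (s : Q → Bool) :
    Function.extend (Sum.map j (id : A → A)) (pad A t) (pad A s) =
      pad A (Function.extend j t s) := by
  have hj' : (Sum.map j (id : A → A)).Injective := Sum.map_injective.2 ⟨hj, Function.injective_id⟩
  ext (q | a)
  · by_cases h : ∃ d, j d = q
    · obtain ⟨d, rfl⟩ := h
      exact (hj'.extend_apply _ _ (Sum.inl d)).trans (hj.extend_apply t s d).symm
    · refine (Function.extend_apply' _ _ _ ?_).trans (Function.extend_apply' _ _ _ h).symm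
      rintro ⟨d | a, hd⟩
      · exact h ⟨d, Sum.inl_injective hd⟩
      · cases hd
  · exact hj'.extend_apply _ _ (Sum.inr a)

theorem extend_sumMap_right {A B : Type} {j : A → B} (hj : j.Injective) (t s : D → Bool) :
    Function.extend (Sum.map (id : D → D) j) (pad A t) (pad B s) = pad B t := by
  have hj' : (Sum.map (id : D → D) j).Injective := Sum.map_injective.2 ⟨Function.injective_id, hj⟩
  ext (q | b)
  · exact hj'.extend_apply _ _ (Sum.inl q)
  · by_cases h : ∃ a, j a = b
    · obtain ⟨a, rfl⟩ := h
      exact hj'.extend_apply _ _ (Sum.inr a)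
    · refine Function.extend_apply' _ _ _ ?_
      rintro ⟨d | a, hd⟩
      · cases hd
      · exact h ⟨a, Sum.inr_injective hd⟩

/-- More ancillas do not harm. -/
theorem circuit_more_ancillas {A B : Type} [Fintype A] [DecidableEq A] [Fintype B] [DecidableEq B]
    {j : A → B} (hj : j.Injective) {C : List (Gate (D ⊕ A))} {ι : Type} {S : Finset ι} {c : ι → ℂ}
    {w : ι → D → Bool} {s : D → Bool}
    (h : circuitMatrix C *ᵥ ket (pad A s) = ∑ i ∈ S, c i • ket (pad A (w i))) :
    circuitMatrix (C.map (Gate.map (Sum.map (id : D → D) j)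
      (Sum.map_injective.2 ⟨Function.injective_id, hj⟩))) *ᵥ ket (pad B s) =
      ∑ i ∈ S, c i • ket (pad B (w i)) := by
  rw [circuitMatrix_map, liftMat_mulVec_of (w := fun i => pad A (w i)) (S := S) (c := c)]
  · simp only [extend_sumMap_right hj]
  · exact Sum.map_injective.2 ⟨Function.injective_id, hj⟩
  · rw [← h]
    congr 2
    ext (d | a) <;> rfl

theorem Impl.mul {k l : ℕ} {M N : Matrix (D → Bool) (D → Bool) ℂ} (hM : Impl D k M)
    (hN : Impl D l N) : Impl D (l + k) (M * N) := by
  obtain ⟨A, _, _, C, hC, hM⟩ := hM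
  obtain ⟨B, _, _, C', hC', hN⟩ := hN
  have hM := fun s => circuit_more_ancillas (Sum.inl_injective (α := A) (β := B)) (hM s)
  have hN := fun s => circuit_more_ancillas (Sum.inr_injective (α := A) (β := B)) (hN s)
  refine ⟨A ⊕ B, inferInstance, inferInstance,
    C'.map (Gate.map _ (Sum.map_injective.2 ⟨Function.injective_id, Sum.inr_injective⟩)) ++
      C.map (Gate.map _ (Sum.map_injective.2 ⟨Function.injective_id, Sum.inl_injective⟩)),
    ?_, fun s => ?_⟩
  rotate_left
  · rw [circuitMatrix_append, ← Matrix.mulVec_mulVec, hN, mulVec_sum_smul]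
    simp only [hM, Finset.smul_sum, smul_smul]
    rw [Finset.sum_comm]
    simp only [← Finset.sum_smul]
    refine Finset.sum_congr rfl fun t _ => ?_
    rw [Matrix.mul_apply]
    congr 1
    exact Finset.sum_congr rfl fun c _ => mul_comm _ _
  · simp only [List.length_append, List.length_map]
    omega

theorem Impl.lift {k : ℕ} {M : Matrix (D → Bool) (D → Bool) ℂ} (hM : Impl D k M) {j : D → Q}
    (hj : j.Injective) : Impl Q k (liftMat j M) := by
  obtain ⟨A, _, _, C, hC, hM⟩ := hM
  have hj' : (Sum.map j (id : A → A)).Injective := Sum.map_injective.2 ⟨hj, Function.injective_id⟩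
  refine ⟨A, inferInstance, inferInstance, C.map (Gate.map _ hj'), by simpa using hC, fun s => ?_⟩
  have h2 : pad A s ∘ Sum.map j id = pad A (s ∘ j) := by
    ext (d | a) <;> rfl
  rw [← ketMap_mulVec_ket (pad A) (liftMat j M), liftMat_mulVec_ket hj, map_sum,
    circuitMatrix_map, liftMat_mulVec_of hj' _ (by rw [h2]; exact hM (s ∘ j))]
  simp only [extend_sumMap_left hj, map_smul, ketMap_ket]

/-- An operator on `D` obtained from one on `D ⊕ E` that keeps the qubits of `E` in state `0`. -/
theorem Impl.hide {k : ℕ} {M : Matrix (D ⊕ E → Bool) (D ⊕ E → Bool) ℂ} (hM : Impl (D ⊕ E) k M)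
    {N : Matrix (D → Bool) (D → Bool) ℂ}
    (h : ∀ s, M *ᵥ ket (pad E s) = ∑ t, N t s • ket (pad E t)) : Impl D k N := by
  obtain ⟨A, _, _, C, hC, hM⟩ := hM
  let j : (D ⊕ E) ⊕ A → D ⊕ (E ⊕ A) := Equiv.sumAssoc D E A
  have hj : j.Injective := (Equiv.sumAssoc D E A).injective
  refine ⟨E ⊕ A, inferInstance, inferInstance, C.map (Gate.map j hj), by simpa using hC,
    fun s => ?_⟩
  have h1 : circuitMatrix C *ᵥ ket (pad A (pad E s)) = ∑ t, N t s • ket (pad A (pad E t)) := by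
    rw [hM, ← ketMap_mulVec_ket, h, map_sum]
    simp only [map_smul, ketMap_ket]
  rw [circuitMatrix_map, liftMat_mulVec_of hj _ (w := fun t => pad A (pad E t)) (S := Finset.univ)
    (c := fun t => N t s)]
  · refine Finset.sum_congr rfl fun t _ => ?_
    congr 2
    ext (d | (e | a))
    · exact hj.extend_apply _ _ (Sum.inl (Sum.inl d))
    · exact hj.extend_apply _ _ (Sum.inl (Sum.inr e))
    · exact hj.extend_apply _ _ (Sum.inr a)
  · rw [← h1]
    congr 2
    ext ((d | e) | a) <;> rfl

/-- The circuit is unitary and preserves the span of the states whose ancillas are 0; M is its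
restriction to this span. -/
theorem Impl.unitary {k : ℕ} {M : Matrix (D → Bool) (D → Bool) ℂ} (hM : Impl D k M) :
    Mᴴ * M = 1 := by
  obtain ⟨A, _, _, C, hC, hM⟩ := hM
  have hent : ∀ t s, circuitMatrix C t (pad A s) = ∑ u, M u s * ket (pad A u) t := by
    intro t s
    rw [← mulVec_ket_apply (circuitMatrix C), hM, Finset.sum_apply]
    simp
  ext s s'
  have h := congrFun (congrFun (circuitMatrix_unitary C) (pad A s)) (pad A s')
  rw [Matrix.mul_apply] at h ⊢
  simp only [Matrix.conjTranspose_apply, hent, star_sum, ket_apply, Finset.sum_mul_sum,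
    apply_ite star, star_zero, mul_ite, mul_one, mul_zero, ite_mul, zero_mul] at h ⊢
  rw [Matrix.one_apply] at h ⊢
  simp only [pad_injective.eq_iff] at h
  rw [← h, Finset.sum_comm]
  refine Finset.sum_congr rfl fun u _ => ?_
  rw [Finset.sum_comm, Finset.sum_eq_single u]
  · simp
  · intro v _ hv
    refine Finset.sum_eq_zero fun t _ => ?_
    by_cases h1 : t = pad A u
    · rw [if_neg]
      rw [h1]
      exact fun h => hv (pad_injective h).symm
    · simp [h1]
  · simp

/-- The reversed circuit works with clean ancillas because M is also surjective: by M Mᴴ = 1 the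
circuit maps the padded column s of Mᴴ to the padded |s⟩. -/
theorem Impl.conjTranspose {k : ℕ} {M : Matrix (D → Bool) (D → Bool) ℂ} (hM : Impl D k M) :
    Impl D k Mᴴ := by
  have hu : M * Mᴴ = 1 := mul_eq_one_comm.1 hM.unitary
  obtain ⟨A, _, _, C, hC, hM⟩ := hM
  refine ⟨A, inferInstance, inferInstance, circuitInv C, by rwa [circuitInv_length], fun s => ?_⟩
  refine circuitInv_mulVec ?_
  rw [mulVec_sum_smul]
  simp only [hM, Finset.smul_sum, smul_smul]
  rw [Finset.sum_comm]
  simp only [← Finset.sum_smul]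
  rw [Finset.sum_eq_single s]
  · have := congrFun (congrFun hu s) s
    rw [Matrix.mul_apply, Matrix.one_apply_eq] at this
    rw [Finset.sum_congr rfl fun c _ => mul_comm _ _, this, one_smul]
  · intro t _ ht
    have := congrFun (congrFun hu t) s
    rw [Matrix.mul_apply, Matrix.one_apply_ne ht] at this
    rw [Finset.sum_congr rfl fun c _ => mul_comm _ _, this, zero_smul]
  · simp

theorem Impl.one : Impl D 0 (1 : Matrix (D → Bool) (D → Bool) ℂ) := by
  simpa [circuitMatrix] using Impl.of_circuit ([] : List (Gate D))

end Impl

/-! ### Diagonal operators -/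

section Diagonal

variable {Q D E : Type} [Fintype Q] [DecidableEq Q] [Fintype D] [DecidableEq D]

/-- The phase `e^{iθ}`. -/
def phase (θ : ℝ) : ℂ := Complex.exp (θ * Complex.I)

theorem phase_add (θ φ : ℝ) : phase (θ + φ) = phase θ * phase φ := by
  rw [phase, phase, phase, ← Complex.exp_add]
  push_cast
  ring_nf

theorem phase_zero : phase 0 = 1 := by simp [phase]

theorem star_phase (θ : ℝ) : star (phase θ) = phase (-θ) := by
  rw [phase, phase, ← starRingEnd_apply, ← Complex.exp_conj]
  simp

theorem phase_neg_mul_self (θ : ℝ) : phase (-θ) * phase θ = 1 := by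
  rw [← phase_add, neg_add_cancel, phase_zero]

theorem exists_phase_eq {z : ℂ} (hz : ‖z‖ = 1) : ∃ θ, z = phase θ := by
  refine ⟨z.arg, ?_⟩
  have := Complex.norm_mul_exp_arg_mul_I z
  rw [hz, Complex.ofReal_one, one_mul] at this
  exact this.symm

/-- The diagonal unitary matrix with entries `e^{iα b}`. -/
def diagUnitary (α : Bool → ℝ) : Matrix.unitaryGroup Bool ℂ :=
  ⟨Matrix.diagonal fun b => phase (α b), Matrix.mem_unitaryGroup_iff'.2 (by
    rw [Matrix.star_eq_conjTranspose, Matrix.diagonal_conjTranspose, Matrix.diagonal_mul_diagonal,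
      ← Matrix.diagonal_one]
    congr 1
    ext b
    simp only [Pi.star_apply, star_phase, phase_neg_mul_self])⟩

/-- The diagonal operator with entries `f s` is computed by at most `k` gates. -/
def DiagCircuit (k : ℕ) (f : (Q → Bool) → ℂ) : Prop :=
  ∃ C : List (Gate Q), C.length ≤ k ∧ circuitMatrix C = Matrix.diagonal f

theorem DiagCircuit.mul {k l : ℕ} {f g : (Q → Bool) → ℂ} (hf : DiagCircuit k f)
    (hg : DiagCircuit l g) : DiagCircuit (k + l) fun s => f s * g s := by
  obtain ⟨C, hC, hf⟩ := hf
  obtain ⟨C', hC', hg⟩ := hg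
  refine ⟨C' ++ C, by rw [List.length_append]; omega, ?_⟩
  rw [circuitMatrix_append, hf, hg, Matrix.diagonal_mul_diagonal]

theorem DiagCircuit.one : DiagCircuit 0 fun _ : Q → Bool => (1 : ℂ) :=
  ⟨[], by simp, by simp [circuitMatrix]⟩

theorem DiagCircuit.mono {k l : ℕ} {f : (Q → Bool) → ℂ} (hf : DiagCircuit k f) (h : k ≤ l) :
    DiagCircuit l f := by
  obtain ⟨C, hC, hf⟩ := hf
  exact ⟨C, hC.trans h, hf⟩

theorem DiagCircuit.impl {k : ℕ} {f : (Q → Bool) → ℂ} (hf : DiagCircuit k f) :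
    Impl Q k (Matrix.diagonal f) := by
  obtain ⟨C, hC, hf⟩ := hf
  exact hf ▸ (Impl.of_circuit C).mono hC

theorem DiagCircuit.congr {k : ℕ} {f g : (Q → Bool) → ℂ} (hf : DiagCircuit k f)
    (h : ∀ s, f s = g s) : DiagCircuit k g :=
  (funext h : f = g) ▸ hf

theorem diagCircuit_phase (q : Q) (α : Bool → ℝ) :
    DiagCircuit 1 fun s : Q → Bool => phase (α (s q)) := by
  refine ⟨[.single q (diagUnitary α)], le_rfl, matrix_ext_ket fun s => ?_⟩
  rw [circuitMatrix_singleton, single_mulVec_ket, diagonal_mulVec_ket,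
    Finset.sum_eq_single (s q)]
  · simp [diagUnitary]
  · intro b _ hb
    simp [diagUnitary, Matrix.diagonal_apply_ne _ hb]
  · simp

theorem DiagCircuit.conj_cnot {k : ℕ} {f : (Q → Bool) → ℂ} (hf : DiagCircuit k f) {c q : Q}
    (h : c ≠ q) :
    DiagCircuit (k + 2) fun s => f (Function.update s q (xor (s q) (s c))) := by
  obtain ⟨C, hC, hf⟩ := hf
  refine ⟨.cnot c q h :: (C ++ [.cnot c q h]), ?_, matrix_ext_ket fun s => ?_⟩
  · rw [List.length_cons, List.length_append, List.length_singleton]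
    omega
  · rw [circuitMatrix, circuitMatrix_append, hf, circuitMatrix_singleton, ← Matrix.mulVec_mulVec,
      ← Matrix.mulVec_mulVec, cnot_mulVec_ket, diagonal_mulVec_ket, Matrix.mulVec_smul,
      cnot_mulVec_ket, diagonal_mulVec_ket]
    simp [Function.update_of_ne h]

/-- For bits, 2ab = a + b - (a ⊕ b). So three one-qubit phases of angle ±θ/2 suffice, the last one
between two CNOTs. -/
theorem diagCircuit_cphase {a b : Q} (h : a ≠ b) (θ : ℝ) :
    DiagCircuit 5 fun s : Q → Bool => phase (if s a && s b then θ else 0) := by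
  have h1 := diagCircuit_phase a fun x => if x then θ / 2 else 0
  have h2 := diagCircuit_phase b fun x => if x then θ / 2 else 0
  have h3 := (diagCircuit_phase b fun x => if x then -(θ / 2) else 0).conj_cnot h
  refine ((h1.mul h2).mul h3).congr fun s => ?_
  rw [← phase_add, ← phase_add]
  congr 1
  cases s a <;> cases s b <;> simp

/-- The same identity multiplied by c: 2abc = bc + ac - (a ⊕ b)c, with 5 + 5 + 7 gates. -/
theorem diagCircuit_ccphase {a b c : Q} (hab : a ≠ b) (hac : a ≠ c) (hbc : b ≠ c) (θ : ℝ) :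
    DiagCircuit 17 fun s : Q → Bool => phase (if s a && s b && s c then θ else 0) := by
  have h1 := diagCircuit_cphase hbc (θ / 2)
  have h2 := diagCircuit_cphase hac (θ / 2)
  have h3 := (diagCircuit_cphase hbc (-(θ / 2))).conj_cnot hab
  refine ((h1.mul h2).mul h3).congr fun s => ?_
  rw [← phase_add, ← phase_add]
  congr 1
  cases s a <;> cases s b <;> cases hc : s c <;> simp [hc, Function.update_of_ne hbc.symm]

theorem diagCircuit_quadratic (θ : Q → Q → ℝ) :
    DiagCircuit (5 * Fintype.card Q ^ 2) fun s : Q → Bool =>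
      phase (∑ i, ∑ j, θ i j * ((s i).toNat * (s j).toNat)) := by
  have key : ∀ S : Finset (Q × Q), DiagCircuit (5 * S.card) fun s : Q → Bool =>
      phase (∑ ij ∈ S, θ ij.1 ij.2 * ((s ij.1).toNat * (s ij.2).toNat)) := by
    intro S
    induction S using Finset.induction_on with
    | empty => simpa [phase_zero] using DiagCircuit.one
    | insert a S ha ih =>
      have h1 : DiagCircuit 5 fun s : Q → Bool =>
          phase (θ a.1 a.2 * ((s a.1).toNat * (s a.2).toNat)) := by
        by_cases h : a.1 = a.2
        · refine ((diagCircuit_phase a.1 fun x => if x then θ a.1 a.2 else 0).mono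
            (by norm_num)).congr fun s => ?_
          rw [← h]
          cases s a.1 <;> simp
        · refine (diagCircuit_cphase h (θ a.1 a.2)).congr fun s => ?_
          cases s a.1 <;> cases s a.2 <;> simp
      refine ((ih.mul h1).mono ?_).congr fun s => ?_
      · rw [Finset.card_insert_of_notMem ha]
        omega
      · rw [Finset.sum_insert ha, add_comm, phase_add]
  refine ((key Finset.univ).mono ?_).congr fun s => ?_
  · rw [Finset.card_univ, Fintype.card_prod, pow_two]
  · rw [Fintype.sum_prod_type]

end Diagonal

/-! ### Controlled gates -/

section Controlled

variable {Q D E : Type} [Fintype Q] [DecidableEq Q] [Fintype D] [DecidableEq D]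

/-- Completing a unit vector to a unitary matrix. -/
theorem exists_unitary_column (u v : ℂ) (h : star u * u + star v * v = 1) :
    ∃ V : Matrix.unitaryGroup Bool ℂ, (V : Matrix Bool Bool ℂ) false false = u ∧
      (V : Matrix Bool Bool ℂ) true false = v := by
  refine ⟨⟨Matrix.of fun i j => bif j then (bif i then star u else -star v) else
    (bif i then v else u), Matrix.mem_unitaryGroup_iff'.2 ?_⟩, rfl, rfl⟩
  ext i j
  rw [Matrix.mul_apply, Fintype.sum_bool]
  cases i <;> cases j <;>
    simp only [Matrix.star_apply, Matrix.of_apply, cond_true, cond_false, star_neg, star_star,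
      Matrix.one_apply_eq, Matrix.one_apply_ne, ne_eq, reduceCtorEq, not_false_eq_true]
  · rw [add_comm, h]
  · ring
  · ring
  · rw [← h]
    ring

/-- A normalised eigenvector is completed to a unitary V. Then V⁻¹UV is unitary and upper
triangular, hence diagonal with entries of modulus 1. -/
theorem exists_diagonalization (U : Matrix.unitaryGroup Bool ℂ) :
    ∃ (V : Matrix.unitaryGroup Bool ℂ) (α : Bool → ℝ), U = V * diagUnitary α * V⁻¹ := by
  obtain ⟨μ, hμ⟩ := Module.End.exists_eigenvalue (Matrix.toLin' (U : Matrix Bool Bool ℂ))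
  obtain ⟨v, hv⟩ := hμ.exists_hasEigenvector
  have hv1 : (U : Matrix Bool Bool ℂ) *ᵥ v = μ • v := by
    rw [← Matrix.toLin'_apply]
    exact hv.apply_eq_smul
  have hpos : 0 < ‖v false‖ ^ 2 + ‖v true‖ ^ 2 := by
    by_contra hle
    have h0 : ‖v false‖ = 0 := by nlinarith [sq_nonneg ‖v false‖, sq_nonneg ‖v true‖]
    have h1 : ‖v true‖ = 0 := by nlinarith [sq_nonneg ‖v false‖, sq_nonneg ‖v true‖]
    refine hv.2 (funext fun b => ?_)
    cases b
    · exact norm_eq_zero.1 h0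
    · exact norm_eq_zero.1 h1
  set r : ℝ := Real.sqrt (‖v false‖ ^ 2 + ‖v true‖ ^ 2) with hr
  have hr0 : (r : ℂ) ≠ 0 := Complex.ofReal_ne_zero.2 (Real.sqrt_pos.2 hpos).ne'
  have hr2 : (r : ℂ) ^ 2 = star (v false) * v false + star (v true) * v true := by
    rw [← Complex.ofReal_pow, hr, Real.sq_sqrt hpos.le, ← starRingEnd_apply, ← starRingEnd_apply,
      Complex.conj_mul', Complex.conj_mul']
    push_cast
    rfl
  have hunit : star (v false / r) * (v false / r) + star (v true / r) * (v true / r) = 1 := by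
    have hs : star (r : ℂ) = r := Complex.conj_ofReal r
    rw [star_div₀, star_div₀, hs, div_mul_div_comm, div_mul_div_comm, ← add_div, ← hr2, pow_two]
    exact div_self (mul_ne_zero hr0 hr0)
  obtain ⟨V, hV0, hV1⟩ := exists_unitary_column _ _ hunit
  set T : Matrix.unitaryGroup Bool ℂ := V⁻¹ * U * V with hT
  have hcol : (V : Matrix Bool Bool ℂ) *ᵥ Pi.single false 1 = (r : ℂ)⁻¹ • v := by
    ext b
    rw [Matrix.mulVec_single_one, Pi.smul_apply, smul_eq_mul, Matrix.col_apply]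
    cases b
    · rw [hV0, div_eq_inv_mul]
    · rw [hV1, div_eq_inv_mul]
  have hTcol : (T : Matrix Bool Bool ℂ) *ᵥ Pi.single false 1 = μ • Pi.single false 1 := by
    have h2 : ((V⁻¹ : Matrix.unitaryGroup Bool ℂ) : Matrix Bool Bool ℂ) *ᵥ ((r : ℂ)⁻¹ • v) =
        Pi.single false 1 := by
      rw [← hcol, Matrix.mulVec_mulVec, ← Submonoid.coe_mul, inv_mul_cancel,
        OneMemClass.coe_one, Matrix.one_mulVec]
    rw [hT, Submonoid.coe_mul, Submonoid.coe_mul, ← Matrix.mulVec_mulVec, hcol,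
      ← Matrix.mulVec_mulVec, Matrix.mulVec_smul, hv1, smul_comm, Matrix.mulVec_smul, h2]
  have hff : (T : Matrix Bool Bool ℂ) false false = μ := by
    simpa using congrFun hTcol false
  have htf : (T : Matrix Bool Bool ℂ) true false = 0 := by
    simpa using congrFun hTcol true
  have hTT := Matrix.mem_unitaryGroup_iff'.1 T.2
  have hent : ∀ i j, star ((T : Matrix Bool Bool ℂ) true i) * (T : Matrix Bool Bool ℂ) true j +
      star ((T : Matrix Bool Bool ℂ) false i) * (T : Matrix Bool Bool ℂ) false j =
      if i = j then 1 else 0 := by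
    intro i j
    have := congrFun (congrFun hTT i) j
    rw [Matrix.mul_apply, Fintype.sum_bool, Matrix.one_apply] at this
    exact this
  have hμμ : star μ * μ = 1 := by
    have := hent false false
    rw [hff, htf] at this
    simpa using this
  have hμ0 : star μ ≠ 0 := left_ne_zero_of_mul_eq_one hμμ
  have hft : (T : Matrix Bool Bool ℂ) false true = 0 := by
    have := hent false true
    rw [hff, htf, star_zero, zero_mul, zero_add, if_neg (by simp)] at this
    exact (mul_eq_zero.1 this).resolve_left hμ0
  have hnorm : ∀ z : ℂ, star z * z = 1 → ‖z‖ = 1 := by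
    intro z hz
    have := congrArg norm hz
    rw [norm_mul, norm_star, norm_one] at this
    nlinarith [norm_nonneg z]
  have htt : star ((T : Matrix Bool Bool ℂ) true true) *
      (T : Matrix Bool Bool ℂ) true true = 1 := by
    have := hent true true
    rw [hft] at this
    simpa using this
  obtain ⟨α, hα⟩ := exists_phase_eq (hnorm _ hμμ)
  obtain ⟨β, hβ⟩ := exists_phase_eq (hnorm _ htt)
  refine ⟨V, fun b => bif b then β else α, ?_⟩
  have : diagUnitary (fun b => bif b then β else α) = T := by
    refine Subtype.ext ?_
    ext i j
    cases i <;> cases j <;> simp [diagUnitary, hff, htf, hft, hα, hβ]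
  rw [this, hT]
  group

/-- A one-qubit unitary controlled by a condition on the other qubits. -/
theorem exists_circuit_conj_diagonal {k : ℕ} {f : (Q → Bool) → ℂ} (hf : DiagCircuit k f) (q : Q)
    (V : Matrix.unitaryGroup Bool ℂ) (α : Bool → ℝ) (P : (Q → Bool) → Bool)
    (hP : ∀ s b, P (Function.update s q b) = P s)
    (hfP : ∀ s, f s = if P s then phase (α (s q)) else 1) :
    ∃ C : List (Gate Q), C.length ≤ k + 2 ∧ ∀ s, circuitMatrix C *ᵥ ket s =
      if P s then (Gate.single q (V * diagUnitary α * V⁻¹)).matrix *ᵥ ket s else ket s := by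
  obtain ⟨C, hC, hf⟩ := hf
  refine ⟨.single q V⁻¹ :: (C ++ [.single q V]), ?_, fun s => ?_⟩
  · rw [List.length_cons, List.length_append, List.length_singleton]
    omega
  rw [circuitMatrix, circuitMatrix_append, hf, circuitMatrix_singleton, ← Matrix.mulVec_mulVec,
    ← Matrix.mulVec_mulVec]
  have hmid : ∀ b, Matrix.diagonal f *ᵥ ket (Function.update s q b) =
      if P s then (Gate.single q (diagUnitary α)).matrix *ᵥ ket (Function.update s q b)
      else ket (Function.update s q b) := by
    intro b
    rw [diagonal_mulVec_ket, hfP, hP]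
    split_ifs
    · rw [single_mulVec_ket, Finset.sum_eq_single b]
      · simp [diagUnitary]
      · intro c _ hc
        simp [diagUnitary, Matrix.diagonal_apply_ne _ hc]
      · simp
    · rw [one_smul]
  split_ifs with h
  · simp only [h, if_true] at hmid
    rw [single_mulVec_ket q V⁻¹, mulVec_sum_smul]
    simp only [hmid]
    rw [← mulVec_sum_smul, ← single_mulVec_ket, Matrix.mulVec_mulVec, single_mul,
      Matrix.mulVec_mulVec, single_mul, mul_assoc]
  · simp only [if_neg h] at hmid
    rw [single_mulVec_ket q V⁻¹, mulVec_sum_smul]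
    simp only [hmid]
    rw [← single_mulVec_ket, Matrix.mulVec_mulVec, single_mul, mul_inv_cancel,
      single_one, Matrix.one_mulVec]

/-- In U = V diag(α) V⁻¹ only the diagonal factor has to be controlled, since V and V⁻¹ cancel when
it is absent. This takes 8 gates; the bound 24 is the one of `exists_circuit_toffoli`. -/
theorem exists_circuit_controlled_single {c q : Q} (h : c ≠ q) (U : Matrix.unitaryGroup Bool ℂ) :
    ∃ C : List (Gate Q), C.length ≤ 24 ∧ ∀ s, circuitMatrix C *ᵥ ket s =
      if s c then (Gate.single q U).matrix *ᵥ ket s else ket s := by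
  obtain ⟨V, α, hU⟩ := exists_diagonalization U
  have h1 := (diagCircuit_phase c fun x => if x then α false else 0).mul
    (diagCircuit_cphase h (α true - α false))
  obtain ⟨C, hC, hact⟩ := exists_circuit_conj_diagonal h1 q V α (fun s => s c)
    (fun s b => by rw [Function.update_of_ne h]) (fun s => by
      rw [← phase_add]
      cases s c <;> cases s q <;> simp [phase_zero])
  exact ⟨C, hC.trans (by norm_num), by rwa [hU]⟩

/-- The one-qubit gate `NOT`. -/
def notUnitary : Matrix.unitaryGroup Bool ℂ :=
  ⟨Matrix.of fun i j => if i = !j then 1 else 0, Matrix.mem_unitaryGroup_iff'.2 (by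
    ext i j
    rw [Matrix.mul_apply, Fintype.sum_bool]
    cases i <;> cases j <;> simp)⟩

theorem not_mulVec_ket (q : Q) (s : Q → Bool) :
    (Gate.single q notUnitary).matrix *ᵥ ket s = ket (Function.update s q (!s q)) := by
  rw [single_mulVec_ket, Finset.sum_eq_single (!s q)]
  · simp [notUnitary]
  · intro b _ hb
    simp [notUnitary, hb]
  · simp

/-- NOT is diagonalised and its diagonal factor is controlled by both bits: 5 + 17 gates for the
phases and 2 for the change of basis. -/
theorem exists_circuit_toffoli {a b q : Q} (hab : a ≠ b) (haq : a ≠ q) (hbq : b ≠ q) :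
    ∃ C : List (Gate Q), C.length ≤ 24 ∧ ∀ s, circuitMatrix C *ᵥ ket s =
      ket (Function.update s q (xor (s q) (s a && s b))) := by
  obtain ⟨V, α, hU⟩ := exists_diagonalization notUnitary
  have h1 := (diagCircuit_cphase hab (α false)).mul
    (diagCircuit_ccphase hab haq hbq (α true - α false))
  obtain ⟨C, hC, hact⟩ := exists_circuit_conj_diagonal h1 q V α (fun s => s a && s b)
    (fun s x => by rw [Function.update_of_ne haq, Function.update_of_ne hbq]) (fun s => by
      rw [← phase_add]
      cases s a <;> cases s b <;> cases s q <;> simp [phase_zero])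
  refine ⟨C, hC, fun s => ?_⟩
  rw [hact, ← hU, not_mulVec_ket]
  split_ifs with h
  · simp [h]
  · simp [h]

/-- The operator `M` on `D` controlled by one more qubit. -/
def ctrlMat (M : Matrix (D → Bool) (D → Bool) ℂ) :
    Matrix (D ⊕ Unit → Bool) (D ⊕ Unit → Bool) ℂ :=
  fun t s => if s (Sum.inr ()) then liftMat Sum.inl M t s else (1 : Matrix _ _ ℂ) t s

theorem ctrlMat_mulVec_ket (M : Matrix (D → Bool) (D → Bool) ℂ) (s : D ⊕ Unit → Bool) :
    ctrlMat M *ᵥ ket s = if s (Sum.inr ()) then liftMat Sum.inl M *ᵥ ket s else ket s := by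
  ext t
  rw [mulVec_ket_apply, ctrlMat]
  split_ifs
  · rw [mulVec_ket_apply]
  · rw [← mulVec_ket_apply (1 : Matrix _ _ ℂ), Matrix.one_mulVec]

/-- Every gate is controlled separately; a CNOT becomes a Toffoli gate. The factor 24 is the cost of
the worse case. -/
theorem exists_circuit_controlled (C : List (Gate D)) :
    ∃ C' : List (Gate (D ⊕ Unit)), C'.length ≤ 24 * C.length ∧
      circuitMatrix C' = ctrlMat (circuitMatrix C) := by
  induction C with
  | nil =>
    refine ⟨[], by simp, matrix_ext_ket fun s => ?_⟩
    rw [ctrlMat_mulVec_ket]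
    simp [circuitMatrix, liftMat_one Sum.inl_injective]
  | cons g C ih =>
    obtain ⟨C', hC', ih⟩ := ih
    have hg : ∃ C₁ : List (Gate (D ⊕ Unit)), C₁.length ≤ 24 ∧
        ∀ s, circuitMatrix C₁ *ᵥ ket s =
          if s (Sum.inr ()) then liftMat Sum.inl g.matrix *ᵥ ket s else ket s := by
      rw [← Gate.map_matrix Sum.inl_injective]
      cases g with
      | single q U => exact exists_circuit_controlled_single Sum.inr_ne_inl U
      | cnot c q h =>
        obtain ⟨C₁, h1, h2⟩ := exists_circuit_toffoli (a := Sum.inr ()) (b := Sum.inl c)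
          (q := Sum.inl q) Sum.inr_ne_inl Sum.inr_ne_inl
          (Sum.inl_injective (α := D) (β := Unit) |>.ne h)
        refine ⟨C₁, h1, fun s => ?_⟩
        rw [h2, Gate.map, cnot_mulVec_ket]
        split_ifs with hs <;> simp [hs]
    obtain ⟨C₁, h1, h2⟩ := hg
    refine ⟨C₁ ++ C', ?_, matrix_ext_ket fun s => ?_⟩
    · rw [List.length_append, List.length_cons]
      omega
    · rw [circuitMatrix_append, ← Matrix.mulVec_mulVec, h2, ih, ctrlMat_mulVec_ket]
      split_ifs with hs
      · rw [circuitMatrix, liftMat_mul Sum.inl_injective, ← Matrix.mulVec_mulVec,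
          liftMat_mulVec_ket Sum.inl_injective, mulVec_sum_smul, mulVec_sum_smul]
        refine Finset.sum_congr rfl fun u _ => ?_
        rw [ctrlMat_mulVec_ket, if_pos]
        rwa [Function.extend_apply' _ _ _ (by rintro ⟨d, hd⟩; cases hd)]
      · rw [ctrlMat_mulVec_ket, if_neg hs]

theorem Impl.ctrl {k : ℕ} {M : Matrix (D → Bool) (D → Bool) ℂ} (hM : Impl D k M) :
    Impl (D ⊕ Unit) (24 * k) (ctrlMat M) := by
  obtain ⟨A, _, _, C, hC, hM⟩ := hM
  obtain ⟨C', hC', hact⟩ := exists_circuit_controlled C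
  let j : (D ⊕ A) ⊕ Unit → (D ⊕ Unit) ⊕ A :=
    Sum.elim (Sum.elim (Sum.inl ∘ Sum.inl) Sum.inr) (Sum.inl ∘ Sum.inr)
  have hj : j.Injective := by
    rintro ((d | a) | u) ((d' | a') | u') h <;> simp_all [j]
  refine ⟨A, inferInstance, inferInstance, C'.map (Gate.map j hj), ?_, fun s => ?_⟩
  · rw [List.length_map]
    omega
  rw [← ketMap_mulVec_ket (pad A) (ctrlMat M), ctrlMat_mulVec_ket, circuitMatrix_map]
  split_ifs with hs
  · rw [liftMat_mulVec_ket Sum.inl_injective, map_sum, liftMat_mulVec_of hj (S := Finset.univ)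
      (c := fun t => M t (s ∘ Sum.inl)) (w := fun t => Function.extend Sum.inl (pad A t)
        (pad A s ∘ j))]
    · simp only [map_smul, ketMap_ket]
      refine Finset.sum_congr rfl fun t _ => ?_
      congr 2
      ext ((d | u) | a)
      · refine Eq.trans ?_ (Sum.inl_injective.extend_apply t s d).symm
        exact (hj.extend_apply _ _ (Sum.inl (Sum.inl d))).trans
          (Sum.inl_injective.extend_apply _ _ (Sum.inl d))
      · refine Eq.trans ?_ (Function.extend_apply' t s (Sum.inr u)
          (by rintro ⟨d, hd⟩; cases hd)).symm
        exact (hj.extend_apply _ _ (Sum.inr u)).trans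
          (Function.extend_apply' _ _ _ (by rintro ⟨d, hd⟩; cases hd))
      · exact (hj.extend_apply _ _ (Sum.inl (Sum.inr a))).trans
          (Sum.inl_injective.extend_apply _ _ (Sum.inr a))
    · rw [hact, ctrlMat_mulVec_ket, if_pos (show (pad A s ∘ j) (Sum.inr ()) = true from hs),
        liftMat_mulVec_of Sum.inl_injective (w := pad A)]
      rw [← hM]
      congr 2
      ext (d | a) <;> rfl
  · rw [ketMap_ket, liftMat_mulVec_of_eq hj (w := pad A s ∘ j), extend_comp_self]
    rw [hact, ctrlMat_mulVec_ket, if_neg]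
    exact hs

end Controlled

/-! ### Boolean straight-line programs -/

/-- Starting from the Boolean functions in `W`, the functions in `T` can be computed by a
straight-line program of at most `k` binary operations. -/
inductive Reach {α : Type} : Set (α → Bool) → ℕ → Set (α → Bool) → Prop
  | done {W T : Set (α → Bool)} {k : ℕ} : T ⊆ W → Reach W k T
  | const {W T : Set (α → Bool)} {k : ℕ} (b : Bool) :
      Reach (insert (fun _ => b) W) k T → Reach W (k + 1) T
  | step {W T : Set (α → Bool)} {k : ℕ} (g : Bool → Bool → Bool) (u v : α → Bool) :
      u ∈ W → v ∈ W → Reach (insert (fun a => g (u a) (v a)) W) k T → Reach W (k + 1) T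

/-- The input bits. -/
def inputBits (D : Type) : Set ((D → Bool) → Bool) := {w | ∃ d, w = fun s => s d}

namespace Reach

variable {α β : Type}

theorem mono {W W' T : Set (α → Bool)} {k l : ℕ} (h : Reach W k T) (hW : W ⊆ W') (hk : k ≤ l) :
    Reach W' l T := by
  induction h generalizing W' l with
  | done hT => exact .done (hT.trans hW)
  | const b _ ih =>
    obtain ⟨l, rfl⟩ := Nat.exists_eq_add_of_le' (le_trans (Nat.le_add_left 1 _) hk)
    exact .const b (ih (Set.insert_subset_insert hW) (by omega))
  | step g u v hu hv _ ih =>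
    obtain ⟨l, rfl⟩ := Nat.exists_eq_add_of_le' (le_trans (Nat.le_add_left 1 _) hk)
    exact .step g u v (hW hu) (hW hv) (ih (Set.insert_subset_insert hW) (by omega))

theorem anti {W T T' : Set (α → Bool)} {k : ℕ} (h : Reach W k T) (hT : T' ⊆ T) :
    Reach W k T' := by
  induction h with
  | done h => exact .done (hT.trans h)
  | const b _ ih => exact .const b (ih hT)
  | step g u v hu hv _ ih => exact .step g u v hu hv (ih hT)

/-- Functions computed first are available afterwards. -/
theorem bind {W T T' : Set (α → Bool)} {k l : ℕ} (h : Reach W k T) (h' : Reach (W ∪ T) l T') :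
    Reach W (k + l) T' := by
  induction h with
  | @done W T k hT =>
    rw [Set.union_eq_self_of_subset_right hT] at h'
    exact h'.mono subset_rfl (Nat.le_add_left _ _)
  | @const W T k b _ ih =>
    rw [add_right_comm]
    exact .const b (ih (h'.mono (Set.union_subset_union_left _ (Set.subset_insert _ _)) le_rfl))
  | @step W T k g u v hu hv _ ih =>
    rw [add_right_comm]
    exact .step g u v hu hv
      (ih (h'.mono (Set.union_subset_union_left _ (Set.subset_insert _ _)) le_rfl))

theorem union {W T T' : Set (α → Bool)} {k l : ℕ} (h : Reach W k T) (h' : Reach W l T') :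
    Reach W (k + l) (T ∪ T') := by
  have h1 : Reach (W ∪ T) l (T' ∪ T) := by
    clear h
    induction h' with
    | done h => exact .done (Set.union_subset_union_left _ h)
    | const b _ ih =>
      refine .const b ?_
      rwa [← Set.insert_union]
    | step g u v hu hv _ ih =>
      refine .step g u v (Or.inl hu) (Or.inl hv) ?_
      rwa [← Set.insert_union]
  exact (h.bind h1).anti (Set.union_comm _ _).subset

theorem comp {W T : Set (α → Bool)} {k : ℕ} (h : Reach W k T) (φ : β → α) :
    Reach ((· ∘ φ) '' W) k ((· ∘ φ) '' T) := by
  induction h with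
  | done h => exact .done (Set.image_mono h)
  | const b _ ih =>
    refine .const b ?_
    rwa [Set.image_insert_eq] at ih
  | step g u v hu hv _ ih =>
    refine .step g _ _ (Set.mem_image_of_mem _ hu) (Set.mem_image_of_mem _ hv) ?_
    rwa [Set.image_insert_eq] at ih

theorem op {W : Set (α → Bool)} {k l : ℕ} {u v : α → Bool} (g : Bool → Bool → Bool)
    (hu : Reach W k {u}) (hv : Reach W l {v}) :
    Reach W (k + l + 1) {fun a => g (u a) (v a)} :=
  (hu.union hv).bind (.step (k := 0) g u v (by simp) (by simp) (.done (by simp)))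

theorem of_mem {W : Set (α → Bool)} {u : α → Bool} (h : u ∈ W) : Reach W 0 {u} :=
  .done (by simpa using h)

end Reach

/-! ### Compilation to reversible circuits -/

section Compile

variable {Q D E : Type} [Fintype Q] [DecidableEq Q] [Fintype D] [DecidableEq D]
  [Fintype E] [DecidableEq E]

/-- The Boolean function `h` can be added to a target qubit by at most `k` gates. -/
def XorCircuit (k : ℕ) (h : (Q → Bool) → Bool) : Prop :=
  ∃ C : List (Gate (Q ⊕ Unit)), C.length ≤ k ∧ ∀ s x, circuitMatrix C *ᵥ
    ket (Sum.elim s fun _ => x) = ket (Sum.elim s fun _ => xor x (h s))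

theorem update_elim_inr {A B : Type} [DecidableEq A] [DecidableEq B] (s : A → Bool) (u : B → Bool)
    (b : B) (x : Bool) : Function.update (Sum.elim s u) (Sum.inr b) x =
      Sum.elim s (Function.update u b x) :=
  Sum.update_elim_inr

theorem XorCircuit.xor {k l : ℕ} {h h' : (Q → Bool) → Bool} (hh : XorCircuit k h)
    (hh' : XorCircuit l h') : XorCircuit (k + l) fun s => xor (h s) (h' s) := by
  obtain ⟨C, hC, h1⟩ := hh
  obtain ⟨C', hC', h2⟩ := hh'
  refine ⟨C ++ C', by rw [List.length_append]; omega, fun s x => ?_⟩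
  rw [circuitMatrix_append, ← Matrix.mulVec_mulVec, h1, h2, Bool.xor_assoc]

theorem XorCircuit.mono {k l : ℕ} {h : (Q → Bool) → Bool} (hh : XorCircuit k h) (hkl : k ≤ l) :
    XorCircuit l h := by
  obtain ⟨C, hC, h1⟩ := hh
  exact ⟨C, hC.trans hkl, h1⟩

theorem update_unit (x y : Bool) :
    Function.update (fun _ : Unit => x) () y = fun _ => y := by
  ext; simp

theorem xorCircuit_const (b : Bool) : XorCircuit 1 fun _ : Q → Bool => b := by
  cases b
  · exact ⟨[], by simp, fun s x => by simp [circuitMatrix]⟩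
  · refine ⟨[.single (Sum.inr ()) notUnitary], le_rfl, fun s x => ?_⟩
    rw [circuitMatrix_singleton, not_mulVec_ket, update_elim_inr, update_unit]
    simp

theorem xorCircuit_coord (q : Q) : XorCircuit 1 fun s : Q → Bool => s q := by
  refine ⟨[.cnot (Sum.inl q) (Sum.inr ()) Sum.inl_ne_inr], le_rfl, fun s x => ?_⟩
  rw [circuitMatrix_singleton, cnot_mulVec_ket, update_elim_inr, update_unit]
  rfl

theorem xorCircuit_and {a b : Q} (hab : a ≠ b) : XorCircuit 24 fun s : Q → Bool => s a && s b := by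
  obtain ⟨C, hC, h⟩ := exists_circuit_toffoli (Q := Q ⊕ Unit) (Sum.inl_injective.ne hab)
    (Sum.inl_ne_inr (b := ())) Sum.inl_ne_inr
  refine ⟨C, hC, fun s x => ?_⟩
  rw [h, update_elim_inr, update_unit]
  rfl

theorem XorCircuit.ite {k : ℕ} {h : (Q → Bool) → Bool} (hh : XorCircuit k h) (b : Bool) :
    XorCircuit (k + 1) fun s => b && h s := by
  cases b
  · exact (xorCircuit_const false).mono (by omega)
  · simpa using hh.mono (by omega)

/-- The algebraic normal form of g consists of a constant, two linear terms and a product, each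
added to the target: 1 + 2 + 2 + 25 gates. Equal inputs are separate because the Toffoli gate needs
distinct qubits. -/
theorem xorCircuit_op (g : Bool → Bool → Bool) (a b : Q) :
    XorCircuit 30 fun s : Q → Bool => g (s a) (s b) := by
  by_cases hab : a = b
  · subst hab
    have h := (xorCircuit_const (g false false)).xor
      ((xorCircuit_coord a).ite (Bool.xor (g true true) (g false false)))
    convert h.mono (show _ ≤ 30 by norm_num) using 2 with s
    cases s a
    · simp
    · cases g true true <;> cases g false false <;> rfl
  · have h := ((xorCircuit_const (g false false)).xor
      ((xorCircuit_coord a).ite (Bool.xor (g true false) (g false false)))).xor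
      (((xorCircuit_coord b).ite (Bool.xor (g false true) (g false false))).xor
      ((xorCircuit_and hab).ite (Bool.xor (Bool.xor (g true true) (g true false))
        (Bool.xor (g false true) (g false false)))))
    convert h.mono (show _ ≤ 30 by norm_num) using 2 with s
    cases s a <;> cases s b <;> cases g true true <;> cases g true false <;>
      cases g false true <;> cases g false false <;> rfl

/-- A circuit for the next operation followed by one for the others. -/
theorem exists_circuit_cons {A : Type} [Fintype A] [DecidableEq A] {k l : ℕ}
    {h : (Q → Bool) → Bool} (hh : XorCircuit k h) {C : List (Gate ((Q ⊕ Unit) ⊕ A))}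
    (hC : C.length ≤ l) : ∃ C' : List (Gate (Q ⊕ (Unit ⊕ A))), C'.length ≤ k + l ∧
      ∀ (s : Q → Bool) (a : A → Bool),
        circuitMatrix C *ᵥ ket (pad A (Sum.elim s fun _ => h s)) =
          ket (Sum.elim (Sum.elim s fun _ => h s) a) →
        circuitMatrix C' *ᵥ ket (pad (Unit ⊕ A) s) =
          ket (Sum.elim s (Sum.elim (fun _ => h s) a)) := by
  obtain ⟨C₁, h1, hact⟩ := hh
  have hj1 : (Sum.map (id : Q → Q) (Sum.inl : Unit → Unit ⊕ A)).Injective :=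
    Sum.map_injective.2 ⟨Function.injective_id, Sum.inl_injective⟩
  let j : (Q ⊕ Unit) ⊕ A → Q ⊕ (Unit ⊕ A) := Equiv.sumAssoc Q Unit A
  have hj : j.Injective := (Equiv.sumAssoc Q Unit A).injective
  refine ⟨C₁.map (Gate.map _ hj1) ++ C.map (Gate.map j hj), ?_, fun s a hsa => ?_⟩
  · rw [List.length_append, List.length_map, List.length_map]
    omega
  rw [circuitMatrix_append, ← Matrix.mulVec_mulVec, circuitMatrix_map, circuitMatrix_map,
    liftMat_mulVec_of_eq hj1 (w := Sum.elim s fun _ => h s)]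
  · rw [liftMat_mulVec_of_eq hj (w := Sum.elim (Sum.elim s fun _ => h s) a)]
    · congr 1
      ext (q | (u | a))
      · exact hj.extend_apply _ _ (Sum.inl (Sum.inl q))
      · exact hj.extend_apply _ _ (Sum.inl (Sum.inr u))
      · exact hj.extend_apply _ _ (Sum.inr a)
    · rw [← hsa]
      congr 2
      ext ((q | u) | a)
      · exact hj1.extend_apply _ _ (Sum.inl q)
      · exact hj1.extend_apply _ _ (Sum.inr u)
      · exact Function.extend_apply' _ _ _ (by rintro ⟨d | d, hd⟩ <;> cases hd)
  · have := hact s false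
    rw [Bool.false_xor] at this
    rw [← this]
    congr 2
    ext (q | u) <;> rfl

/-- Every operation writes its value on a fresh ancilla, so that each available function always sits
on some qubit. The garbage `τ` is explicit so that it can be uncomputed later. -/
theorem Reach.compile {α : Type} {W T : Set (α → Bool)} {k : ℕ} (h : Reach W k T) (Q : Type)
    [Fintype Q] [DecidableEq Q] (σ : α → Q → Bool) (hW : ∀ w ∈ W, ∃ q, ∀ a, σ a q = w a) :
    ∃ (A : Type) (_ : Fintype A) (_ : DecidableEq A) (C : List (Gate (Q ⊕ A)))
      (τ : α → A → Bool), C.length ≤ 30 * k ∧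
      (∀ a, circuitMatrix C *ᵥ ket (pad A (σ a)) = ket (Sum.elim (σ a) (τ a))) ∧
      ∀ w ∈ T, ∃ q, ∀ a, Sum.elim (σ a) (τ a) q = w a := by
  have key : ∀ {W T : Set (α → Bool)} {k : ℕ} {Q : Type} [Fintype Q] [DecidableEq Q]
      (σ : α → Q → Bool) (h : (Q → Bool) → Bool) (_ : XorCircuit 30 h)
      (_ : ∃ (A : Type) (_ : Fintype A) (_ : DecidableEq A) (C : List (Gate ((Q ⊕ Unit) ⊕ A)))
        (τ : α → A → Bool), C.length ≤ 30 * k ∧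
        (∀ a, circuitMatrix C *ᵥ ket (pad A (Sum.elim (σ a) fun _ : Unit => h (σ a))) =
          ket (Sum.elim (Sum.elim (σ a) fun _ : Unit => h (σ a)) (τ a))) ∧
        ∀ w ∈ T, ∃ q, ∀ a, Sum.elim (Sum.elim (σ a) fun _ : Unit => h (σ a)) (τ a) q = w a),
      ∃ (A : Type) (_ : Fintype A) (_ : DecidableEq A) (C : List (Gate (Q ⊕ A)))
        (τ : α → A → Bool), C.length ≤ 30 * (k + 1) ∧
        (∀ a, circuitMatrix C *ᵥ ket (pad A (σ a)) = ket (Sum.elim (σ a) (τ a))) ∧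
        ∀ w ∈ T, ∃ q, ∀ a, Sum.elim (σ a) (τ a) q = w a := by
    intro W T k Q _ _ σ h hh hrest
    obtain ⟨A, _, _, C, τ, hC, hact, hT⟩ := hrest
    obtain ⟨C', hC', hact'⟩ := exists_circuit_cons hh hC
    refine ⟨Unit ⊕ A, inferInstance, inferInstance, C',
      fun a => Sum.elim (fun _ => h (σ a)) (τ a), by omega, fun a => hact' _ _ (hact a),
      fun w hw => ?_⟩
    obtain ⟨q, hq⟩ := hT w hw
    refine ⟨Equiv.sumAssoc Q Unit A q, fun a => ?_⟩
    rw [← hq]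
    rcases q with ((q | u) | b) <;> rfl
  induction h generalizing Q with
  | done hT =>
    refine ⟨Empty, inferInstance, inferInstance, [], fun _ _ => false, by simp, fun a => ?_,
      fun w hw => ?_⟩
    · simp [circuitMatrix]
    · obtain ⟨q, hq⟩ := hW w (hT hw)
      exact ⟨Sum.inl q, hq⟩
  | @const W T k b _ ih =>
    refine key (W := W) σ (fun _ => b) ((xorCircuit_const b).mono (by norm_num)) (ih _ _ ?_)
    rintro w (rfl | hw)
    · exact ⟨Sum.inr (), fun a => rfl⟩
    · obtain ⟨q, hq⟩ := hW w hw
      exact ⟨Sum.inl q, hq⟩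
  | @step W T k g u v hu hv _ ih =>
    obtain ⟨a, ha⟩ := hW u hu
    obtain ⟨b, hb⟩ := hW v hv
    refine key (W := W) σ _ (xorCircuit_op g a b) (ih _ _ ?_)
    rintro w (rfl | hw)
    · exact ⟨Sum.inr (), fun x => by simp [ha, hb]⟩
    · obtain ⟨q, hq⟩ := hW w hw
      exact ⟨Sum.inl q, hq⟩

/-- Adding bits to targets one after the other. -/
theorem exists_circuit_cnots {A : Type} [Fintype A] [DecidableEq A] (q : E → D ⊕ A) (l : List E)
    (hl : l.Nodup) :
    ∃ C : List (Gate ((D ⊕ E) ⊕ A)), C.length = l.length ∧ ∀ (s : D → Bool) (u : E → Bool)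
      (a : A → Bool), circuitMatrix C *ᵥ ket (Sum.elim (Sum.elim s u) a) =
        ket (Sum.elim (Sum.elim s fun e => xor (u e) (if e ∈ l then Sum.elim s a (q e) else false))
          a) := by
  induction l with
  | nil => exact ⟨[], rfl, fun s u a => by simp [circuitMatrix]⟩
  | cons e l ih =>
    obtain ⟨C, hC, hact⟩ := ih (List.nodup_cons.1 hl).2
    have hne : Sum.map (Sum.inl : D → D ⊕ E) (id : A → A) (q e) ≠ Sum.inl (Sum.inr e) := by
      rcases q e with d | a <;> simp
    refine ⟨.cnot _ _ hne :: C, by simp [hC], fun s u a => ?_⟩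
    have hval : Sum.elim (Sum.elim s u) a (Sum.map (Sum.inl : D → D ⊕ E) (id : A → A) (q e)) =
        Sum.elim s a (q e) := by
      rcases q e with d | a <;> rfl
    have hupd : Function.update (Sum.elim (Sum.elim s u) a) (Sum.inl (Sum.inr e))
        (xor (u e) (Sum.elim s a (q e))) =
        Sum.elim (Sum.elim s (Function.update u e (xor (u e) (Sum.elim s a (q e))))) a := by
      rw [Sum.update_elim_inl, Sum.update_elim_inr]
    rw [circuitMatrix, ← Matrix.mulVec_mulVec, cnot_mulVec_ket, hval, Sum.elim_inl, Sum.elim_inr,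
      hupd, hact]
    congr 3
    ext e'
    by_cases he : e' = e
    · subst he
      simp [(List.nodup_cons.1 hl).1]
    · simp [he]

/-- The map of basis states adding `f` of the first part to the second part. -/
def xorMap (f : (D → Bool) → (E → Bool)) (s : D ⊕ E → Bool) : D ⊕ E → Bool :=
  Sum.elim (s ∘ Sum.inl) fun e => xor (s (Sum.inr e)) (f (s ∘ Sum.inl) e)

/-- Compute with garbage, copy the result by CNOTs, and run the computation backwards. The two runs
account for 60 = 2 · 30. -/
theorem impl_xorMap {f : (D → Bool) → (E → Bool)} {k : ℕ}
    (hf : Reach (inputBits D) k {w | ∃ e, w = fun s => f s e}) :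
    Impl (D ⊕ E) (60 * k + Fintype.card E) (permMat (xorMap f)) := by
  obtain ⟨A, _, _, C, τ, hC, hact, hT⟩ := hf.compile D (fun s => s) (by
    rintro w ⟨d, rfl⟩
    exact ⟨d, fun _ => rfl⟩)
  choose q hq using fun e => hT (fun s => f s e) ⟨e, rfl⟩
  obtain ⟨L, hL, hLact⟩ := exists_circuit_cnots q Finset.univ.toList (Finset.nodup_toList _)
  have hj : (Sum.map (Sum.inl : D → D ⊕ E) (id : A → A)).Injective :=
    Sum.map_injective.2 ⟨Sum.inl_injective, Function.injective_id⟩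
  have hext : ∀ (s : D → Bool) (u : E → Bool) (a b : A → Bool),
      Function.extend (Sum.map (Sum.inl : D → D ⊕ E) (id : A → A)) (Sum.elim s b)
        (Sum.elim (Sum.elim s u) a) = Sum.elim (Sum.elim s u) b := by
    intro s u a b
    ext ((d | e) | a)
    · exact hj.extend_apply _ _ (Sum.inl d)
    · exact Function.extend_apply' _ _ _ (by rintro ⟨d | d, hd⟩ <;> cases hd)
    · exact hj.extend_apply _ _ (Sum.inr a)
  have hres : ∀ (s : D → Bool) (u : E → Bool) (a : A → Bool),
      Sum.elim (Sum.elim s u) a ∘ Sum.map (Sum.inl : D → D ⊕ E) (id : A → A) = Sum.elim s a := by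
    intro s u a
    ext (d | a) <;> rfl
  refine ⟨A, inferInstance, inferInstance,
    C.map (Gate.map _ hj) ++ (L ++ (circuitInv C).map (Gate.map _ hj)), ?_, fun s => ?_⟩
  · simp only [List.length_append, List.length_map, circuitInv_length, hL, Finset.length_toList,
      Finset.card_univ]
    omega
  · rw [← ketMap_mulVec_ket (pad A), permMat_mulVec_ket, ketMap_ket]
    obtain ⟨s, u, rfl⟩ : ∃ (s' : D → Bool) (u : E → Bool), s = Sum.elim s' u :=
      ⟨s ∘ Sum.inl, s ∘ Sum.inr, (Sum.elim_comp_inl_inr s).symm⟩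
    rw [circuitMatrix_append, circuitMatrix_append, ← Matrix.mulVec_mulVec,
      ← Matrix.mulVec_mulVec, circuitMatrix_map, circuitMatrix_map,
      liftMat_mulVec_of_eq hj (w := Sum.elim s (τ s)) _ (by rw [hres]; exact hact s), hext, hLact,
      liftMat_mulVec_of_eq hj (w := pad A s) _ (by rw [hres]; exact circuitInv_mulVec (hact s)),
      hext]
    congr 2
    unfold xorMap
    congr 1
    ext e
    simp [hq]

/-- In-place evaluation of a map with a computable inverse. -/
theorem exists_impl_inPlace {f g : (D → Bool) → (D → Bool)} {k l : ℕ}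
    (hf : Reach (inputBits D) k {w | ∃ e, w = fun s => f s e})
    (hg : Reach (inputBits D) l {w | ∃ e, w = fun s => g s e}) :
    ∃ M, Impl (D ⊕ D) (60 * (k + l) + 4 * Fintype.card D) M ∧
      ∀ s, g (f s) = s → M *ᵥ ket (pad D s) = ket (pad D (f s)) := by
  have hid : Reach (inputBits D) 0 {w | ∃ e, w = fun s : D → Bool => id s e} :=
    .done (by rintro w ⟨e, rfl⟩; exact ⟨e, rfl⟩)
  have hs : (Sum.swap : D ⊕ D → D ⊕ D).Injective := Sum.swap_leftInverse.injective
  have h1 := impl_xorMap hf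
  have h2 := (impl_xorMap hg).lift hs
  have h3 := (impl_xorMap hid).lift hs
  have h4 := impl_xorMap hid
  -- The words pass through (s, 0), (s, f s), (s ⊕ g(f s), f s) = (0, f s), (f s, f s), (f s, 0).
  -- The inverse g erases the input.
  refine ⟨_, (((h4.mul h3).mul h2).mul h1).mono (by omega), fun s hgf => ?_⟩
  have hswap : ∀ (h : (D → Bool) → (D → Bool)) (s u : D → Bool),
      liftMat Sum.swap (permMat (xorMap h)) *ᵥ ket (Sum.elim s u) =
        ket (Sum.elim (fun d => xor (s d) (h u d)) u) := by
    intro h s u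
    rw [liftMat_mulVec_of_eq hs _ (permMat_mulVec_ket _ _)]
    congr 1
    ext (d | d)
    · exact hs.extend_apply _ _ (Sum.inr d)
    · exact hs.extend_apply _ _ (Sum.inl d)
  have hdir : ∀ (h : (D → Bool) → (D → Bool)) (s u : D → Bool),
      permMat (xorMap h) *ᵥ ket (Sum.elim s u) =
        ket (Sum.elim s fun d => xor (u d) (h s d)) := by
    intro h s u
    rw [permMat_mulVec_ket]
    rfl
  rw [← Matrix.mulVec_mulVec, ← Matrix.mulVec_mulVec, ← Matrix.mulVec_mulVec, pad, hdir]
  simp only [Bool.false_xor]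
  rw [hswap, hgf]
  simp only [Bool.xor_self]
  rw [hswap, hdir]
  simp [pad]

/-- The reflection given by a computable predicate. -/
theorem impl_reflection {π : (D → Bool) → Bool} {k : ℕ} (h : Reach (inputBits D) k {π}) :
    Impl D (120 * k + 3) (Matrix.diagonal fun s => if π s then (-1 : ℂ) else 1) := by
  have h1 : Impl (D ⊕ Unit) (60 * k + Fintype.card Unit) (permMat (xorMap fun s _ => π s)) :=
    impl_xorMap (h.anti (by rintro w ⟨e, rfl⟩; rfl))
  have h2 := (diagCircuit_phase (Sum.inr () : D ⊕ Unit) fun x => if x then Real.pi else 0).impl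
  refine (((h1.mul h2).mul h1).mono (l := 120 * k + 3) ?_).hide fun s => ?_
  · rw [Fintype.card_unit]
    omega
  · rw [← ketMap_mulVec_ket (pad Unit), diagonal_mulVec_ket, map_smul, ketMap_ket,
      ← Matrix.mulVec_mulVec, ← Matrix.mulVec_mulVec, permMat_mulVec_ket, diagonal_mulVec_ket,
      Matrix.mulVec_smul, permMat_mulVec_ket]
    congr 1
    · cases hp : π s
      · simp [xorMap, pad, Function.comp_def, hp, phase_zero]
      · simp [xorMap, pad, Function.comp_def, hp, phase]
    · congr 1
      ext (d | u)
      · rfl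
      · simp [xorMap, pad, Function.comp_def]

end Compile

/-! ### Exact amplitude amplification -/

section Amplification

variable {D : Type} [Fintype D] [DecidableEq D]

/-- One round of amplification turns a block `F / 2` of a unitary into the isometry `F`. -/
theorem amplification {Q α β : Type} [Fintype Q] [DecidableEq Q] [Fintype α] [DecidableEq α]
    [Fintype β] {U : Matrix (Q → Bool) (Q → Bool) ℂ} (hU : Uᴴ * U = 1)
    {e : α → Q → Bool} {e' : β → Q → Bool} (he : e.Injective) (he' : e'.Injective)
    {F : Matrix β α ℂ} (hF : Fᴴ * F = 1) (hblock : ∀ a b, U (e' b) (e a) = 1 / 2 * F b a)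
    {f f' : (Q → Bool) → ℂ} (hf : ∀ a, f (e a) = 1) (hf0 : ∀ s, s ∉ Set.range e → f s = -1)
    (hf' : ∀ b, f' (e' b) = -1) (hf0' : ∀ s, s ∉ Set.range e' → f' s = 1) (a : α) :
    (U * Matrix.diagonal f * Uᴴ * Matrix.diagonal f' * U) *ᵥ ket (e a) =
      ∑ b, F b a • ket (e' b) := by
  set g : (Q → Bool) → ℂ := ∑ b, F b a • ket (e' b) with hg
  have hgb : ∀ b, g (e' b) = F b a := by
    intro b
    rw [hg, Finset.sum_apply, Finset.sum_eq_single b]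
    · simp [ket_apply]
    · intro c _ hc
      simp [ket_apply, (he'.ne hc).symm]
    · simp
  have hg0 : ∀ s, s ∉ Set.range e' → g s = 0 := by
    intro s hs
    rw [hg, Finset.sum_apply]
    refine Finset.sum_eq_zero fun b _ => ?_
    have : s ≠ e' b := fun h => hs ⟨b, h.symm⟩
    simp [ket_apply, this]
  -- The part of U|e a⟩ on the output states is g/2; changing its sign subtracts g.
  have h1 : Matrix.diagonal f' *ᵥ (U *ᵥ ket (e a)) = U *ᵥ ket (e a) - g := by
    ext t
    rw [Matrix.mulVec_diagonal, Pi.sub_apply]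
    by_cases ht : t ∈ Set.range e'
    · obtain ⟨b, rfl⟩ := ht
      rw [hf', hgb, mulVec_ket_apply, hblock]
      ring
    · rw [hf0' t ht, hg0 t ht, one_mul, sub_zero]
  have h2 : ∀ a', (Uᴴ *ᵥ g) (e a') = 1 / 2 * (if a' = a then 1 else 0) := by
    intro a'
    have := congrFun (congrFun hF a') a
    rw [Matrix.mul_apply, Matrix.one_apply] at this
    rw [← this, hg, mulVec_sum_smul, Finset.sum_apply, Finset.mul_sum]
    refine Finset.sum_congr rfl fun b _ => ?_
    rw [Pi.smul_apply, mulVec_ket_apply, Matrix.conjTranspose_apply, hblock,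
      Matrix.conjTranspose_apply, star_mul', smul_eq_mul]
    simp
    ring
  -- On the input states Uᴴg is half of |e a⟩, hence equal to the difference; elsewhere the
  -- difference is -Uᴴg and f changes its sign. The last application of U then gives g. This is
  -- where the value 1/2 is indispensable.
  have h3 : Matrix.diagonal f *ᵥ (ket (e a) - Uᴴ *ᵥ g) = Uᴴ *ᵥ g := by
    ext s
    rw [Matrix.mulVec_diagonal, Pi.sub_apply, ket_apply]
    by_cases hs : s ∈ Set.range e
    · obtain ⟨a', rfl⟩ := hs
      rw [hf, h2]
      simp only [he.eq_iff]
      split_ifs <;> norm_num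
    · rw [hf0 s hs, if_neg fun h => hs ⟨a, h.symm⟩]
      ring
  have hU' : U * Uᴴ = 1 := mul_eq_one_comm.1 hU
  rw [← Matrix.mulVec_mulVec, ← Matrix.mulVec_mulVec, ← Matrix.mulVec_mulVec,
    ← Matrix.mulVec_mulVec, h1, Matrix.mulVec_sub, Matrix.mulVec_mulVec _ Uᴴ U, hU,
    Matrix.one_mulVec, h3, Matrix.mulVec_mulVec, hU', Matrix.one_mulVec]

theorem Reach.pad_pred {π : (D → Bool) → Bool} {k : ℕ} (h : Reach (inputBits D) k {π})
    (b : Bool) : Reach (inputBits (D ⊕ Unit)) (k + 1)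
      {fun s => xor b (π (s ∘ Sum.inl) && !s (Sum.inr ()))} := by
  have h1 : Reach (inputBits (D ⊕ Unit)) k {fun s => π (s ∘ Sum.inl)} := by
    refine ((h.comp fun s : D ⊕ Unit → Bool => s ∘ Sum.inl).mono ?_ le_rfl).anti ?_
    · rintro w ⟨_, ⟨d, rfl⟩, rfl⟩
      exact ⟨Sum.inl d, rfl⟩
    · rintro w rfl
      exact ⟨π, rfl, rfl⟩
  exact h1.op (fun x y => xor b (x && !y)) (Reach.of_mem (u := fun s => s (Sum.inr ())) ⟨_, rfl⟩)

/-- If a computable unitary has a multiple `c F` of an isometry `F` as a block, with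
`1 / 2 ≤ |c|`, then `F` itself is computable. -/
theorem exists_impl_amplified {α β : Type} [Fintype α] [DecidableEq α] [Fintype β]
    {U : Matrix (D → Bool) (D → Bool) ℂ} {k : ℕ} (hU : Impl D k U)
    {e : α → D → Bool} {e' : β → D → Bool} (he : e.Injective) (he' : e'.Injective)
    {F : Matrix β α ℂ} (hF : Fᴴ * F = 1) {c : ℂ} (hc : 1 / 2 ≤ ‖c‖)
    (hblock : ∀ a b, U (e' b) (e a) = c * F b a) {π π' : (D → Bool) → Bool} {l : ℕ}
    (hπ : Reach (inputBits D) l {π}) (hπ' : Reach (inputBits D) l {π'})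
    (hπe : ∀ s, π s = true ↔ s ∈ Set.range e) (hπe' : ∀ s, π' s = true ↔ s ∈ Set.range e') :
    ∃ M, Impl (D ⊕ Unit) (3 * k + 240 * l + 249) M ∧
      ∀ a, M *ᵥ ket (pad Unit (e a)) = ∑ b, F b a • ket (pad Unit (e' b)) := by
  have hc0 : c ≠ 0 := by
    rintro rfl
    norm_num at hc
  have hw : ‖1 / (2 * c)‖ ≤ 1 := by
    rw [norm_div, norm_mul, norm_one, Complex.norm_two, div_le_one (by linarith)]
    linarith
  -- V is a rotation of one extra qubit whose amplitude 0 → 0 is 1/(2c), so it lowers the factor c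
  -- of the block to exactly 1/2. The bound on |c| makes this an admissible amplitude.
  obtain ⟨V, hV, -⟩ := exists_unitary_column (1 / (2 * c)) (Real.sqrt (1 - ‖1 / (2 * c)‖ ^ 2)) (by
    rw [← starRingEnd_apply, ← starRingEnd_apply, Complex.conj_mul', Complex.conj_ofReal,
      ← Complex.ofReal_mul, Real.mul_self_sqrt (by nlinarith [norm_nonneg (1 / (2 * c))])]
    push_cast
    ring)
  set U' : Matrix (D ⊕ Unit → Bool) (D ⊕ Unit → Bool) ℂ :=
    (Gate.single (Sum.inr ()) V).matrix * liftMat Sum.inl U with hU'def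
  have hU' : Impl (D ⊕ Unit) (k + 1) U' := by
    have h1 := Impl.of_circuit [Gate.single (Sum.inr () : D ⊕ Unit) V]
    rw [circuitMatrix_singleton] at h1
    exact h1.mul (hU.lift Sum.inl_injective)
  have hpadext : ∀ s t : D → Bool, Function.extend Sum.inl t (pad Unit s) = pad Unit t := by
    intro s t
    ext (d | u)
    · exact Sum.inl_injective.extend_apply _ _ _
    · exact Function.extend_apply' _ _ _ (by rintro ⟨d, hd⟩; cases hd)
  have hU'block : ∀ a b, U' (pad Unit (e' b)) (pad Unit (e a)) = 1 / 2 * F b a := by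
    intro a b
    rw [← mulVec_ket_apply U', hU'def, ← Matrix.mulVec_mulVec,
      liftMat_mulVec_ket Sum.inl_injective, mulVec_sum_smul, Finset.sum_apply,
      Finset.sum_eq_single (e' b)]
    · rw [Pi.smul_apply, hpadext, single_mulVec_ket, Finset.sum_apply, Finset.sum_eq_single false]
      · have hfalse : pad Unit (e' b) (Sum.inr ()) = false := rfl
        rw [hfalse, hV, Pi.smul_apply, update_elim_inr, update_unit, ket_apply, if_pos rfl]
        change U (e' b) (e a) • _ = _
        rw [hblock, smul_eq_mul, smul_eq_mul]
        field_simp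
      · intro x _ hx
        rw [Pi.smul_apply, update_elim_inr, update_unit, ket_apply, if_neg, smul_zero]
        exact fun h => hx (congrFun h (Sum.inr ())).symm
      · simp
    · intro u _ hu
      rw [Pi.smul_apply, hpadext, single_mulVec_ket, Finset.sum_apply, Finset.sum_eq_zero,
        smul_zero]
      intro x _
      rw [Pi.smul_apply, update_elim_inr, update_unit, ket_apply, if_neg, smul_zero]
      intro h
      exact hu (funext fun d => (congrFun h (Sum.inl d)).symm)
    · simp
  have hrange : ∀ {γ : Type} {e : γ → D → Bool} {π : (D → Bool) → Bool}
      (_ : ∀ s, π s = true ↔ s ∈ Set.range e) (s : D ⊕ Unit → Bool),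
      (π (s ∘ Sum.inl) && !s (Sum.inr ())) = true ↔ s ∈ Set.range fun a => pad Unit (e a) := by
    intro γ e π hπ s
    rw [Bool.and_eq_true, hπ]
    constructor
    · rintro ⟨⟨a, ha⟩, hs⟩
      refine ⟨a, ?_⟩
      ext (d | u)
      · exact congrFun ha d
      · simpa using hs
    · rintro ⟨a, rfl⟩
      exact ⟨⟨a, rfl⟩, rfl⟩
  -- The value `true` negates the predicate, placing -1 off the input states; `false` below places
  -- -1 on the output states.
  have h0 := impl_reflection (hπ.pad_pred true)
  have h0' := impl_reflection (hπ'.pad_pred false)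
  refine ⟨_, ((((hU'.mul h0).mul hU'.conjTranspose).mul h0').mul hU').mono (by omega),
    amplification hU'.unitary (pad_injective.comp he) (pad_injective.comp he') hF hU'block
      ?_ ?_ ?_ ?_⟩
  · intro a
    have := (hrange hπe (pad Unit (e a))).2 ⟨a, rfl⟩
    exact if_neg (by rw [Function.comp_apply, this]; simp)
  · intro s hs
    have := mt (hrange hπe s).1 hs
    rw [Bool.not_eq_true] at this
    exact if_pos (by rw [this]; simp)
  · intro b
    have := (hrange hπe' (pad Unit (e' b))).2 ⟨b, rfl⟩
    exact if_pos (by rw [Function.comp_apply, this]; simp)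
  · intro s hs
    have := mt (hrange hπe' s).1 hs
    rw [Bool.not_eq_true] at this
    exact if_neg (by rw [this]; simp)

end Amplification

/-! ### Arithmetic by straight-line programs -/

section Arithmetic

variable {α : Type}

/-- The lowest `w` bits of the number `f a`. -/
def bitsOf (w : ℕ) (f : α → ℕ) : Set (α → Bool) := {u | ∃ i < w, u = fun a => (f a).testBit i}

/-- The lowest `w` bits of `f` are computable from `W` in `k` operations. -/
abbrev Gets (W : Set (α → Bool)) (k w : ℕ) (f : α → ℕ) : Prop := Reach W k (bitsOf w f)

theorem bitsOf_succ (w : ℕ) (f : α → ℕ) :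
    bitsOf (w + 1) f = bitsOf w f ∪ {fun a => (f a).testBit w} := by
  ext u
  constructor
  · rintro ⟨i, hi, rfl⟩
    rcases Nat.lt_succ_iff_lt_or_eq.1 hi with h | rfl
    · exact Or.inl ⟨i, h, rfl⟩
    · exact Or.inr rfl
  · rintro (⟨i, hi, rfl⟩ | rfl)
    · exact ⟨i, by omega, rfl⟩
    · exact ⟨w, by omega, rfl⟩

theorem bitsOf_congr {w : ℕ} {f g : α → ℕ} (h : ∀ a, f a % 2 ^ w = g a % 2 ^ w) :
    bitsOf w f = bitsOf w g := by
  have key : ∀ i < w, (fun a => (f a).testBit i) = fun a => (g a).testBit i := by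
    intro i hi
    ext a
    have := congrArg (fun x => x.testBit i) (h a)
    simpa [Nat.testBit_mod_two_pow, hi] using this
  ext u
  constructor
  · rintro ⟨i, hi, rfl⟩
    exact ⟨i, hi, key i hi⟩
  · rintro ⟨i, hi, rfl⟩
    exact ⟨i, hi, (key i hi).symm⟩

theorem Reach.congr {W : Set (α → Bool)} {k w : ℕ} {f g : α → ℕ} (h : Gets W k w f)
    (hfg : ∀ a, f a = g a) : Gets W k w g :=
  (funext hfg : f = g) ▸ h

theorem Gets.self {W : Set (α → Bool)} {w : ℕ} {f : α → ℕ} : Gets (W ∪ bitsOf w f) 0 w f :=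
  .done Set.subset_union_right

theorem Reach.weaken {W T V : Set (α → Bool)} {k : ℕ} (h : Reach W k T) : Reach (W ∪ V) k T :=
  h.mono Set.subset_union_left le_rfl

theorem Reach.more {W T : Set (α → Bool)} {k l : ℕ} (h : Reach W k T) (hkl : k ≤ l) :
    Reach W l T :=
  h.mono subset_rfl hkl

theorem Gets.bit {W : Set (α → Bool)} {k w : ℕ} {f : α → ℕ} (h : Gets W k w f) {i : ℕ}
    (hi : i < w) : Reach W k {fun a => (f a).testBit i} :=
  h.anti (by rintro u rfl; exact ⟨i, hi, rfl⟩)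

theorem Gets.le {W : Set (α → Bool)} {k w v : ℕ} {f : α → ℕ} (h : Gets W k w f) (hv : v ≤ w) :
    Gets W k v f :=
  h.anti (by rintro u ⟨i, hi, rfl⟩; exact ⟨i, by omega, rfl⟩)

theorem Gets.of_bits {W : Set (α → Bool)} {k w : ℕ} {f : α → ℕ}
    (h : ∀ i < w, Reach W k {fun a => (f a).testBit i}) : Gets W (w * k) w f := by
  induction w with
  | zero => exact .done (by rintro u ⟨i, hi, rfl⟩; omega)
  | succ w ih =>
    rw [Gets, bitsOf_succ, Nat.succ_mul]
    exact (ih fun i hi => h i (by omega)).union (h w (by omega))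

theorem Reach.of_const {W : Set (α → Bool)} (b : Bool) : Reach W 1 {fun _ => b} :=
  .const b (.done (by simp))

theorem Gets.const {W : Set (α → Bool)} (w c : ℕ) : Gets W 2 w fun _ => c := by
  refine Reach.const true (Reach.const false (.done ?_))
  rintro u ⟨i, hi, rfl⟩
  cases hb : c.testBit i
  · exact Or.inl (funext fun _ => hb)
  · exact Or.inr (Or.inl (funext fun _ => hb))

/-! ### Addition, comparison and selection of binary numbers -/

theorem testBit_add_eq (x y i : ℕ) : (x + y).testBit i =
    xor (xor (x.testBit i) (y.testBit i)) (decide (2 ^ i ≤ x % 2 ^ i + y % 2 ^ i)) := by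
  rw [Nat.testBit_eq_decide_div_mod_eq, Nat.testBit_eq_decide_div_mod_eq,
    Nat.testBit_eq_decide_div_mod_eq, Nat.add_div (Nat.two_pow_pos i)]
  rcases Nat.mod_two_eq_zero_or_one (x / 2 ^ i) with hx | hx <;>
    rcases Nat.mod_two_eq_zero_or_one (y / 2 ^ i) with hy | hy <;>
    by_cases hc : 2 ^ i ≤ x % 2 ^ i + y % 2 ^ i <;> simp [hc, hx, hy, Nat.add_mod]

theorem carry_succ (x y i : ℕ) :
    decide (2 ^ (i + 1) ≤ x % 2 ^ (i + 1) + y % 2 ^ (i + 1)) =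
      ((x.testBit i && y.testBit i) ||
        (xor (x.testBit i) (y.testBit i) && decide (2 ^ i ≤ x % 2 ^ i + y % 2 ^ i))) := by
  rw [Nat.testBit_eq_decide_div_mod_eq, Nat.testBit_eq_decide_div_mod_eq,
    Nat.mod_pow_succ, Nat.mod_pow_succ, pow_succ]
  have h1 := Nat.mod_lt x (Nat.two_pow_pos i)
  have h2 := Nat.mod_lt y (Nat.two_pow_pos i)
  have h3 := Nat.two_pow_pos i
  generalize x % 2 ^ i = x' at *
  generalize y % 2 ^ i = y' at *
  generalize 2 ^ i = m at *
  rcases Nat.mod_two_eq_zero_or_one (x / m) with hx | hx <;>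
    rcases Nat.mod_two_eq_zero_or_one (y / m) with hy | hy <;> simp [hx, hy] <;> omega

/-- The carry into position `i` of a sum. -/
def carry (f g : α → ℕ) (i : ℕ) (a : α) : Bool := decide (2 ^ i ≤ f a % 2 ^ i + g a % 2 ^ i)

/-- Ripple-carry addition. The final carry is returned as well because it decides comparisons. -/
theorem Gets.add_carry {W : Set (α → Bool)} {k l w : ℕ} {f g : α → ℕ} (hf : Gets W k w f)
    (hg : Gets W l w g) :
    Reach W (k + l + (7 * w + 1)) (bitsOf w (fun a => f a + g a) ∪ {carry f g w}) := by
  refine (hf.union hg).bind ?_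
  set V := W ∪ (bitsOf w f ∪ bitsOf w g) with hV
  have hfV : Gets V 0 w f := .done (by intro u hu; exact Or.inr (Or.inl hu))
  have hgV : Gets V 0 w g := .done (by intro u hu; exact Or.inr (Or.inr hu))
  have key : ∀ i ≤ w, Reach V (7 * i + 1) (bitsOf i (fun a => f a + g a) ∪ {carry f g i}) := by
    intro i
    induction i with
    | zero =>
      intro _
      refine (Reach.of_const false).anti ?_
      rintro u (⟨i, hi, rfl⟩ | rfl)
      · omega
      · ext a
        simp [carry, Nat.mod_one]
    | succ i ih =>
      intro hi
      have hfi : Reach (V ∪ (bitsOf i (fun a => f a + g a) ∪ {carry f g i})) 0 _ :=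
        (hfV.bit (i := i) (by omega)).weaken
      have hgi : Reach (V ∪ (bitsOf i (fun a => f a + g a) ∪ {carry f g i})) 0 _ :=
        (hgV.bit (i := i) (by omega)).weaken
      have hc : Reach (V ∪ (bitsOf i (fun a => f a + g a) ∪ {carry f g i})) 0 {carry f g i} :=
        .done (by simp)
      have hs : Reach (V ∪ (bitsOf i (fun a => f a + g a) ∪ {carry f g i})) 0
          (bitsOf i fun a => f a + g a) := .done (by intro u hu; exact Or.inr (Or.inl hu))
      have hx := hfi.op xor hgi
      have h1 := hx.op xor hc
      have h2 := (hfi.op and hgi).op or (hx.op and hc)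
      refine (((ih (by omega)).bind ((hs.union h1).union h2)).more (by omega)).anti ?_
      rw [bitsOf_succ]
      refine Set.union_subset_union (Set.union_subset_union_right _ ?_) ?_
      · rintro u rfl
        ext a
        exact testBit_add_eq _ _ _
      · rintro u rfl
        ext a
        exact carry_succ _ _ _
  exact key w le_rfl

theorem Gets.add {W : Set (α → Bool)} {k l w : ℕ} {f g : α → ℕ} (hf : Gets W k w f)
    (hg : Gets W l w g) : Gets W (k + l + (7 * w + 1)) w fun a => f a + g a :=
  (hf.add_carry hg).anti Set.subset_union_left

/-- c ≤ f exactly when f + (2^w - c) overflows w bits; c > 0 ensures that the summand fits into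
them. -/
theorem Gets.ge_const {W : Set (α → Bool)} {k w : ℕ} {f : α → ℕ} (hf : Gets W k w f)
    (hfw : ∀ a, f a < 2 ^ w) {c : ℕ} (hc0 : 0 < c) (hc : c ≤ 2 ^ w) :
    Reach W (k + (7 * w + 3)) {fun a => decide (c ≤ f a)} := by
  refine ((hf.add_carry (Gets.const w (2 ^ w - c))).anti ?_).more (by omega)
  rintro u rfl
  refine Or.inr ?_
  ext a
  have := hfw a
  rw [carry, Nat.mod_eq_of_lt this, Nat.mod_eq_of_lt (by omega)]
  congr 1
  rw [eq_iff_iff]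
  omega

theorem Gets.mux {W : Set (α → Bool)} {k l m w : ℕ} {b : α → Bool} {f g : α → ℕ}
    (hb : Reach W m {b}) (hf : Gets W k w f) (hg : Gets W l w g) :
    Gets W (m + k + l + 3 * w) w fun a => if b a then f a else g a := by
  refine (((hb.union hf).union hg).bind ?_)
  set V := W ∪ ({b} ∪ bitsOf w f ∪ bitsOf w g) with hV
  have hbV : Reach V 0 {b} := .done (by intro u hu; exact Or.inr (Or.inl (Or.inl hu)))
  have hfV : Gets V 0 w f := .done (by intro u hu; exact Or.inr (Or.inl (Or.inr hu)))
  have hgV : Gets V 0 w g := .done (by intro u hu; exact Or.inr (Or.inr hu))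
  rw [mul_comm]
  refine Gets.of_bits fun i hi => ?_
  refine ((hbV.op and (hfV.bit hi)).op or (hbV.op (fun x y => !x && y) (hgV.bit hi))).anti ?_
  rintro u rfl
  ext a
  cases b a <;> simp

theorem Gets.shift {W : Set (α → Bool)} {k w n : ℕ} {f : α → ℕ} (hf : Gets W k (w + n) f) :
    Gets W k w fun a => f a / 2 ^ n := by
  refine hf.anti ?_
  rintro u ⟨i, hi, rfl⟩
  exact ⟨i + n, by omega, funext fun a => Nat.testBit_div_two_pow _ _⟩

/-! ### Arithmetic modulo p and division by p -/

variable {p : ℕ}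

/-- Reduction of a number below `2p`. -/
theorem Gets.reduce {W : Set (α → Bool)} {k w : ℕ} {f : α → ℕ} (hp : 0 < p) (hpw : 2 * p ≤ 2 ^ w)
    (hf : Gets W k w f) (hfp : ∀ a, f a < 2 * p) :
    Gets W (k + (17 * w + 6)) w fun a => f a % p := by
  have h0 : Gets (W ∪ bitsOf w f) 0 w f := Gets.self
  have hge := h0.ge_const (fun a => (hfp a).trans_le hpw) hp (by omega)
  -- Adding 2^w - p subtracts p modulo 2^w.
  have hsub := h0.add (Gets.const w (2 ^ w - p))
  have h := hf.bind (Gets.mux hge hsub h0)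
  rw [bitsOf_congr (g := fun a => f a % p)] at h
  · exact h.more (by omega)
  · intro a
    have := hfp a
    simp only [decide_eq_true_eq]
    split_ifs with hle
    · rw [Nat.mod_eq_sub_mod hle, Nat.mod_eq_of_lt (by omega : f a - p < p),
        show f a + (2 ^ w - p) = f a - p + 2 ^ w by omega, Nat.add_mod_right]
    · rw [Nat.mod_eq_of_lt (by omega : f a < p)]

theorem Gets.addMod {W : Set (α → Bool)} {k l w : ℕ} {f g : α → ℕ} (hp : 0 < p)
    (hpw : 2 * p ≤ 2 ^ w) (hf : Gets W k w f) (hfp : ∀ a, f a < p) (hg : Gets W l w g)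
    (hgp : ∀ a, g a < p) : Gets W (k + l + (24 * w + 7)) w fun a => (f a + g a) % p := by
  refine ((hf.add hg).reduce hp hpw fun a => ?_).more (by omega)
  have := hfp a
  have := hgp a
  omega

theorem Gets.double {W : Set (α → Bool)} {k w : ℕ} {f : α → ℕ} (hp : 0 < p)
    (hpw : 2 * p ≤ 2 ^ w) (hf : Gets W k w f) (hfp : ∀ a, f a < p) :
    Gets W (k + (24 * w + 7)) w fun a => 2 * f a % p := by
  refine ((hf.bind (Gets.self.addMod hp hpw hfp Gets.self hfp)).more (by omega)).congr fun a => ?_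
  rw [two_mul]

/-- Replacing a number by `0` unless it is below `p`. -/
theorem Gets.clamp {W : Set (α → Bool)} {k w : ℕ} {f : α → ℕ} (hp : 0 < p) (hpw : 2 * p ≤ 2 ^ w)
    (hf : Gets W k w f) (hfw : ∀ a, f a < 2 ^ w) :
    Gets W (k + (10 * w + 5)) w fun a => if f a < p then f a else 0 := by
  have h0 : Gets (W ∪ bitsOf w f) 0 w f := Gets.self
  have hge := h0.ge_const hfw hp (by omega)
  refine ((hf.bind (Gets.mux hge (Gets.const w 0) h0)).more (by omega)).congr fun a => ?_
  simp only [decide_eq_true_eq]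
  split_ifs <;> omega

/-- Horner's rule, reading the digits from the top; it drives both `Gets.mulMod` and `Gets.powMod`.
-/
theorem two_pow_div_step {x w j : ℕ} (hj : j < w) : x / 2 ^ (w - (j + 1)) =
    2 * (x / 2 ^ (w - j)) + (x.testBit (w - (j + 1))).toNat := by
  have h : 2 ^ (w - j) = 2 ^ (w - (j + 1)) * 2 := by
    rw [← pow_succ]
    congr 1
    omega
  rw [Nat.toNat_testBit, h, ← Nat.div_div_eq_div_mul]
  omega

/-- Multiplication modulo `p`, by doubling and adding. -/
theorem Gets.mulMod {W : Set (α → Bool)} {k l w : ℕ} {f g : α → ℕ} (hp : 0 < p)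
    (hpw : 2 * p ≤ 2 ^ w) (hf : Gets W k w f) (hfw : ∀ a, f a < 2 ^ w) (hg : Gets W l w g)
    (hgp : ∀ a, g a < p) :
    Gets W (k + l + (w * (51 * w + 16) + 2)) w fun a => f a * g a % p := by
  refine (hf.union hg).bind ?_
  set V := W ∪ (bitsOf w f ∪ bitsOf w g) with hV
  have hfV : Gets V 0 w f := .done (by intro u hu; exact Or.inr (Or.inl hu))
  have hgV : Gets V 0 w g := .done (by intro u hu; exact Or.inr (Or.inr hu))
  have key : ∀ j ≤ w, Gets V (j * (51 * w + 16) + 2) w fun a => f a / 2 ^ (w - j) * g a % p := by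
    intro j
    induction j with
    | zero =>
      intro _
      refine ((Gets.const w 0).more (by omega)).congr fun a => ?_
      rw [Nat.sub_zero, Nat.div_eq_of_lt (hfw a), zero_mul, Nat.zero_mod]
    | succ j ih =>
      intro hj
      have h1 := (ih (by omega)).double hp hpw fun a => Nat.mod_lt _ hp
      have h2 := Gets.mux (hfV.bit (i := w - (j + 1)) (by omega)) hgV (Gets.const w 0)
      refine ((h1.addMod hp hpw (fun a => Nat.mod_lt _ hp) h2 fun a => ?_).more ?_).congr
        fun a => ?_
      · split_ifs
        · exact hgp a
        · exact hp
      · have := Nat.succ_mul j (51 * w + 16)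
        rw [Nat.succ_eq_add_one] at this
        omega
      · rw [two_pow_div_step hj]
        cases (f a).testBit (w - (j + 1)) <;>
          simp [add_mul, mul_assoc, Nat.mul_mod, Nat.add_mod]
  refine (key w le_rfl).congr fun a => ?_
  rw [Nat.sub_self, pow_zero, Nat.div_one]

/-- Powers modulo `p`, by repeated squaring. -/
theorem Gets.powMod {W : Set (α → Bool)} {k w L e : ℕ} {f : α → ℕ} (hp : 0 < p)
    (hpw : 2 * p ≤ 2 ^ w) (hf : Gets W k w f) (hfp : ∀ a, f a < p) (he : e < 2 ^ L) :
    Gets W (k + (L * (2 * (w * (51 * w + 16) + 2)) + 2)) w fun a => f a ^ e % p := by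
  have hlt : ∀ x, x % p < 2 ^ w := fun x => by
    have := Nat.mod_lt x hp
    omega
  refine hf.bind ?_
  set V := W ∪ bitsOf w f with hV
  have hfV : Gets V 0 w f := Gets.self
  have key : ∀ j ≤ L, Gets V (j * (2 * (w * (51 * w + 16) + 2)) + 2) w
      fun a => f a ^ (e / 2 ^ (L - j)) % p := by
    intro j
    induction j with
    | zero =>
      intro _
      refine ((Gets.const w (1 % p)).more (by omega)).congr fun a => ?_
      rw [Nat.sub_zero, Nat.div_eq_of_lt he, pow_zero]
    | succ j ih =>
      intro hj
      have h1 := (ih (by omega)).bind (Gets.self.mulMod hp hpw (fun a => hlt _) Gets.self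
        fun a => Nat.mod_lt _ hp)
      have hstep := two_pow_div_step (x := e) hj
      cases hb : e.testBit (L - (j + 1)) with
      | false =>
        refine (h1.more ?_).congr fun a => ?_
        · have := Nat.succ_mul j (2 * (w * (51 * w + 16) + 2))
          rw [Nat.succ_eq_add_one] at this
          omega
        · rw [hstep, hb, Bool.toNat_false, add_zero, two_mul, pow_add, ← Nat.mul_mod]
      | true =>
        refine ((Gets.mulMod hp hpw h1 (fun a => hlt _) hfV hfp).more ?_).congr fun a => ?_
        · have := Nat.succ_mul j (2 * (w * (51 * w + 16) + 2))
          rw [Nat.succ_eq_add_one] at this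
          omega
        · rw [hstep, hb, Bool.toNat_true, pow_succ, two_mul, pow_add]
          simp [Nat.mul_mod]
  refine (key L le_rfl).congr fun a => ?_
  rw [Nat.sub_self, pow_zero, Nat.div_one]

/-- Long division: a quotient digit tells whether doubling the preceding remainder reaches p. -/
theorem testBit_div_prime {b n i : ℕ} (hp : 0 < p) (hi : i < n) :
    (2 ^ n * b / p).testBit i = decide (p ≤ 2 * (2 ^ (n - 1 - i) * b % p)) := by
  have hpow : 2 ^ n = 2 ^ i * (2 * 2 ^ (n - 1 - i)) := by
    rw [← pow_succ', ← pow_add]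
    congr 1
    omega
  rw [Nat.testBit_eq_decide_div_mod_eq, Nat.div_div_eq_div_mul, mul_comm p, hpow, mul_assoc,
    Nat.mul_div_mul_left _ _ (Nat.two_pow_pos i), mul_assoc]
  set A := 2 ^ (n - 1 - i) * b
  have hA := Nat.div_add_mod A p
  have hlt := Nat.mod_lt A hp
  have h2 : 2 * A / p = 2 * (A / p) + 2 * (A % p) / p := by
    conv_lhs => rw [← hA]
    rw [mul_add, ← mul_assoc, mul_comm 2 p, mul_assoc, Nat.mul_add_div hp]
  rw [h2, Nat.mul_add_mod]
  congr 1
  rw [eq_iff_iff]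
  by_cases hc : p ≤ 2 * (A % p)
  · have : 2 * (A % p) / p = 1 := Nat.div_eq_of_lt_le (by omega) (by omega)
    rw [this]
    simp [hc]
  · rw [Nat.div_eq_of_lt (by omega)]
    simp [hc]

/-- Division of `2 ^ n b` by `p`, one bit at a time. -/
theorem Gets.divPrime {W : Set (α → Bool)} {k w n : ℕ} {f : α → ℕ} (hp : 0 < p)
    (hpw : 2 * p ≤ 2 ^ w) (hnw : n ≤ w) (hf : Gets W k w f) (hfp : ∀ a, f a < p) :
    Gets W (k + n * (n * (24 * w + 7) + (7 * w + 3))) n fun a => 2 ^ n * f a / p := by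
  refine hf.bind ?_
  set V := W ∪ bitsOf w f with hV
  have key : ∀ j, Gets V (j * (24 * w + 7)) w fun a => 2 ^ j * f a % p := by
    intro j
    induction j with
    | zero =>
      refine (Gets.self.more (by omega)).congr fun a => ?_
      rw [pow_zero, one_mul, Nat.mod_eq_of_lt (hfp a)]
    | succ j ih =>
      refine ((ih.double hp hpw fun a => Nat.mod_lt _ hp).more (by ring_nf; exact le_rfl)).congr
        fun a => ?_
      rw [pow_succ', mul_assoc, Nat.mul_mod_mod]
  refine Gets.of_bits fun i hi => ?_
  obtain ⟨v, rfl⟩ : ∃ v, w = v + 1 := by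
    refine ⟨w - 1, ?_⟩
    omega
  have hlt : ∀ a, 2 ^ (n - 1 - i) * f a % p < p := fun a => Nat.mod_lt _ hp
  -- For integers p ≤ 2m means (p + 1)/2 ≤ m with the quotient rounded down. Every digit recomputes
  -- its own remainder, which a cubic count can afford.
  have h1 := (key (n - 1 - i)).ge_const (c := (p + 1) / 2) (fun a => by have := hlt a; omega)
    (by omega) (by omega)
  have hle : (n - 1 - i) * (24 * (v + 1) + 7) ≤ n * (24 * (v + 1) + 7) :=
    Nat.mul_le_mul_right _ (by omega)
  refine (h1.more (by omega)).anti ?_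
  rintro u rfl
  ext a
  rw [testBit_div_prime hp hi]
  congr 1
  rw [eq_iff_iff]
  omega

/-- This ceiling of f p / 2^n undoes b ↦ ⌊2^n b / p⌋, by `ceil_mul_div`. -/
theorem Gets.ceilDiv {W : Set (α → Bool)} {k w n : ℕ} {f : α → ℕ} (hpn : p < 2 ^ n)
    (hw : 2 * n + 1 ≤ w) (hf : Gets W k w f) (hfn : ∀ a, f a < 2 ^ n) :
    Gets W (k + (w * (51 * w + 16) + 7 * w + 7)) (w - n)
      fun a => (f a * p + (2 ^ n - 1)) / 2 ^ n := by
  have h2n : 2 ^ n * 2 ^ n = 2 ^ (2 * n) := by rw [← pow_add, two_mul]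
  have hnn : 2 ^ n ≤ 2 ^ (2 * n) := Nat.pow_le_pow_right (by norm_num) (by omega)
  have hnw : 2 ^ n ≤ 2 ^ w := Nat.pow_le_pow_right (by norm_num) (by omega)
  have hq : 2 * 2 ^ (2 * n) ≤ 2 ^ w := by
    rw [← pow_succ']
    exact Nat.pow_le_pow_right (by norm_num) hw
  -- The modulus 2^(2n) exceeds the product, so the modular routine yields the ordinary product.
  have h1 := (hf.mulMod (p := 2 ^ (2 * n)) (by positivity) hq (fun a => (hfn a).trans_le hnw)
    (Gets.const w p) fun a => hpn.trans_le hnn).add (Gets.const w (2 ^ n - 1))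
  have h2 : Gets W _ (w - n + n) _ := h1.le (by omega)
  refine (h2.shift.more (by omega)).congr fun a => ?_
  have : f a * p < 2 ^ (2 * n) := by
    rw [← h2n]
    exact Nat.mul_lt_mul'' (hfn a) hpn
  rw [Nat.mod_eq_of_lt this]

end Arithmetic

/-! ### Families of states -/

section Prepares

variable {D D' ι ι' α β : Type} [Fintype D] [DecidableEq D] [Fintype D'] [DecidableEq D']
  [Fintype α] [Fintype β]

/-- Some circuit with at most `k` gates and `k` qubits in state `0` takes, for every `i`, the basis
state `enc i` to the superposition of the states `out i a` with amplitudes `c i a`. -/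
def Prepares (k : ℕ) (enc : ι → D → Bool) (c : ι → α → ℂ) (out : ι → α → D → Bool) : Prop :=
  ∃ (A : Type) (_ : Fintype A) (_ : DecidableEq A)
    (M : Matrix (D ⊕ A → Bool) (D ⊕ A → Bool) ℂ), Fintype.card A ≤ k ∧ Impl (D ⊕ A) k M ∧
    ∀ i, M *ᵥ ket (pad A (enc i)) = ∑ a, c i a • ket (pad A (out i a))

namespace Prepares

variable {k l : ℕ} {enc : ι → D → Bool} {c : ι → α → ℂ} {out : ι → α → D → Bool}

theorem mono (h : Prepares k enc c out) (hkl : k ≤ l) : Prepares l enc c out := by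
  obtain ⟨A, _, _, M, hA, hM, h⟩ := h
  exact ⟨A, _, _, M, hA.trans hkl, hM.mono hkl, h⟩

theorem congr (h : Prepares k enc c out) {c' : ι → β → ℂ} {out' : ι → β → D → Bool}
    (hc : ∀ i, ∑ a, c i a • ket (out i a) = ∑ b, c' i b • ket (out' i b)) :
    Prepares k enc c' out' := by
  obtain ⟨A, _, _, M, hA, hM, h⟩ := h
  refine ⟨A, _, _, M, hA, hM, fun i => ?_⟩
  have := congrArg (ketMap (pad A)) (hc i)
  simp only [map_sum, map_smul, ketMap_ket] at this
  rw [h, this]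

/-- Reindexing of the summands. -/
theorem reindex (h : Prepares k enc c out) (e : β ≃ α) :
    Prepares k enc (fun i b => c i (e b)) fun i b => out i (e b) :=
  h.congr fun i => (e.sum_comp fun a => c i a • ket (out i a)).symm

theorem of_impl {M : Matrix (D → Bool) (D → Bool) ℂ} (hM : Impl D k M)
    (h : ∀ i, M *ᵥ ket (enc i) = ∑ a, c i a • ket (out i a)) : Prepares k enc c out := by
  refine ⟨Empty, inferInstance, inferInstance, liftMat Sum.inl M, by simp,
    hM.lift Sum.inl_injective, fun i => ?_⟩
  rw [liftMat_mulVec_of Sum.inl_injective (pad Empty (enc i)) (h i)]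
  refine Finset.sum_congr rfl fun a _ => ?_
  congr 2
  ext (d | e)
  · exact Sum.inl_injective.extend_apply _ _ _
  · exact e.elim

theorem refl (enc : ι → D → Bool) :
    Prepares 0 enc (fun _ (_ : Unit) => 1) fun i _ => enc i :=
  of_impl Impl.one fun i => by simp

/-- A further operation on some of the qubits. -/
theorem branch (h : Prepares k enc c out) {enc' : ι' → D' → Bool} {c' : ι' → β → ℂ}
    {out' : ι' → β → D' → Bool} (h' : Prepares l enc' c' out') {j : D' → D} (hj : j.Injective)
    (φ : ι → α → ι') (hφ : ∀ i a, out i a ∘ j = enc' (φ i a)) :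
    Prepares (k + l) enc (fun i (x : α × β) => c i x.1 * c' (φ i x.1) x.2)
      fun i x => Function.extend j (out' (φ i x.1) x.2) (out i x.1) := by
  obtain ⟨A, _, _, M, hA, hM, h⟩ := h
  obtain ⟨B, _, _, N, hB, hN, h'⟩ := h'
  have hjA : (Sum.map (id : D → D) (Sum.inl : A → A ⊕ B)).Injective :=
    Sum.map_injective.2 ⟨Function.injective_id, Sum.inl_injective⟩
  have hjB : (Sum.map j (Sum.inr : B → A ⊕ B)).Injective :=
    Sum.map_injective.2 ⟨hj, Sum.inr_injective⟩
  refine ⟨A ⊕ B, inferInstance, inferInstance, _, by rw [Fintype.card_sum]; omega,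
    (hN.lift hjB).mul (hM.lift hjA), fun i => ?_⟩
  have hext : ∀ (s : D → Bool) (t : D' → Bool),
      Function.extend (Sum.map j (Sum.inr : B → A ⊕ B)) (pad B t) (pad (A ⊕ B) s) =
        pad (A ⊕ B) (Function.extend j t s) := by
    intro s t
    ext (d | (a | b))
    · by_cases hd : ∃ d', j d' = d
      · obtain ⟨d', rfl⟩ := hd
        exact (hjB.extend_apply _ _ (Sum.inl d')).trans (hj.extend_apply t s d').symm
      · refine (Function.extend_apply' _ _ _ ?_).trans (Function.extend_apply' _ _ _ hd).symm
        rintro ⟨d' | b, hd'⟩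
        · exact hd ⟨d', Sum.inl_injective hd'⟩
        · cases hd'
    · exact Function.extend_apply' _ _ _ (by rintro ⟨d' | b, hd'⟩ <;> cases hd')
    · exact hjB.extend_apply _ _ (Sum.inr b)
  rw [← Matrix.mulVec_mulVec, liftMat_mulVec_of hjA _ (w := fun a => pad A (out i a))
    (S := Finset.univ) (c := c i), mulVec_sum_smul, Fintype.sum_prod_type]
  · refine Finset.sum_congr rfl fun a _ => ?_
    rw [extend_sumMap_right Sum.inl_injective, liftMat_mulVec_of hjB _
      (w := fun b => pad B (out' (φ i a) b)) (S := Finset.univ) (c := c' (φ i a)), Finset.smul_sum]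
    · refine Finset.sum_congr rfl fun b _ => ?_
      rw [smul_smul, hext]
    · rw [← h']
      congr 2
      ext (d | b)
      · exact congrFun (hφ i a) d
      · rfl
  · rw [← h]
    congr 2
    ext (d | a) <;> rfl

theorem prod_unit (h : Prepares k enc (fun i (x : α × Unit) => c i x.1) fun i x => out i x.1) :
    Prepares k enc c out :=
  h.reindex (Equiv.prodPUnit α).symm

theorem phase (h : Prepares k enc c out) {f : (D → Bool) → ℂ} (hf : DiagCircuit l f) :
    Prepares (k + l) enc (fun i a => c i a * f (out i a)) out := by
  have h' : Prepares l (fun s : D → Bool => s) (fun s (_ : Unit) => f s) fun s _ => s :=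
    of_impl hf.impl fun s => by simp [diagonal_mulVec_ket]
  have := h.branch h' Function.injective_id out fun _ _ => rfl
  exact (this.congr (c' := fun i x => c i x.1 * f (out i x.1)) (out' := fun i x => out i x.1)
    fun i => Finset.sum_congr rfl fun a _ => by
    rw [show Function.extend id (out i a.1) (out i a.1) = out i a.1 from
      funext fun d => Function.injective_id.extend_apply _ _ d]).prod_unit

theorem inPlace (h : Prepares k enc c out) {f g : (D → Bool) → (D → Bool)} {m : ℕ}
    (hf : Reach (inputBits D) l {w | ∃ e, w = fun s => f s e})
    (hg : Reach (inputBits D) m {w | ∃ e, w = fun s => g s e})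
    (hgf : ∀ i a, g (f (out i a)) = out i a) :
    Prepares (k + (60 * (l + m) + 4 * Fintype.card D)) enc c fun i a => f (out i a) := by
  obtain ⟨M, hM, hMf⟩ := exists_impl_inPlace hf hg
  have h' : Prepares (60 * (l + m) + 4 * Fintype.card D) (fun x : ι × α => out x.1 x.2)
      (fun _ (_ : Unit) => 1) fun x _ => f (out x.1 x.2) :=
    ⟨D, inferInstance, inferInstance, M, by omega, hM, fun x => by simp [hMf _ (hgf x.1 x.2)]⟩
  have := h.branch h' Function.injective_id Prod.mk fun _ _ => rfl
  exact (this.congr (c' := fun i x => c i x.1) (out' := fun i x => f (out i x.1)) fun i =>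
    Finset.sum_congr rfl fun a _ => by
    rw [mul_one, show Function.extend id (f (out i a.1)) (out i a.1) = f (out i a.1) from
      funext fun d => Function.injective_id.extend_apply _ _ d]).prod_unit

/-- An operation that is applied if the control qubit is set. -/
theorem ctrl [Fintype ι] [DecidableEq ι] {c : ι → ι → ℂ} (h : Prepares k enc c fun _ => enc) :
    Prepares (24 * k) (fun x : ι × Bool => (Sum.elim (enc x.1) fun _ => x.2 : D ⊕ Unit → Bool))
      (fun x a => if x.2 then c x.1 a else if a = x.1 then 1 else 0)
      fun x a => Sum.elim (enc a) fun _ => x.2 := by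
  obtain ⟨A, _, _, M, hA, hM, h⟩ := h
  let j : (D ⊕ A) ⊕ Unit → (D ⊕ Unit) ⊕ A :=
    Sum.elim (Sum.map Sum.inl id) fun u => Sum.inl (Sum.inr u)
  have hj : j.Injective := by
    rintro ((d | a) | u) ((d' | a') | u') <;> simp [j]
  refine ⟨A, inferInstance, inferInstance, _, by omega, (Impl.ctrl hM).lift hj, ?_⟩
  rintro ⟨i, b⟩
  have hcomp : (pad A (Sum.elim (enc i) fun _ => b : D ⊕ Unit → Bool)) ∘ j =
      Sum.elim (pad A (enc i)) fun _ => b := by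
    ext ((d | a) | u) <;> rfl
  have hext : ∀ a, Function.extend j (Sum.elim (pad A (enc a)) fun _ => b)
      (pad A (Sum.elim (enc i) fun _ => b : D ⊕ Unit → Bool)) =
      pad A (Sum.elim (enc a) fun _ => b : D ⊕ Unit → Bool) := by
    intro a
    ext ((d | u) | a')
    · exact hj.extend_apply _ _ (Sum.inl (Sum.inl d))
    · exact hj.extend_apply _ _ (Sum.inr u)
    · exact hj.extend_apply _ _ (Sum.inl (Sum.inr a'))
  rw [liftMat_mulVec_of hj _ (S := Finset.univ)
    (w := fun a => Sum.elim (pad A (enc a)) fun _ => b)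
    (c := fun a => if b then c i a else if a = i then 1 else 0)]
  · simp only [hext]
  · rw [hcomp, ctrlMat_mulVec_ket]
    cases b
    · simp
    · rw [if_pos (by rfl), liftMat_mulVec_of Sum.inl_injective
        (Sum.elim (pad A (enc i)) fun _ => true) (h i)]
      refine Finset.sum_congr rfl fun a _ => ?_
      rw [if_pos rfl]
      congr 2
      ext (d | u)
      · exact Sum.inl_injective.extend_apply _ _ _
      · exact Function.extend_apply' _ _ _ (by rintro ⟨d', hd'⟩; cases hd')

end Prepares

theorem Reach.forall_false {A Q : Type} [Fintype A] (w : A → Q) :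
    Reach (inputBits Q) (Fintype.card A + 1) {fun s => decide (∀ a, s (w a) = false)} := by
  classical
  have key : ∀ S : Finset A, Reach (inputBits Q) (S.card + 1)
      {fun s => decide (∀ a ∈ S, s (w a) = false)} := by
    intro S
    induction S using Finset.induction_on with
    | empty => simpa using Reach.of_const true
    | insert a S ha ih =>
      rw [Finset.card_insert_of_notMem ha]
      refine ((ih.op (fun x y => x && !y) (Reach.of_mem (u := fun s => s (w a)) ⟨_, rfl⟩)).more
        (by omega)).anti ?_
      rintro u rfl
      ext s
      simp only [Finset.forall_mem_insert, Bool.decide_and]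
      rw [Bool.and_comm]
      cases s (w a) <;> simp
  simpa using key Finset.univ

theorem Reach.lift_input {Q : Type} {T : Set ((D → Bool) → Bool)} {k : ℕ}
    (h : Reach (inputBits D) k T) (j : D → Q) :
    Reach (inputBits Q) k ((fun f s => f (s ∘ j)) '' T) := by
  refine (h.comp fun s : Q → Bool => s ∘ j).mono ?_ le_rfl
  rintro w ⟨_, ⟨d, rfl⟩, rfl⟩
  exact ⟨j d, rfl⟩

/-- Amplification: if two preparations have the inner products `κ F y x`, with `1 / 2 ≤ |κ|` and an
isometry `F`, then `F` itself can be computed. -/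
theorem Prepares.amplify {ι κ α β : Type} [Fintype ι] [DecidableEq ι] [Fintype κ] [Fintype α]
    [Fintype β] {k l m : ℕ} {e : ι → D → Bool} {e' : κ → D → Bool} (he : e.Injective)
    (he' : e'.Injective) {c : ι → α → ℂ} {out : ι → α → D → Bool} {c' : κ → β → ℂ}
    {out' : κ → β → D → Bool} (h : Prepares k e c out) (h' : Prepares l e' c' out')
    {F : Matrix κ ι ℂ} (hF : Fᴴ * F = 1) {z : ℂ} (hz : 1 / 2 ≤ ‖z‖)
    (hblock : ∀ y x, ∑ b, ∑ a, (if out' y b = out x a then star (c' y b) * c x a else 0) =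
      z * F y x) {π π' : (D → Bool) → Bool} (hπ : Reach (inputBits D) m {π})
    (hπ' : Reach (inputBits D) m {π'}) (hπe : ∀ s, π s = true ↔ s ∈ Set.range e)
    (hπe' : ∀ s, π' s = true ↔ s ∈ Set.range e') :
    Prepares (243 * (k + l) + 240 * m + 729) e (fun i j => F j i) fun _ => e' := by
  obtain ⟨A, _, _, M, hA, hM, h⟩ := h
  obtain ⟨B, _, _, N, hB, hN, h'⟩ := h'
  have hjA : (Sum.map (id : D → D) (Sum.inl : A → A ⊕ B)).Injective :=
    Sum.map_injective.2 ⟨Function.injective_id, Sum.inl_injective⟩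
  have hjB : (Sum.map (id : D → D) (Sum.inr : B → A ⊕ B)).Injective :=
    Sum.map_injective.2 ⟨Function.injective_id, Sum.inr_injective⟩
  -- Preparing with M and undoing N gives an operator whose entries between encoded states are the
  -- inner products of the two prepared families.
  have hU := (hN.lift hjB).conjTranspose.mul (hM.lift hjA)
  have hcol : ∀ x, liftMat (Sum.map (id : D → D) (Sum.inl : A → A ⊕ B)) M *ᵥ
      ket (pad (A ⊕ B) (e x)) = ∑ a, c x a • ket (pad (A ⊕ B) (out x a)) := by
    intro x
    rw [liftMat_mulVec_of hjA _ (w := fun a => pad A (out x a)) (S := Finset.univ) (c := c x)]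
    · simp only [extend_sumMap_right Sum.inl_injective]
    · rw [← h]
      congr 2
      ext (d | a) <;> rfl
  have hcol' : ∀ y, liftMat (Sum.map (id : D → D) (Sum.inr : B → A ⊕ B)) N *ᵥ
      ket (pad (A ⊕ B) (e' y)) = ∑ b, c' y b • ket (pad (A ⊕ B) (out' y b)) := by
    intro y
    rw [liftMat_mulVec_of hjB _ (w := fun b => pad B (out' y b)) (S := Finset.univ) (c := c' y)]
    · simp only [extend_sumMap_right Sum.inr_injective]
    · rw [← h']
      congr 2
      ext (d | a) <;> rfl
  -- The reflections must also test that the extra qubits of both preparations are 0. This costs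
  -- their number, which is why `Prepares` bounds it.
  have hpred : ∀ {π : (D → Bool) → Bool} (_ : Reach (inputBits D) m {π}),
      Reach (inputBits (D ⊕ (A ⊕ B))) (m + (k + l) + 2)
        {fun s => π (s ∘ Sum.inl) && decide (∀ x, s (Sum.inr x) = false)} := by
    intro π hπ
    have h1 : Reach (inputBits (D ⊕ (A ⊕ B))) m {fun s => π (s ∘ Sum.inl)} :=
      (hπ.lift_input Sum.inl).anti (by rintro w rfl; exact ⟨π, rfl, rfl⟩)
    refine (h1.op and (Reach.forall_false (Sum.inr : A ⊕ B → D ⊕ (A ⊕ B)))).more ?_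
    rw [Fintype.card_sum]
    omega
  have hrange : ∀ {γ : Type} {e : γ → D → Bool} {π : (D → Bool) → Bool}
      (_ : ∀ s, π s = true ↔ s ∈ Set.range e) (s : D ⊕ (A ⊕ B) → Bool),
      (π (s ∘ Sum.inl) && decide (∀ x, s (Sum.inr x) = false)) = true ↔
        s ∈ Set.range fun a => pad (A ⊕ B) (e a) := by
    intro γ e π hπ s
    rw [Bool.and_eq_true, hπ, decide_eq_true_eq]
    constructor
    · rintro ⟨⟨a, ha⟩, hs⟩
      refine ⟨a, ?_⟩
      ext (d | u)
      · exact congrFun ha d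
      · exact (hs u).symm
    · rintro ⟨a, rfl⟩
      exact ⟨⟨a, rfl⟩, fun _ => rfl⟩
  have hent : ∀ x y, ((liftMat (Sum.map (id : D → D) (Sum.inr : B → A ⊕ B)) N)ᴴ *
      liftMat (Sum.map (id : D → D) (Sum.inl : A → A ⊕ B)) M) (pad (A ⊕ B) (e' y))
      (pad (A ⊕ B) (e x)) = z * F y x := by
    intro x y
    rw [← hblock, Matrix.mul_apply]
    have h1 : ∀ t,
        (liftMat (Sum.map (id : D → D) (Sum.inr : B → A ⊕ B)) N)ᴴ (pad (A ⊕ B) (e' y)) t =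
        ∑ b, star (c' y b) * (if t = pad (A ⊕ B) (out' y b) then 1 else 0) := by
      intro t
      rw [Matrix.conjTranspose_apply, ← mulVec_ket_apply (liftMat _ N), hcol', Finset.sum_apply,
        star_sum]
      refine Finset.sum_congr rfl fun b _ => ?_
      rw [Pi.smul_apply, ket_apply, smul_eq_mul, star_mul', apply_ite star, star_one, star_zero]
    have h2 : ∀ t, liftMat (Sum.map (id : D → D) (Sum.inl : A → A ⊕ B)) M t (pad (A ⊕ B) (e x)) =
        ∑ a, c x a * (if t = pad (A ⊕ B) (out x a) then 1 else 0) := by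
      intro t
      rw [← mulVec_ket_apply (liftMat _ M), hcol, Finset.sum_apply]
      refine Finset.sum_congr rfl fun b _ => ?_
      rw [Pi.smul_apply, ket_apply, smul_eq_mul]
    simp only [h1, h2, Finset.sum_mul_sum]
    rw [Finset.sum_comm]
    refine Finset.sum_congr rfl fun b _ => ?_
    rw [Finset.sum_comm]
    refine Finset.sum_congr rfl fun a _ => ?_
    rw [Finset.sum_eq_single (pad (A ⊕ B) (out' y b))]
    · by_cases hab : out' y b = out x a
      · simp [hab]
      · rw [if_neg hab, if_neg (c := pad (A ⊕ B) (out' y b) = pad (A ⊕ B) (out x a))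
          fun hh => hab (pad_injective hh)]
        ring
    · intro t _ ht
      rw [if_neg ht]
      ring
    · simp
  obtain ⟨R, hR, hRact⟩ := exists_impl_amplified hU (pad_injective.comp he)
    (pad_injective.comp he') hF hz hent (hpred hπ) (hpred hπ') (hrange hπe)
    (hrange hπe')
  let j : (D ⊕ (A ⊕ B)) ⊕ Unit → D ⊕ ((A ⊕ B) ⊕ Unit) := Equiv.sumAssoc D (A ⊕ B) Unit
  have hj : j.Injective := (Equiv.sumAssoc D (A ⊕ B) Unit).injective
  refine ⟨(A ⊕ B) ⊕ Unit, inferInstance, inferInstance, _, ?_,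
    (hR.lift hj).mono (by omega), fun x => ?_⟩
  · simp only [Fintype.card_sum, Fintype.card_unit]
    omega
  · rw [liftMat_mulVec_of hj _ (S := Finset.univ) (c := fun y => F y x)
      (w := fun y => pad Unit (pad (A ⊕ B) (e' y)))]
    · refine Finset.sum_congr rfl fun y _ => ?_
      congr 2
      ext (d | (q | u))
      · exact hj.extend_apply _ _ (Sum.inl (Sum.inl d))
      · exact hj.extend_apply _ _ (Sum.inl (Sum.inr q))
      · exact hj.extend_apply _ _ (Sum.inr u)
    · refine Eq.trans ?_ (hRact x)
      congr 2
      ext ((d | q) | u) <;> rfl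

end Prepares

/-! ### Words and the Fourier transform modulo a power of two -/

section Words

variable {n : ℕ}

/-- The word of the lowest `n` bits of a number. -/
def bits (n a : ℕ) : Fin n → Bool := fun i => a.testBit i

theorem ofBits_bits {a : ℕ} (h : a < 2 ^ n) : Nat.ofBits (bits n a) = a :=
  (Nat.ofBits_testBit a n).trans (Nat.mod_eq_of_lt h)

theorem bits_ofBits (u : Fin n → Bool) : bits n (Nat.ofBits u) = u := by
  ext i
  rw [bits, Nat.testBit_ofBits_lt _ _ i.2]

theorem bits_injOn {a b : ℕ} (ha : a < 2 ^ n) (hb : b < 2 ^ n) (h : bits n a = bits n b) :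
    a = b := by
  rw [← ofBits_bits ha, h, ofBits_bits hb]

theorem ofBits_eq_sum (u : Fin n → Bool) :
    Nat.ofBits u = ∑ i : Fin n, 2 ^ (i : ℕ) * (u i).toNat := by
  induction n with
  | zero => simp
  | succ n ih =>
    rw [Nat.ofBits_succ, ih, Fin.sum_univ_succ, Finset.mul_sum, add_comm]
    simp [pow_succ', mul_assoc]

/-- The number whose binary digits are those of the word in the reverse order. -/
def revVal (u : Fin n → Bool) : ℕ := Nat.ofBits fun i => u i.rev

theorem revVal_eq_sum (u : Fin n → Bool) :
    revVal u = ∑ i : Fin n, 2 ^ (n - 1 - (i : ℕ)) * (u i).toNat := by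
  rw [revVal, ofBits_eq_sum, ← Equiv.sum_comp Fin.revPerm]
  refine Finset.sum_congr rfl fun i _ => ?_
  rw [Fin.revPerm_apply, Fin.rev_rev, Fin.val_rev]
  congr 2
  omega

theorem revVal_lt (u : Fin n → Bool) : revVal u < 2 ^ n := Nat.ofBits_lt_two_pow _

/-- The word with value `a` in the reverse order. -/
def revBits (n a : ℕ) : Fin n → Bool := fun i => a.testBit i.rev

theorem revVal_revBits {a : ℕ} (h : a < 2 ^ n) : revVal (revBits n a) = a := by
  unfold revVal revBits
  simp only [Fin.rev_rev]
  exact ofBits_bits h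

theorem revBits_revVal (u : Fin n → Bool) : revBits n (revVal u) = u := by
  ext i
  rw [revBits, revVal, Nat.testBit_ofBits_lt _ _ i.rev.2]
  exact congrArg u (Fin.rev_rev i)

theorem phase_two_pi_mul_nat (k : ℕ) : phase (2 * Real.pi * k) = 1 := by
  rw [phase]
  push_cast
  rw [mul_assoc, mul_comm, mul_assoc, Complex.exp_eq_one_iff]
  exact ⟨k, by push_cast; ring⟩

theorem phase_pi : phase Real.pi = -1 := by simp [phase]

/-- The Hadamard gate. -/
def hadamard : Matrix.unitaryGroup Bool ℂ :=
  ⟨Matrix.of fun b c => ((Real.sqrt 2)⁻¹ : ℝ) * phase (Real.pi * (b.toNat * c.toNat)),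
    Matrix.mem_unitaryGroup_iff'.2 (by
      have h : (((Real.sqrt 2)⁻¹ : ℝ) : ℂ) * ((Real.sqrt 2)⁻¹ : ℝ) = 1 / 2 := by
        rw [← Complex.ofReal_mul, ← mul_inv, Real.mul_self_sqrt (by norm_num)]
        norm_num
      ext b c
      rw [Matrix.mul_apply, Fintype.sum_bool]
      simp only [Matrix.star_apply, Matrix.of_apply, star_mul', ← starRingEnd_apply (phase _),
        ← starRingEnd_apply (Complex.ofReal _), Complex.conj_ofReal]
      cases b <;> cases c <;> simp only [Bool.toNat_true, Bool.toNat_false, Nat.cast_one,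
        Nat.cast_zero, mul_zero, mul_one, phase_zero, phase_pi, map_one, map_neg, h,
        mul_neg, neg_mul, neg_neg, Matrix.one_apply] <;> norm_num)⟩

theorem hadamard_apply (b c : Bool) : (hadamard : Matrix Bool Bool ℂ) b c =
    ((Real.sqrt 2)⁻¹ : ℝ) * phase (Real.pi * (b.toNat * c.toNat)) := rfl

/-- The matrix of the Fourier transform modulo `2 ^ n`, the output being in the reverse order. -/
def fourierMat (n : ℕ) : Matrix (Fin n → Bool) (Fin n → Bool) ℂ := fun u s =>
  ((Real.sqrt (2 ^ n))⁻¹ : ℝ) * phase (2 * Real.pi * ((revVal u * Nat.ofBits s : ℕ) / 2 ^ n))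

/-- The phases accumulated when the qubits from `k` on have been transformed. -/
def partialAngle (k : ℕ) (u s : Fin n → Bool) : ℝ :=
  ∑ i : Fin n, ∑ j : Fin n, if k ≤ i ∧ j ≤ i then
    2 * Real.pi * (2 ^ (j : ℕ) / 2 ^ (i + 1 : ℕ)) * ((u i).toNat * (s j).toNat) else 0

/-- The operator that has transformed the qubits from `k` on. -/
def partialFourier (n k : ℕ) : Matrix (Fin n → Bool) (Fin n → Bool) ℂ := fun u s =>
  if ∀ j : Fin n, (j : ℕ) < k → u j = s j then
    (((Real.sqrt 2)⁻¹ ^ (n - k) : ℝ) : ℂ) * phase (partialAngle k u s) else 0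

theorem partialFourier_self : partialFourier n n = 1 := by
  ext u s
  have h0 : partialAngle n u s = 0 :=
    Finset.sum_eq_zero fun i _ => Finset.sum_eq_zero fun j _ => if_neg (by omega)
  rw [partialFourier, h0, Matrix.one_apply]
  by_cases h : u = s
  · simp [h, phase_zero]
  · rw [if_neg h, if_neg fun h' => h (funext fun j => h' j j.2)]

/-- In the product of the reversed output and the input, the pairs of digits with j > i contribute
integral multiples of 2π and may be dropped. -/
theorem partialAngle_zero (u s : Fin n → Bool) : phase (partialAngle 0 u s) =
    phase (2 * Real.pi * ((revVal u * Nat.ofBits s : ℕ) / 2 ^ n)) := by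
  have key : (2 * Real.pi * ((revVal u * Nat.ofBits s : ℕ) / 2 ^ n) : ℝ) = partialAngle 0 u s +
      2 * Real.pi * (∑ i : Fin n, ∑ j : Fin n,
        if j ≤ i then 0 else 2 ^ (j - i - 1 : ℕ) * ((u i).toNat * (s j).toNat) : ℕ) := by
    rw [revVal_eq_sum, ofBits_eq_sum, Finset.sum_mul_sum, partialAngle]
    push_cast
    rw [Finset.sum_div, Finset.mul_sum, Finset.mul_sum, ← Finset.sum_add_distrib]
    refine Finset.sum_congr rfl fun i _ => ?_
    rw [Finset.sum_div, Finset.mul_sum, Finset.mul_sum, ← Finset.sum_add_distrib]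
    refine Finset.sum_congr rfl fun j _ => ?_
    have hi : (2 : ℝ) ^ (n - 1 - (i : ℕ)) = 2 ^ n / 2 ^ (i + 1 : ℕ) := by
      rw [eq_div_iff (by positivity), ← pow_add]
      congr 1
      omega
    by_cases hij : j ≤ i
    · rw [if_pos ⟨Nat.zero_le _, hij⟩, if_pos hij, hi]
      field_simp
      ring
    · have hj : (2 : ℝ) ^ (j - i - 1 : ℕ) = 2 ^ (j : ℕ) / 2 ^ (i + 1 : ℕ) := by
        rw [eq_div_iff (by positivity), ← pow_add]
        congr 1
        omega
      rw [if_neg (by tauto), if_neg hij, hi, hj]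
      field_simp
      ring
  rw [key, phase_add, phase_two_pi_mul_nat, mul_one]

theorem partialFourier_zero : partialFourier n 0 = fourierMat n := by
  ext u s
  rw [partialFourier, fourierMat, if_pos (fun j h => absurd h (Nat.not_lt_zero _)),
    ← partialAngle_zero, Nat.sub_zero, inv_pow]
  have h : Real.sqrt 2 ^ n = Real.sqrt (2 ^ n) := by
    rw [eq_comm, Real.sqrt_eq_iff_mul_self_eq (by positivity) (by positivity), ← mul_pow,
      Real.mul_self_sqrt (by norm_num)]
  rw [h]

theorem partialAngle_succ (m : Fin n) (u s : Fin n → Bool) : partialAngle m u s =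
    partialAngle (m + 1) u s + ∑ j : Fin n, if j ≤ m then
      2 * Real.pi * (2 ^ (j : ℕ) / 2 ^ (m + 1 : ℕ)) * ((u m).toNat * (s j).toNat) else 0 := by
  rw [partialAngle, partialAngle, ← Finset.add_sum_erase _ _ (Finset.mem_univ m),
    ← Finset.add_sum_erase (a := m) _ (fun i : Fin n => ∑ j : Fin n, if (m : ℕ) + 1 ≤ i ∧ j ≤ i then
      2 * Real.pi * (2 ^ (j : ℕ) / 2 ^ (i + 1 : ℕ)) * ((u i).toNat * (s j).toNat) else 0)
      (Finset.mem_univ m)]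
  have h0 : (∑ j : Fin n, if (m : ℕ) + 1 ≤ m ∧ j ≤ m then
      2 * Real.pi * (2 ^ (j : ℕ) / 2 ^ (m + 1 : ℕ)) * ((u m).toNat * (s j).toNat) else 0) = 0 :=
    Finset.sum_eq_zero fun j _ => if_neg (by omega)
  rw [h0, zero_add, add_comm]
  congr 1
  · refine Finset.sum_congr rfl fun i hi => Finset.sum_congr rfl fun j _ => ?_
    have : (i : ℕ) ≠ m := fun h => (Finset.mem_erase.1 hi).1 (Fin.ext h)
    have hiff : (m : ℕ) ≤ i ↔ (m : ℕ) + 1 ≤ i := by omega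
    simp only [hiff]
  · simp

theorem partialAngle_update (m : Fin n) (u s : Fin n → Bool) (b : Bool) :
    partialAngle (m + 1) (Function.update u m b) s = partialAngle (m + 1) u s := by
  refine Finset.sum_congr rfl fun i _ => Finset.sum_congr rfl fun j _ => ?_
  by_cases hi : i = m
  · subst hi
    rw [if_neg (by omega), if_neg (by omega)]
  · rw [Function.update_of_ne hi]

theorem single_mul_apply {Q : Type} [Fintype Q] [DecidableEq Q] (q : Q)
    (U : Matrix.unitaryGroup Bool ℂ) (M : Matrix (Q → Bool) (Q → Bool) ℂ) (u s : Q → Bool) :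
    ((Gate.single q U).matrix * M) u s =
      ∑ b, (U : Matrix Bool Bool ℂ) (u q) b * M (Function.update u q b) s := by
  rw [Matrix.mul_apply]
  have h : ∀ t : Q → Bool, (Gate.single q U).matrix u t * M t s = ∑ b,
      if t = Function.update u q b then
        (U : Matrix Bool Bool ℂ) (u q) b * M (Function.update u q b) s else 0 := by
    intro t
    change (if ∀ r, r ≠ q → u r = t r then (U : Matrix Bool Bool ℂ) (u q) (t q) else 0) * M t s = _
    by_cases ht : ∀ r, r ≠ q → u r = t r
    · have htu : t = Function.update u q (t q) := by
        ext r
        by_cases hr : r = q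
        · subst hr; simp
        · rw [Function.update_of_ne hr, ht r hr]
      rw [if_pos ht, Finset.sum_eq_single (t q)]
      · rw [if_pos htu, ← htu]
      · intro b _ hb
        rw [if_neg]
        intro h
        exact hb (by rw [h]; simp)
      · simp
    · rw [if_neg ht, zero_mul, Finset.sum_eq_zero]
      intro b _
      rw [if_neg]
      rintro rfl
      exact ht fun r hr => (Function.update_of_ne hr _ _).symm
  simp only [h]
  rw [Finset.sum_comm]
  simp

/-- The qubits are transformed from the top down, so those below m still hold input digits. The
Hadamard gate accounts for the pair (m, m), and the phases controlled by the lower qubits for the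
pairs (m, j) with j < m. -/
theorem partialFourier_step (m : Fin n) : partialFourier n m =
    Matrix.diagonal (fun u : Fin n → Bool => phase (∑ i, ∑ j, (if i = m ∧ j < m then
      2 * Real.pi * (2 ^ (j : ℕ) / 2 ^ (m + 1 : ℕ)) else 0) * ((u i).toNat * (u j).toNat))) *
      ((Gate.single m hadamard).matrix * partialFourier n (m + 1)) := by
  ext u s
  rw [Matrix.diagonal_mul, single_mul_apply, Finset.sum_eq_single (s m)]
  · rw [partialFourier, partialFourier, partialAngle_update]
    by_cases h : ∀ j : Fin n, (j : ℕ) < m → u j = s j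
    · rw [if_pos h, if_pos]
      · rw [hadamard_apply, partialAngle_succ, phase_add,
          show n - (m : ℕ) = n - (m + 1) + 1 by omega, pow_succ]
        have hsum : (∑ j : Fin n, if j ≤ m then
            2 * Real.pi * (2 ^ (j : ℕ) / 2 ^ (m + 1 : ℕ)) * ((u m).toNat * (s j).toNat) else 0) =
            (∑ i, ∑ j, (if i = m ∧ j < m then
              2 * Real.pi * (2 ^ (j : ℕ) / 2 ^ (m + 1 : ℕ)) else 0) *
                ((u i).toNat * (u j).toNat)) + Real.pi * ((u m).toNat * (s m).toNat) := by
          rw [Finset.sum_eq_single (s := (Finset.univ : Finset (Fin n))) (a := m)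
            (f := fun i : Fin n => ∑ j : Fin n, (if i = m ∧ j < m then
              2 * Real.pi * (2 ^ (j : ℕ) / 2 ^ (m + 1 : ℕ)) else 0) *
                ((u i).toNat * (u j).toNat)),
            ← Finset.add_sum_erase _ _ (Finset.mem_univ m),
            ← Finset.add_sum_erase (a := m) (f := fun j : Fin n => (if m = m ∧ j < m then
              2 * Real.pi * (2 ^ (j : ℕ) / 2 ^ (m + 1 : ℕ)) else 0) *
                ((u m).toNat * (u j).toNat)) _ (Finset.mem_univ m)]
          · rw [if_pos le_rfl, if_neg (by simp), zero_mul, zero_add, add_comm]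
            congr 1
            · refine Finset.sum_congr rfl fun j hj => ?_
              have hne : j ≠ m := (Finset.mem_erase.1 hj).1
              by_cases hjm : j < m
              · rw [if_pos hjm.le, if_pos ⟨rfl, hjm⟩, h j hjm]
              · rw [if_neg fun h' => hjm (lt_of_le_of_ne h' hne), if_neg (by tauto), zero_mul]
            · rw [pow_succ]
              field_simp
          · intro i _ hi
            exact Finset.sum_eq_zero fun j _ => by rw [if_neg (by tauto), zero_mul]
          · simp
        rw [hsum, phase_add]
        push_cast
        ring
      · intro j hj
        by_cases hjm : j = m
        · subst hjm; simp
        · rw [Function.update_of_ne hjm]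
          exact h j (by have : (j : ℕ) ≠ m := fun h => hjm (Fin.ext h)
                        omega)
    · rw [if_neg h, if_neg, mul_zero, mul_zero]
      intro h'
      refine h fun j hj => ?_
      have hne : j ≠ m := fun h => by subst h; omega
      rw [← h' j (by omega), Function.update_of_ne hne]
  · intro b _ hb
    rw [partialFourier, if_neg, mul_zero]
    intro h
    exact hb (by rw [← h m (by omega)]; simp)
  · simp

/-- Charging all n² pairs at each of the n steps is wasteful but stays cubic. -/
theorem impl_fourierMat (n : ℕ) : Impl (Fin n) (n * (5 * n ^ 2 + 1)) (fourierMat n) := by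
  have key : ∀ k ≤ n, Impl (Fin n) (k * (5 * n ^ 2 + 1)) (partialFourier n (n - k)) := by
    intro k
    induction k with
    | zero =>
      intro _
      rw [Nat.sub_zero, partialFourier_self, zero_mul]
      exact Impl.one
    | succ k ih =>
      intro hk
      have hm : n - (k + 1) < n := by omega
      have h := partialFourier_step (⟨n - (k + 1), hm⟩ : Fin n)
      have h1 : n - (k + 1) + 1 = n - k := by omega
      simp only [h1] at h
      rw [h]
      have hd := (diagCircuit_quadratic fun i j : Fin n =>
        if i = ⟨n - (k + 1), hm⟩ ∧ j < ⟨n - (k + 1), hm⟩ then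
          2 * Real.pi * (2 ^ (j : ℕ) / 2 ^ (n - k)) else 0).impl
      have hg := Impl.of_circuit [Gate.single (⟨n - (k + 1), hm⟩ : Fin n) hadamard]
      rw [circuitMatrix_singleton] at hg
      refine (hd.mul (hg.mul (ih (by omega)))).mono ?_
      rw [Fintype.card_fin, List.length_singleton]
      ring_nf
      exact le_rfl
  have := key n le_rfl
  rwa [Nat.sub_self, partialFourier_zero] at this

end Words

/-! ### Uniform superpositions -/

section Uniform

variable {n p : ℕ}

theorem Gets.input {D : Type} (j : Fin n → D) :
    Gets (inputBits D) 0 n fun s : D → Bool => Nat.ofBits (s ∘ j) := by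
  refine .done ?_
  rintro u ⟨i, hi, rfl⟩
  exact ⟨j ⟨i, hi⟩, funext fun s => Nat.testBit_ofBits_lt _ _ hi⟩

theorem Gets.widen {α : Type} {W : Set (α → Bool)} {k w v : ℕ} {f : α → ℕ} (h : Gets W k w f)
    (hf : ∀ a, f a < 2 ^ w) : Gets W (k + 1) v f := by
  refine (h.union (Reach.of_const false)).anti ?_
  rintro u ⟨i, -, rfl⟩
  by_cases hi : i < w
  · exact Or.inl ⟨i, hi, rfl⟩
  · refine Or.inr (funext fun a => ?_)
    exact Nat.testBit_lt_two_pow ((hf a).trans_le (Nat.pow_le_pow_right (by norm_num) (by omega)))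

theorem Reach.lt_const {α : Type} {W : Set (α → Bool)} {k w : ℕ} {f : α → ℕ} (hf : Gets W k w f)
    (hfw : ∀ a, f a < 2 ^ w) {c : ℕ} (hc0 : 0 < c) (hc : c ≤ 2 ^ w) :
    Reach W (k + (7 * w + 4)) {fun a => decide (f a < c)} := by
  have h := (hf.ge_const hfw hc0 hc).bind
    (Reach.step (k := 0) (T := {fun a => !decide (c ≤ f a)}) (fun x _ => !x) _ _ (Or.inr rfl)
      (Or.inr rfl) (.done (by simp)))
  refine (h.anti ?_).more (by omega)
  rintro u rfl
  ext a
  rcases lt_or_ge (f a) c with h | h <;> simp [h]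

variable [NeZero p]

/-- The word of a residue. -/
def zbits (n : ℕ) (x : ZMod p) : Fin n → Bool := bits n x.val

theorem ofBits_zbits (hp : p < 2 ^ n) (x : ZMod p) : Nat.ofBits (zbits n x) = x.val :=
  ofBits_bits ((ZMod.val_lt x).trans hp)

theorem zbits_injective (hp : p < 2 ^ n) : (zbits n : ZMod p → Fin n → Bool).Injective := by
  intro x y h
  exact ZMod.val_injective p (by rw [← ofBits_zbits hp x, h, ofBits_zbits hp])

theorem mem_range_zbits (hp : p < 2 ^ n) (s : Fin n → Bool) :
    s ∈ Set.range (zbits n : ZMod p → Fin n → Bool) ↔ Nat.ofBits s < p := by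
  constructor
  · rintro ⟨x, rfl⟩
    rw [ofBits_zbits hp]
    exact ZMod.val_lt x
  · intro h
    exact ⟨(Nat.ofBits s : ℕ), by rw [zbits, ZMod.val_natCast, Nat.mod_eq_of_lt h, bits_ofBits]⟩

/-- The transform of the zero word is uniform on 2^n words. Its restriction to residues is √(p/2^n)
≥ 1/2 times the wanted state, which is amplified against the trivial preparation. -/
theorem prepares_uniform (hp : p < 2 ^ n) (hp2 : 2 ^ n ≤ 2 * p) :
    Prepares (5100 * n ^ 3) (fun (_ : Unit) (_ : Fin n) => false)
      (fun _ (_ : ZMod p) => (((Real.sqrt p)⁻¹ : ℝ) : ℂ)) fun _ => zbits n := by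
  have hp0 : 0 < p := NeZero.pos p
  have hn : 1 ≤ n := by
    rcases Nat.eq_zero_or_pos n with rfl | h
    · rw [pow_zero] at hp
      omega
    · exact h
  have h1 : Prepares (n * (5 * n ^ 2 + 1)) (fun (_ : Unit) (_ : Fin n) => false)
      (fun _ u => fourierMat n u fun _ => false) fun _ (u : Fin n → Bool) => u :=
    .of_impl (impl_fourierMat n) fun _ => mulVec_ket _ _
  have hpR : (0 : ℝ) < p := by exact_mod_cast hp0
  have hz : (1 / 2 : ℝ) ≤ ‖(((Real.sqrt (2 ^ n))⁻¹ : ℝ) : ℂ) * (Real.sqrt p : ℝ)‖ := by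
    rw [norm_mul, Complex.norm_real, Complex.norm_real, Real.norm_eq_abs,
      Real.norm_eq_abs, abs_of_nonneg (by positivity), abs_of_nonneg (Real.sqrt_nonneg _),
      inv_mul_eq_div, le_div_iff₀ (by positivity), ← Real.sqrt_sq (by norm_num : (0 : ℝ) ≤ 1 / 2),
      ← Real.sqrt_mul (by norm_num)]
    refine Real.sqrt_le_sqrt ?_
    have : (2 ^ n : ℝ) ≤ 2 * p := by exact_mod_cast hp2
    linarith
  refine (Prepares.amplify (F := Matrix.of fun (_ : ZMod p) (_ : Unit) =>
      (((Real.sqrt p)⁻¹ : ℝ) : ℂ))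
    (m := 7 * n + 4) (π := fun s => decide (∀ i, s (id i) = false))
    (π' := fun s => decide (Nat.ofBits s < p)) (fun _ _ _ => rfl)
    (zbits_injective hp) h1 (Prepares.refl (zbits n)) ?_ hz ?_ ?_ ?_ ?_ ?_).mono ?_
  · ext i j
    rw [Matrix.mul_apply]
    simp only [Matrix.of_apply, Matrix.conjTranspose_apply, ← starRingEnd_apply,
      Complex.conj_ofReal, ← Complex.ofReal_mul, ← mul_inv, Real.mul_self_sqrt hpR.le,
      Finset.sum_const, Finset.card_univ, ZMod.card]
    simp
  · intro y x
    have h0 : Nat.ofBits (fun _ : Fin n => false) = 0 := by simp [ofBits_eq_sum]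
    rw [Fintype.sum_unique, Finset.sum_ite_eq, if_pos (Finset.mem_univ _), star_one, one_mul,
      fourierMat, h0]
    simp [phase_zero, hpR.ne']
  · convert (Reach.forall_false (id : Fin n → Fin n)).more (l := 7 * n + 4)
      (by rw [Fintype.card_fin]; omega)
  · exact (Reach.lt_const (Gets.input id) (fun s => Nat.ofBits_lt_two_pow _) hp0 hp.le).more
      (by omega)
  · intro s
    rw [decide_eq_true_eq]
    constructor
    · intro h
      exact ⟨(), funext fun i => (h i).symm⟩
    · rintro ⟨-, rfl⟩ i
      rfl
  · intro s
    rw [mem_range_zbits hp, decide_eq_true_eq]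
  · have h2 : n ≤ n ^ 3 := Nat.le_self_pow (by norm_num) n
    have h3 : 1 ≤ n ^ 3 := Nat.one_le_pow _ _ hn
    ring_nf
    omega

end Uniform

/-! ### The error of rounding a Fourier transform -/

section Rounding

theorem one_sub_le_cos {t : ℝ} (ht : |t| ≤ Real.pi / 2) : 1 - 2 / Real.pi * |t| ≤ Real.cos t := by
  rw [← Real.cos_abs]
  exact Real.one_sub_mul_le_cos (abs_nonneg t) ht

theorem sum_range_id_real (m : ℕ) : ∑ a ∈ Finset.range m, (a : ℝ) = m * (m - 1) / 2 := by
  induction m with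
  | zero => simp
  | succ m ih =>
    rw [Finset.sum_range_succ, ih]
    push_cast
    ring

/-- Centring at p/2 makes the mean distance at most p/4; this mean determines the loss caused by
rounding. -/
theorem sum_abs_sub_half_le (p : ℕ) :
    ∑ a ∈ Finset.range p, |(a : ℝ) - (p / 2 : ℕ)| ≤ p ^ 2 / 4 := by
  obtain ⟨m, l, hp, hm, hl⟩ : ∃ m l, p = m + l ∧ p / 2 = m ∧ (l = m ∨ l = m + 1) :=
    ⟨p / 2, p - p / 2, by omega, rfl, by omega⟩
  rw [hm, hp, Finset.sum_range_add]
  have h1 : ∑ a ∈ Finset.range m, |(a : ℝ) - m| = m * (m + 1) / 2 := by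
    have : ∀ a ∈ Finset.range m, |(a : ℝ) - m| = m - a := by
      intro a ha
      have : (a : ℝ) ≤ m := by exact_mod_cast (Finset.mem_range.1 ha).le
      rw [abs_of_nonpos (by linarith)]
      ring
    rw [Finset.sum_congr rfl this, Finset.sum_sub_distrib, sum_range_id_real]
    simp
    ring
  have h2 : ∑ a ∈ Finset.range l, |((m + a : ℕ) : ℝ) - m| = l * (l - 1) / 2 := by
    rw [← sum_range_id_real]
    refine Finset.sum_congr rfl fun a _ => ?_
    push_cast
    rw [add_sub_cancel_left, abs_of_nonneg (Nat.cast_nonneg a)]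
  rw [h1, h2]
  rcases hl with rfl | rfl
  · push_cast
    nlinarith
  · push_cast
    nlinarith

/-- Shifting the floor by 1/2 makes the error symmetric and halves its bound. The phase πa/2^n in
`approxAngle` implements this shift. -/
theorem abs_rounding_le {p N b : ℕ} (hp : 0 < p) (hN : 0 < N) :
    |(((N * b / p : ℕ) : ℝ) + 1 / 2) / N - b / p| ≤ 1 / (2 * N) := by
  have hp' : (0 : ℝ) < p := by exact_mod_cast hp
  have hN' : (0 : ℝ) < N := by exact_mod_cast hN
  have h1 : ((N * b / p : ℕ) : ℝ) * p ≤ N * b := by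
    exact_mod_cast Nat.div_mul_le_self (N * b) p
  have h2 : (N * b : ℝ) < (((N * b / p : ℕ) : ℝ) + 1) * p := by
    have := Nat.lt_mul_div_succ (N * b) hp
    rw [mul_comm p] at this
    exact_mod_cast this
  rw [show (((N * b / p : ℕ) : ℝ) + 1 / 2) / N - b / p =
    (((N * b / p : ℕ) : ℝ) + 1 / 2 - N * b / p) / N by field_simp, abs_div,
    abs_of_pos hN', div_le_div_iff₀ hN' (by positivity), one_mul]
  have h3 : ((N * b / p : ℕ) : ℝ) ≤ N * b / p := by rwa [le_div_iff₀ hp']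
  have h4 : (N * b / p : ℝ) < ((N * b / p : ℕ) : ℝ) + 1 := by rwa [div_lt_iff₀ hp']
  have h5 : |((N * b / p : ℕ) : ℝ) + 1 / 2 - N * b / p| ≤ 1 / 2 := by
    rw [abs_le]
    constructor <;> linarith
  nlinarith

/-- The phases of the rounded transform are close to those of the exact one. -/
theorem norm_sum_phase_ge {p N : ℕ} (hp : 0 < p) (hpN : p ≤ N) :
    (p : ℝ) ^ 2 * (1 - p / (2 * N)) ≤ ‖∑ a ∈ Finset.range p, ∑ b ∈ Finset.range p,
      phase (2 * Real.pi * ((a - (p / 2 : ℕ)) * ((N * b / p : ℕ) : ℝ) / N + a / (2 * N) -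
        (a - (p / 2 : ℕ)) * b / p))‖ := by
  have hN : 0 < N := by omega
  have hp' : (0 : ℝ) < p := by exact_mod_cast hp
  have hN' : (0 : ℝ) < N := by exact_mod_cast hN
  have hpN' : (p : ℝ) ≤ N := by exact_mod_cast hpN
  set κ : ℝ := ((p / 2 : ℕ) : ℝ) with hκ
  have hphase : ∀ t, ‖phase t‖ = 1 := fun t => Complex.norm_exp_ofReal_mul_I t
  -- A common phase turns a/(2N) into (a - κ)/(2N); then every angle is 2π(a - κ) times the
  -- symmetric rounding error.
  have hz : ∀ z : ℂ, ‖z‖ = ‖z * phase (-(Real.pi * κ / N))‖ := fun z => by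
    rw [norm_mul, hphase, mul_one]
  rw [hz]
  refine le_trans ?_ (Complex.re_le_norm _)
  rw [Finset.sum_mul, Complex.re_sum]
  have hre : ∀ t, (phase t).re = Real.cos t := fun t => Complex.exp_ofReal_mul_I_re t
  have hcos : ∀ a ∈ Finset.range p, ∀ b : ℕ, 1 - 2 * |(a : ℝ) - κ| / N ≤ Real.cos (2 * Real.pi *
      ((a - κ) * ((N * b / p : ℕ) : ℝ) / N + a / (2 * N) - (a - κ) * b / p) +
        -(Real.pi * κ / N)) := by
    intro a ha b
    have h1 := abs_rounding_le (b := b) hp hN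
    set t := 2 * Real.pi * ((a - κ) * ((N * b / p : ℕ) : ℝ) / N + a / (2 * N) - (a - κ) * b / p) +
        -(Real.pi * κ / N) with ht
    have h2 : t = 2 * Real.pi * (a - κ) * ((((N * b / p : ℕ) : ℝ) + 1 / 2) / N - b / p) := by
      rw [ht]
      field_simp
      ring
    have h3 : |t| ≤ Real.pi * |(a : ℝ) - κ| / N := by
      rw [h2, abs_mul, abs_mul, abs_of_pos (by positivity : (0 : ℝ) < 2 * Real.pi)]
      calc 2 * Real.pi * |(a : ℝ) - κ| * |(((N * b / p : ℕ) : ℝ) + 1 / 2) / N - b / p|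
          ≤ 2 * Real.pi * |(a : ℝ) - κ| * (1 / (2 * N)) := by gcongr
        _ = Real.pi * |(a : ℝ) - κ| / N := by field_simp
    -- This keeps the angle within ±π/2, where the cosine lies above its chord.
    have h4 : |(a : ℝ) - κ| ≤ N / 2 := by
      have ha' : ((a + 1 : ℕ) : ℝ) ≤ p := by exact_mod_cast Finset.mem_range.1 ha
      have hk1 : ((2 * (p / 2) : ℕ) : ℝ) ≤ p := by exact_mod_cast Nat.mul_div_le p 2
      have hk2 : (p : ℝ) ≤ ((2 * (p / 2) + 1 : ℕ) : ℝ) := by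
        exact_mod_cast (by omega : p ≤ 2 * (p / 2) + 1)
      push_cast at ha' hk1 hk2
      rw [abs_le]
      have : (0 : ℝ) ≤ a := Nat.cast_nonneg a
      simp only [hκ]
      constructor <;> linarith
    have h5 : |t| ≤ Real.pi / 2 := by
      refine h3.trans ?_
      rw [div_le_div_iff₀ hN' (by norm_num)]
      nlinarith [Real.pi_pos]
    refine le_trans ?_ (one_sub_le_cos h5)
    have : 2 / Real.pi * |t| ≤ 2 / Real.pi * (Real.pi * |(a : ℝ) - κ| / N) := by gcongr
    have h6 : 2 / Real.pi * (Real.pi * |(a : ℝ) - κ| / N) = 2 * |(a : ℝ) - κ| / N := by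
      field_simp
    linarith
  calc (p : ℝ) ^ 2 * (1 - p / (2 * N)) = p ^ 2 - p * (2 * (p ^ 2 / 4) / N) := by
        field_simp
        ring
    _ ≤ p ^ 2 - p * (2 * (∑ a ∈ Finset.range p, |(a : ℝ) - κ|) / N) := by
        gcongr
        exact sum_abs_sub_half_le p
    _ = ∑ a ∈ Finset.range p, ∑ b ∈ Finset.range p, (1 - 2 * |(a : ℝ) - κ| / N) := by
        simp only [Finset.sum_const, Finset.card_range, nsmul_eq_mul]
        rw [← Finset.mul_sum, Finset.sum_sub_distrib, ← Finset.sum_div, ← Finset.mul_sum]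
        simp
        ring
    _ ≤ _ := by
        refine Finset.sum_le_sum fun a ha => ?_
        rw [Finset.sum_mul, Complex.re_sum]
        refine Finset.sum_le_sum fun b _ => ?_
        rw [← phase_add, hre]
        exact hcos a ha b

/-- The prefactor combines the normalisations 1/p of the two superpositions of shifts, 1/√N of the
transform modulo N, and √p to offset that of F. With ρ = p/N in [1/2, 1] the norm is at least √ρ(1 -
ρ/2), which equals 1/2 at ρ = 1. -/
theorem half_le_norm_block {p N : ℕ} (hp : 0 < p) (hpN : p ≤ N) (hN : N ≤ 2 * p) {S : ℂ}
    (hS : (p : ℝ) ^ 2 * (1 - p / (2 * N)) ≤ ‖S‖) :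
    1 / 2 ≤ ‖(((p : ℝ)⁻¹ * (p : ℝ)⁻¹ * (Real.sqrt N)⁻¹ * Real.sqrt p : ℝ) : ℂ) * S‖ := by
  have hp' : (0 : ℝ) < p := by exact_mod_cast hp
  have hN' : (0 : ℝ) < N := by exact_mod_cast hp.trans_le hpN
  have hpN' : (p : ℝ) ≤ N := by exact_mod_cast hpN
  have hNp' : (N : ℝ) ≤ 2 * p := by exact_mod_cast hN
  rw [norm_mul, Complex.norm_real, Real.norm_eq_abs, abs_of_pos (by positivity)]
  set ρ : ℝ := p / N with hρ
  have hρ1 : ρ ≤ 1 := by rwa [hρ, div_le_one hN']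
  have hρ2 : 1 / 2 ≤ ρ := by
    rw [hρ, div_le_div_iff₀ (by norm_num) hN']
    linarith
  have h1 : (p : ℝ) / (2 * N) = ρ / 2 := by
    rw [hρ]
    field_simp
  rw [h1] at hS
  have h2 : 1 / 2 ≤ Real.sqrt ρ * (1 - ρ / 2) := by
    rw [← div_le_iff₀ (by linarith)]
    refine Real.le_sqrt_of_sq_le ?_
    rw [div_pow, div_le_iff₀ (by nlinarith)]
    -- The claim is ρ(2 - ρ)² ≥ 1, and ρ(2 - ρ)² - 1 = (1 - ρ)(3ρ - ρ² - 1).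
    nlinarith [mul_nonneg (sub_nonneg.2 hρ1) (show (0 : ℝ) ≤ 3 * ρ - ρ ^ 2 - 1 by nlinarith)]
  calc (1 / 2 : ℝ) ≤ Real.sqrt ρ * (1 - ρ / 2) := h2
    _ = (p : ℝ)⁻¹ * (p : ℝ)⁻¹ * (Real.sqrt N)⁻¹ * Real.sqrt p * (p ^ 2 * (1 - ρ / 2)) := by
        rw [hρ, Real.sqrt_div hp'.le]
        field_simp
    _ ≤ _ := by gcongr

end Rounding

/-! ### Registers of several words -/

section Registers

variable {D ι α : Type} [Fintype D] [DecidableEq D] [Fintype α] {n : ℕ}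

/-- A linear function of the bits. -/
def IsLinear (L : (D → Bool) → ℝ) : Prop := ∃ l : D → ℝ, ∀ s, L s = ∑ d, l d * (s d).toNat

theorem IsLinear.add {L M : (D → Bool) → ℝ} (hL : IsLinear L) (hM : IsLinear M) :
    IsLinear fun s => L s + M s := by
  obtain ⟨l, hl⟩ := hL
  obtain ⟨m, hm⟩ := hM
  exact ⟨fun d => l d + m d, fun s => by simp only [hl, hm, add_mul, Finset.sum_add_distrib]⟩

theorem IsLinear.smul {L : (D → Bool) → ℝ} (hL : IsLinear L) (c : ℝ) :
    IsLinear fun s => c * L s := by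
  obtain ⟨l, hl⟩ := hL
  exact ⟨fun d => c * l d, fun s => by simp only [hl, Finset.mul_sum, mul_assoc]⟩

theorem IsLinear.coord (d : D) : IsLinear fun s : D → Bool => ((s d).toNat : ℝ) :=
  ⟨fun e => if e = d then 1 else 0, fun s => by simp⟩

theorem IsLinear.zero : IsLinear fun _ : D → Bool => 0 := ⟨fun _ => 0, fun s => by simp⟩

theorem IsLinear.sum {ι : Type} (S : Finset ι) {L : ι → (D → Bool) → ℝ}
    (hL : ∀ i, IsLinear (L i)) : IsLinear fun s => ∑ i ∈ S, L i s := by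
  classical
  induction S using Finset.induction_on with
  | empty => simpa using IsLinear.zero
  | insert a S ha ih => simpa only [Finset.sum_insert ha] using (hL a).add ih

theorem IsLinear.ofBits (j : Fin n → D) :
    IsLinear fun s : D → Bool => (Nat.ofBits (s ∘ j) : ℝ) := by
  simp only [ofBits_eq_sum]
  push_cast
  exact .sum _ fun i => (IsLinear.coord (j i)).smul _

/-- The exponent is a quadratic form in the bits; the linear part goes on its diagonal because bits
are idempotent. -/
theorem diagCircuit_bilinear {L L' M : (D → Bool) → ℝ} (hL : IsLinear L) (hL' : IsLinear L')
    (hM : IsLinear M) :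
    DiagCircuit (5 * Fintype.card D ^ 2) fun s : D → Bool => phase (L s * L' s + M s) := by
  obtain ⟨l, hl⟩ := hL
  obtain ⟨l', hl'⟩ := hL'
  obtain ⟨m, hm⟩ := hM
  refine (diagCircuit_quadratic fun i j => l i * l' j + if i = j then m i else 0).congr
    fun s => ?_
  congr 1
  rw [hl, hl', hm, Finset.sum_mul_sum, ← Finset.sum_add_distrib]
  refine Finset.sum_congr rfl fun i _ => ?_
  simp only [add_mul, ite_mul, zero_mul, Finset.sum_add_distrib, Finset.sum_ite_eq,
    Finset.mem_univ, if_true]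
  congr 1
  · exact Finset.sum_congr rfl fun j _ => by ring
  · cases s i <;> simp

/-- Qubits that stay in the state `0` are ancillas. -/
theorem Prepares.hide {Q E : Type} [Fintype Q] [DecidableEq Q] [Fintype E] [DecidableEq E]
    {k l : ℕ} (σ : D ⊕ E ≃ Q) {enc : ι → Q → Bool} {c : ι → α → ℂ} {out : ι → α → Q → Bool}
    (h : Prepares k enc c out) {enc' : ι → D → Bool} {out' : ι → α → D → Bool}
    (henc : ∀ i, enc i ∘ σ = pad E (enc' i)) (hout : ∀ i a, out i a ∘ σ = pad E (out' i a))
    (hE : Fintype.card E ≤ l) : Prepares (k + l) enc' c out' := by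
  obtain ⟨A, _, _, M, hA, hM, h⟩ := h
  let j : Q ⊕ A → D ⊕ (E ⊕ A) := fun x => Equiv.sumAssoc D E A (Sum.map σ.symm id x)
  have hj : j.Injective := (Equiv.sumAssoc D E A).injective.comp
    (Sum.map_injective.2 ⟨σ.symm.injective, Function.injective_id⟩)
  refine ⟨E ⊕ A, inferInstance, inferInstance, _, ?_, (hM.lift hj).mono (by omega), fun i => ?_⟩
  · rw [Fintype.card_sum]
    omega
  have hcomp : pad (E ⊕ A) (enc' i) ∘ j = pad A (enc i) := by
    ext (q | a)
    · obtain ⟨x, rfl⟩ := σ.surjective q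
      refine Eq.trans ?_ (congrFun (henc i) x).symm
      rcases x with d | e <;> simp [j]
    · rfl
  rw [liftMat_mulVec_of hj _ (S := Finset.univ) (c := c i) (w := fun a => pad A (out i a))]
  · refine Finset.sum_congr rfl fun a _ => ?_
    congr 2
    ext (d | (e | x))
    · refine Eq.trans ?_ ((hj.extend_apply (pad A (out i a)) (pad (E ⊕ A) (enc' i))
        (Sum.inl (σ (Sum.inl d)))).trans
        (congrFun (hout i a) (Sum.inl d)))
      simp [j]
    · refine Eq.trans ?_ ((hj.extend_apply (pad A (out i a)) (pad (E ⊕ A) (enc' i))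
        (Sum.inl (σ (Sum.inr e)))).trans
        (congrFun (hout i a) (Sum.inr e)))
      simp [j]
    · exact hj.extend_apply (pad A (out i a)) _ (Sum.inr x)
  · rw [hcomp, h]

/-- The state of three words. -/
def word3 (u v w : Fin n → Bool) : Fin 3 × Fin n → Bool := fun ci => ![u, v, w] ci.1 ci.2

theorem word3_eta (s : Fin 3 × Fin n → Bool) :
    word3 (fun i => s (0, i)) (fun i => s (1, i)) (fun i => s (2, i)) = s := by
  ext ⟨c, i⟩
  fin_cases c <;> rfl

theorem word3_inj {u v w u' v' w' : Fin n → Bool} :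
    word3 u v w = word3 u' v' w' ↔ u = u' ∧ v = v' ∧ w = w' := by
  constructor
  · intro h
    exact ⟨funext fun i => congrFun h (0, i), funext fun i => congrFun h (1, i),
      funext fun i => congrFun h (2, i)⟩
  · rintro ⟨rfl, rfl, rfl⟩
    rfl

theorem injective_pair (c : Fin 3) : (fun i : Fin n => (c, i)).Injective :=
  fun _ _ h => (Prod.ext_iff.1 h).2

theorem extend_word3 (c : Fin 3) (t u v w : Fin n → Bool) :
    Function.extend (fun i : Fin n => (c, i)) t (word3 u v w) =
      word3 (if c = 0 then t else u) (if c = 1 then t else v) (if c = 2 then t else w) := by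
  ext ⟨d, i⟩
  by_cases hd : d = c
  · subst hd
    refine ((injective_pair d).extend_apply _ _ i).trans ?_
    fin_cases d <;> rfl
  · rw [Function.extend_apply' _ _ _ (by rintro ⟨i', hi'⟩; exact hd (Prod.ext_iff.1 hi').1.symm)]
    fin_cases c <;> fin_cases d <;> first | rfl | exact absurd rfl hd

/-- The bits of a word. -/
def wordBits {β : Type} (f : β → Fin n → Bool) : Set (β → Bool) := {w | ∃ i, w = fun s => f s i}

theorem Reach.wordBits_bits {β : Type} {W : Set (β → Bool)} {k : ℕ} {f : β → ℕ}
    (h : Gets W k n f) : Reach W k (wordBits fun s => bits n (f s)) :=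
  h.anti (by rintro w ⟨i, rfl⟩; exact ⟨i, i.2, rfl⟩)

theorem Reach.wordBits_revBits {β : Type} {W : Set (β → Bool)} {k : ℕ} {f : β → ℕ}
    (h : Gets W k n f) : Reach W k (wordBits fun s => revBits n (f s)) :=
  h.anti (by rintro w ⟨i, rfl⟩; exact ⟨i.rev, i.rev.2, rfl⟩)

theorem Reach.wordBits_input (j : Fin n → D) :
    Reach (inputBits D) 0 (wordBits fun s : D → Bool => fun i => s (j i)) :=
  .done (by rintro w ⟨i, rfl⟩; exact ⟨j i, rfl⟩)

theorem Reach.word3 {β : Type} {W : Set (β → Bool)} {k l m : ℕ} {f g h : β → Fin n → Bool}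
    (hf : Reach W k (wordBits f)) (hg : Reach W l (wordBits g)) (hh : Reach W m (wordBits h)) :
    Reach W (k + l + m) {w | ∃ e, w = fun s => word3 (f s) (g s) (h s) e} := by
  refine ((hf.union hg).union hh).anti ?_
  rintro w ⟨⟨c, i⟩, rfl⟩
  fin_cases c
  · exact Or.inl (Or.inl ⟨i, rfl⟩)
  · exact Or.inl (Or.inr ⟨i, rfl⟩)
  · exact Or.inr ⟨i, rfl⟩

end Registers

/-! ### The Fourier transform modulo a prime -/

section PrimeFourier

variable {n p : ℕ}

theorem extend_word3_zero (t u v w : Fin n → Bool) :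
    Function.extend (fun i : Fin n => ((0 : Fin 3), i)) t (word3 u v w) = word3 t v w :=
  extend_word3 0 t u v w

theorem extend_word3_one (t u v w : Fin n → Bool) :
    Function.extend (fun i : Fin n => ((1 : Fin 3), i)) t (word3 u v w) = word3 u t w :=
  extend_word3 1 t u v w

theorem extend_word3_two (t u v w : Fin n → Bool) :
    Function.extend (fun i : Fin n => ((2 : Fin 3), i)) t (word3 u v w) = word3 u v t :=
  extend_word3 2 t u v w

/-- A number, replaced by `0` if it is not a residue. -/
def clampVal (p a : ℕ) : ℕ := if a < p then a else 0

/-- Programs run on all bit strings, while the modular routines require residues for every input;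
clamping provides them and changes nothing on encoded states. -/
theorem clampVal_lt (hp : 0 < p) (a : ℕ) : clampVal p a < p := by
  unfold clampVal
  split_ifs <;> assumption

theorem clampVal_of_lt {a : ℕ} (h : a < p) : clampVal p a = a := if_pos h

theorem two_mul_le_two_pow (hp : p < 2 ^ n) : 2 * p ≤ 2 ^ (2 * n + 2) := by
  have : 2 ^ (2 * n + 2) = 2 ^ n * 2 ^ n * 4 := by ring
  nlinarith [Nat.one_le_two_pow (n := n)]

theorem Gets.word {D : Type} (j : Fin n → D) :
    Gets (inputBits D) 1 (2 * n + 2) fun s : D → Bool => Nat.ofBits (s ∘ j) :=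
  (Gets.input j).widen fun _ => Nat.ofBits_lt_two_pow _

theorem ofBits_lt_wide (u : Fin n → Bool) : Nat.ofBits u < 2 ^ (2 * n + 2) :=
  (Nat.ofBits_lt_two_pow u).trans_le (Nat.pow_le_pow_right (by norm_num) (by omega))

theorem Gets.clampWord {D : Type} (hp0 : 0 < p) (hp : p < 2 ^ n) (j : Fin n → D) :
    Gets (inputBits D) (20 * n + 26) (2 * n + 2)
      fun s : D → Bool => clampVal p (Nat.ofBits (s ∘ j)) :=
  ((Gets.word j).clamp hp0 (two_mul_le_two_pow hp) fun _ => ofBits_lt_wide _).more (by omega)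

/-- A multiple of a residue. -/
theorem Gets.constMul {α : Type} {W : Set (α → Bool)} {k c : ℕ} {f : α → ℕ} (hp0 : 0 < p)
    (hp : p < 2 ^ n) (hc : c < p) (hf : Gets W k (2 * n + 2) f) (hfp : ∀ a, f a < p) :
    Gets W (k + (204 * n ^ 2 + 440 * n + 240)) (2 * n + 2) fun a => c * f a % p := by
  refine ((Gets.const _ c).mulMod hp0 (two_mul_le_two_pow hp) (fun _ => ?_) hf hfp).more ?_
  · have := two_mul_le_two_pow hp
    omega
  · ring_nf
    omega

/-- The number `⌊2 ^ n b / p⌋` for `b = h (x + r) mod p`. -/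
def roundMul (n p h x r : ℕ) : ℕ := 2 ^ n * (h * ((clampVal p x + clampVal p r) % p) % p) / p

/-- The residue `x` with `z = ⌊2 ^ n b / p⌋`, `b = (x + r) / h' mod p`. -/
def unroundMul (n p h' z r : ℕ) : ℕ :=
  (h' * clampVal p ((z * p + (2 ^ n - 1)) / 2 ^ n) % p + (p - 1) * clampVal p r % p) % p

theorem cast_sub_one_mul (hp0 : 0 < p) (a : ℕ) : (((p - 1) * a : ℕ) : ZMod p) = -a := by
  rw [Nat.cast_mul, Nat.cast_sub (by omega)]
  simp

theorem roundMul_lt (hp0 : 0 < p) (h x r : ℕ) : roundMul n p h x r < 2 ^ n := by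
  rw [roundMul, Nat.div_lt_iff_lt_mul hp0]
  exact Nat.mul_lt_mul_of_pos_left (Nat.mod_lt _ hp0) (by positivity)

/-- With remainder r < p < 2^n, the number ⌊2^n b / p⌋ p = 2^n b - r lies above 2^n (b - 1). So
rounding loses no information about b. -/
theorem ceil_mul_div {b : ℕ} (hp : p < 2 ^ n) (hb : b < p) :
    (2 ^ n * b / p * p + (2 ^ n - 1)) / 2 ^ n = b := by
  have h1 := Nat.div_add_mod (2 ^ n * b) p
  have h2 := Nat.mod_lt (2 ^ n * b) (by omega : 0 < p)
  have h3 : 2 ^ n * b / p * p = p * (2 ^ n * b / p) := mul_comm _ _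
  refine Nat.div_eq_of_lt_le ?_ ?_
  · rw [h3, mul_comm b]
    omega
  · rw [h3, add_mul, one_mul, mul_comm b]
    omega

theorem unroundMul_roundMul [NeZero p] (hp : p < 2 ^ n) {h h' : ℕ}
    (hh : (h' : ZMod p) * h = 1) (x r : ZMod p) :
    unroundMul n p h' (roundMul n p h x.val r.val) r.val = x.val := by
  have hp0 : 0 < p := NeZero.pos p
  rw [unroundMul, roundMul, ceil_mul_div hp (Nat.mod_lt _ hp0), clampVal_of_lt (Nat.mod_lt _ hp0),
    clampVal_of_lt (ZMod.val_lt x), clampVal_of_lt (ZMod.val_lt r), ← ZMod.val_natCast]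
  congr 1
  simp only [Nat.cast_add, ZMod.natCast_mod, cast_sub_one_mul hp0, Nat.cast_mul,
    ZMod.natCast_zmod_val]
  rw [← mul_assoc, hh]
  ring

/-- The number `a + t mod p`, if `a` is a residue. -/
def shiftVal (p a t : ℕ) : ℕ := if a < p then (clampVal p a + clampVal p t) % p else a

/-- The number `y - t mod p`, if `y` is a residue. -/
def unshiftVal (p y t : ℕ) : ℕ :=
  if y < p then (clampVal p y + (p - 1) * clampVal p t % p) % p else y

/-- The shift permutes residues and fixes all other words. It is therefore reversible on every
output of the transform modulo 2^n, and a non-residue never meets an encoded y. -/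
theorem shiftVal_lt_iff (hp0 : 0 < p) (a t : ℕ) : shiftVal p a t < p ↔ a < p := by
  unfold shiftVal
  split_ifs with h
  · simp [h, Nat.mod_lt _ hp0]
  · rfl

theorem shiftVal_eq_val [NeZero p] {a : ℕ} {t : ZMod p} (ha : a < p) :
    shiftVal p a t.val = ((a : ZMod p) + t).val := by
  rw [shiftVal, if_pos ha, clampVal_of_lt ha, clampVal_of_lt (ZMod.val_lt t), ← ZMod.val_natCast]
  congr 1
  simp

theorem unshiftVal_shiftVal [NeZero p] (a : ℕ) (t : ZMod p) :
    unshiftVal p (shiftVal p a t.val) t.val = a := by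
  have hp0 : 0 < p := NeZero.pos p
  by_cases ha : a < p
  · have hs : shiftVal p a t.val < p := (shiftVal_lt_iff hp0 _ _).2 ha
    rw [unshiftVal, if_pos hs, clampVal_of_lt hs, clampVal_of_lt (ZMod.val_lt t),
      shiftVal_eq_val ha, ← ZMod.val_natCast]
    have : ((((a : ZMod p) + t).val + (p - 1) * t.val % p : ℕ) : ZMod p) = a := by
      simp only [Nat.cast_add, ZMod.natCast_mod, cast_sub_one_mul hp0, ZMod.natCast_zmod_val]
      ring
    rw [this, ZMod.val_natCast, Nat.mod_eq_of_lt ha]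
  · rw [unshiftVal, if_neg ((shiftVal_lt_iff hp0 _ _).not.2 ha), shiftVal, if_neg ha]

theorem cubic_bounds (hn : 1 ≤ n) : 1 ≤ n ^ 3 ∧ n ≤ n ^ 3 ∧ n ^ 2 ≤ n ^ 3 :=
  ⟨Nat.one_le_pow _ _ hn, Nat.le_self_pow (by norm_num) n, Nat.pow_le_pow_right hn (by norm_num)⟩

section Gets

variable {D : Type} (hn : 1 ≤ n) (hp0 : 0 < p) (hp : p < 2 ^ n)
include hn hp0 hp

theorem Gets.roundMul {h : ℕ} (hh : h < p) (j j' : Fin n → D) :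
    Gets (inputBits D) (2000 * n ^ 3) n fun s : D → Bool =>
      roundMul n p h (Nat.ofBits (s ∘ j)) (Nat.ofBits (s ∘ j')) := by
  have h2 := two_mul_le_two_pow hp
  have h3 := (Gets.clampWord hp0 hp j).addMod hp0 h2 (fun _ => clampVal_lt hp0 _)
    (Gets.clampWord hp0 hp j') fun _ => clampVal_lt hp0 _
  have h4 := (Gets.constMul hp0 hp hh h3 fun _ => Nat.mod_lt _ hp0).divPrime hp0 h2
    (by omega : n ≤ 2 * n + 2) fun _ => Nat.mod_lt _ hp0
  refine h4.more ?_
  have := cubic_bounds hn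
  ring_nf at this ⊢
  omega

theorem Gets.unroundMul {h' : ℕ} (hh : h' < p) (j j' : Fin n → D) :
    Gets (inputBits D) (4000 * n ^ 3) n fun s : D → Bool =>
      unroundMul n p h' (Nat.ofBits (s ∘ j)) (Nat.ofBits (s ∘ j')) := by
  have h2 := two_mul_le_two_pow hp
  have h3 := (Gets.word j).ceilDiv hp (by omega : 2 * n + 1 ≤ 2 * n + 2)
    fun s => Nat.ofBits_lt_two_pow _
  have hlt : ∀ z < 2 ^ n, (z * p + (2 ^ n - 1)) / 2 ^ n < 2 ^ (2 * n + 2 - n) := by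
    intro z hz
    rw [Nat.div_lt_iff_lt_mul (by positivity), show 2 * n + 2 - n = n + 2 by omega, pow_add]
    have : z * p ≤ 2 ^ n * 2 ^ n := Nat.mul_le_mul hz.le hp.le
    have h5 : 2 ^ n ≤ 2 ^ n * 2 ^ n := Nat.le_mul_self _
    have h6 : 2 ^ n * 2 ^ 2 * 2 ^ n = 4 * (2 ^ n * 2 ^ n) := by ring
    omega
  have h4 := (h3.widen (v := 2 * n + 2) fun s => hlt _ (Nat.ofBits_lt_two_pow _)).clamp hp0 h2
    fun s => (hlt _ (Nat.ofBits_lt_two_pow _)).trans_le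
      (Nat.pow_le_pow_right (by norm_num) (by omega))
  have h5 := Gets.constMul hp0 hp hh h4 fun _ => clampVal_lt hp0 _
  have h6 := Gets.constMul hp0 hp (by omega : p - 1 < p) (Gets.clampWord hp0 hp j')
    fun _ => clampVal_lt hp0 _
  refine ((h5.addMod hp0 h2 (fun _ => Nat.mod_lt _ hp0) h6 fun _ => Nat.mod_lt _ hp0).le
    (by omega)).more ?_
  have := cubic_bounds hn
  ring_nf at this ⊢
  omega

theorem Gets.shiftVal (j j' : Fin n → D) :
    Gets (inputBits D) (1000 * n ^ 3) n fun s : D → Bool =>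
      shiftVal p (Nat.ofBits (s ∘ j)) (Nat.ofBits (s ∘ j')) := by
  have h2 := two_mul_le_two_pow hp
  have h3 := (Gets.clampWord hp0 hp j).addMod hp0 h2 (fun _ => clampVal_lt hp0 _)
    (Gets.clampWord hp0 hp j') fun _ => clampVal_lt hp0 _
  have h4 := Gets.mux ((Gets.word j).lt_const (fun _ => ofBits_lt_wide _) hp0 (by omega)) h3
    (Gets.word j)
  refine ((h4.le (by omega : n ≤ 2 * n + 2)).more ?_).congr fun s => ?_
  · have := cubic_bounds hn
    ring_nf at this ⊢
    omega
  · simp only [decide_eq_true_eq]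
    rfl

theorem Gets.unshiftVal (j j' : Fin n → D) :
    Gets (inputBits D) (3000 * n ^ 3) n fun s : D → Bool =>
      unshiftVal p (Nat.ofBits (s ∘ j)) (Nat.ofBits (s ∘ j')) := by
  have h2 := two_mul_le_two_pow hp
  have h3 := (Gets.clampWord hp0 hp j).addMod hp0 h2 (fun _ => clampVal_lt hp0 _)
    (Gets.constMul hp0 hp (by omega : p - 1 < p) (Gets.clampWord hp0 hp j')
      fun _ => clampVal_lt hp0 _) fun _ => Nat.mod_lt _ hp0
  have h4 := Gets.mux ((Gets.word j).lt_const (fun _ => ofBits_lt_wide _) hp0 (by omega)) h3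
    (Gets.word j)
  refine ((h4.le (by omega : n ≤ 2 * n + 2)).more ?_).congr fun s => ?_
  · have := cubic_bounds hn
    ring_nf at this ⊢
    omega
  · simp only [decide_eq_true_eq]
    rfl

end Gets

variable [NeZero p]

/-- The state of three words of which only the first is not `0`. -/
def word1 (u : Fin n → Bool) : Fin 3 × Fin n → Bool :=
  word3 u (fun _ => false) fun _ => false

/-- This is both the start of `prepares_approx` and the reference family with which its inner
products are taken. -/
theorem prepares_shifts (hp : p < 2 ^ n) (hp2 : 2 ^ n ≤ 2 * p) :
    Prepares (10200 * n ^ 3) (fun x : ZMod p => word1 (zbits n x))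
      (fun _ (_ : ZMod p × ZMod p) => (((p : ℝ)⁻¹ : ℝ) : ℂ))
      fun x rt => word3 (zbits n x) (zbits n rt.1) (zbits n rt.2) := by
  have hu := prepares_uniform hp hp2
  have h1 := (Prepares.refl fun x : ZMod p => word1 (zbits n x)).branch hu (injective_pair 1)
    (fun _ _ => ()) fun _ _ => rfl
  simp only [word1, extend_word3_one] at h1
  have h2 := h1.branch hu (injective_pair 2) (fun _ _ => ()) fun _ _ => rfl
  simp only [extend_word3_two] at h2
  refine (h2.mono (by omega)).congr fun x => ?_
  rw [Fintype.sum_prod_type, Fintype.sum_prod_type, Fintype.sum_prod_type, Fintype.sum_unique]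
  refine Finset.sum_congr rfl fun r _ => Finset.sum_congr rfl fun t _ => ?_
  congr 1
  rw [one_mul, ← Complex.ofReal_mul, ← mul_inv, Real.mul_self_sqrt (Nat.cast_nonneg p)]

/-- The angle of the amplitudes of `prepares_approx`. -/
def approxAngle (n p h : ℕ) (x r t a : ℕ) : ℝ :=
  2 * Real.pi * h / p * ((t + (p / 2 : ℕ)) * (x + r)) -
    2 * Real.pi * (p / 2 : ℕ) * roundMul n p h x r / 2 ^ n +
    2 * Real.pi * ((a * roundMul n p h x r : ℕ) / 2 ^ n) + Real.pi * a / 2 ^ n -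
    2 * Real.pi * h / p * (shiftVal p a t * r)

/-- Each phase in `approxAngle` is applied while the words it involves are present: the one in t and
x + r before x is overwritten, the one in the rounded number before the transform modulo 2^n, the
one in a after it, and the one in the shifted output times r at the end. The inverse h' of h lets x
be recovered from the rounded number and r. -/
theorem prepares_approx (hn : 1 ≤ n) (hp : p < 2 ^ n) (hp2 : 2 ^ n ≤ 2 * p) {h h' : ℕ}
    (hh : (h' : ZMod p) * h = 1) (hhp : h < p) (hhp' : h' < p) :
    Prepares (620000 * n ^ 3) (fun x : ZMod p => word1 (zbits n x))
      (fun x (a : (ZMod p × ZMod p) × (Fin n → Bool)) =>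
        (((p : ℝ)⁻¹ * (Real.sqrt (2 ^ n))⁻¹ : ℝ) : ℂ) *
          phase (approxAngle n p h x.val a.1.1.val a.1.2.val (revVal a.2)))
      fun _ a => word3 (bits n (shiftVal p (revVal a.2) a.1.2.val)) (zbits n a.1.1)
        (zbits n a.1.2) := by
  have hp0 : 0 < p := NeZero.pos p
  let L (c : Fin 3) (s : Fin 3 × Fin n → Bool) : ℝ := Nat.ofBits (s ∘ fun i => (c, i))
  have hL : ∀ c, IsLinear (L c) := fun c => .ofBits _
  -- The transform leaves its output in reverse order; the digits are read accordingly instead of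
  -- being swapped.
  let Lr (s : Fin 3 × Fin n → Bool) : ℝ := Nat.ofBits (s ∘ fun i => ((0 : Fin 3), i.rev))
  have hLr : IsLinear Lr := .ofBits _
  set θ : ℝ := 2 * Real.pi * h / p with hθ
  have s1 := (prepares_shifts hp hp2).phase (diagCircuit_bilinear (((hL 2).smul θ))
    ((hL 0).add (hL 1)) (((hL 0).add (hL 1)).smul (θ * (p / 2 : ℕ))))
  have s2 := s1.inPlace
    (f := fun s => word3 (bits n (roundMul n p h (Nat.ofBits (s ∘ fun i => ((0 : Fin 3), i)))
      (Nat.ofBits (s ∘ fun i => ((1 : Fin 3), i))))) (fun i => s (1, i)) fun i => s (2, i))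
    (g := fun s => word3 (bits n (unroundMul n p h' (Nat.ofBits (s ∘ fun i => ((0 : Fin 3), i)))
      (Nat.ofBits (s ∘ fun i => ((1 : Fin 3), i))))) (fun i => s (1, i)) fun i => s (2, i))
    (.word3 (.wordBits_bits (.roundMul hn hp0 hp hhp _ _)) (.wordBits_input _) (.wordBits_input _))
    (.word3 (.wordBits_bits (.unroundMul hn hp0 hp hhp' _ _)) (.wordBits_input _)
      (.wordBits_input _)) (by
    intro x a
    change word3 (bits n (unroundMul n p h' (Nat.ofBits (bits n (roundMul n p h
      (Nat.ofBits (zbits n x)) (Nat.ofBits (zbits n a.1))))) (Nat.ofBits (zbits n a.1)))) _ _ = _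
    rw [ofBits_bits (roundMul_lt hp0 _ _ _), ofBits_zbits hp, ofBits_zbits hp,
      unroundMul_roundMul hp hh]
    rfl)
  have s3 := s2.phase (diagCircuit_bilinear .zero .zero
    ((hL 0).smul (-(2 * Real.pi * (p / 2 : ℕ) / 2 ^ n))))
  have hF : Prepares (n * (5 * n ^ 2 + 1)) (fun s : Fin n → Bool => s)
      (fun s u => fourierMat n u s) fun _ u => u := .of_impl (impl_fourierMat n) (mulVec_ket _)
  have s4 := s3.branch hF (injective_pair 0) (fun x a => bits n (roundMul n p h
      (Nat.ofBits (zbits n x)) (Nat.ofBits (zbits n a.1)))) fun _ _ => rfl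
  simp only [extend_word3_zero] at s4
  have s5 := s4.phase (diagCircuit_bilinear .zero .zero (hLr.smul (Real.pi / 2 ^ n)))
  have s6 := s5.inPlace
    (f := fun s => word3 (bits n (shiftVal p (Nat.ofBits (s ∘ fun i => ((0 : Fin 3), i.rev)))
      (Nat.ofBits (s ∘ fun i => ((2 : Fin 3), i))))) (fun i => s (1, i)) fun i => s (2, i))
    (g := fun s => word3 (revBits n (unshiftVal p (Nat.ofBits (s ∘ fun i => ((0 : Fin 3), i)))
      (Nat.ofBits (s ∘ fun i => ((2 : Fin 3), i))))) (fun i => s (1, i)) fun i => s (2, i))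
    (.word3 (.wordBits_bits (.shiftVal hn hp0 hp _ _)) (.wordBits_input _) (.wordBits_input _))
    (.word3 (.wordBits_revBits (.unshiftVal hn hp0 hp _ _)) (.wordBits_input _)
      (.wordBits_input _)) (by
    intro _ a
    change word3 (revBits n (unshiftVal p (Nat.ofBits (bits n (shiftVal p (revVal a.2)
      (Nat.ofBits (zbits n a.1.2))))) (Nat.ofBits (zbits n a.1.2)))) _ _ = _
    rw [ofBits_bits, ofBits_zbits hp, unshiftVal_shiftVal, revBits_revVal]
    · rfl
    · by_cases hr : revVal a.2 < p
      · exact ((shiftVal_lt_iff hp0 _ _).2 hr).trans hp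
      · rw [shiftVal, if_neg hr]
        exact revVal_lt _)
  have s7 := s6.phase (diagCircuit_bilinear ((hL 0).smul (-θ)) (hL 1) .zero)
  refine (s7.mono ?_).congr fun x => Finset.sum_congr rfl ?_
  · simp only [Fintype.card_prod, Fintype.card_fin]
    have := cubic_bounds hn
    ring_nf at this ⊢
    omega
  rintro ⟨⟨r, t⟩, u⟩ -
  have hs : shiftVal p (revVal u) t.val < 2 ^ n := by
    by_cases hr : revVal u < p
    · exact ((shiftVal_lt_iff hp0 _ _).2 hr).trans hp
    · rw [shiftVal, if_neg hr]
      exact revVal_lt _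
  have e1 : ∀ u v w : Fin n → Bool, L 0 (word3 u v w) = Nat.ofBits u := fun _ _ _ => rfl
  have e2 : ∀ u v w : Fin n → Bool, L 1 (word3 u v w) = Nat.ofBits v := fun _ _ _ => rfl
  have e3 : ∀ u v w : Fin n → Bool, L 2 (word3 u v w) = Nat.ofBits w := fun _ _ _ => rfl
  have e4 : ∀ u v w : Fin n → Bool, Lr (word3 u v w) = revVal u := fun _ _ _ => rfl
  have e5 : ∀ u v w : Fin n → Bool, word3 u v w ∘ (fun i => ((0 : Fin 3), i)) = u :=
    fun _ _ _ => rfl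
  have e6 : ∀ u v w : Fin n → Bool, word3 u v w ∘ (fun i => ((1 : Fin 3), i)) = v :=
    fun _ _ _ => rfl
  have e7 : ∀ u v w : Fin n → Bool, word3 u v w ∘ (fun i => ((2 : Fin 3), i)) = w :=
    fun _ _ _ => rfl
  have e8 : ∀ u v w : Fin n → Bool, Nat.ofBits (word3 u v w ∘ fun i => ((0 : Fin 3), i.rev)) =
    revVal u := fun _ _ _ => rfl
  have e9 : ∀ u v w : Fin n → Bool, (fun i => word3 u v w (1, i)) = v := fun _ _ _ => rfl
  have e10 : ∀ u v w : Fin n → Bool, (fun i => word3 u v w (2, i)) = w := fun _ _ _ => rfl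
  simp only [e1, e2, e3, e4, e5, e6, e7, e8, e9, e10, ofBits_zbits hp, ofBits_bits hs, fourierMat,
    ofBits_bits (roundMul_lt hp0 _ _ _)]
  have key : ∀ (a b : ℂ) (A B C A' B' : ℝ), a * phase A * phase B * (b * phase C) * phase A' *
      phase B' = a * b * phase (A + B + C + A' + B') := by
    intro a b A B C A' B'
    simp only [phase_add]
    ring
  rw [key, Complex.ofReal_mul]
  congr 3
  rw [approxAngle, hθ]
  push_cast
  ring

end PrimeFourier

/-! ### The exact Fourier transform modulo p by amplification -/

section ExactFourier

variable {n p : ℕ}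

theorem phase_two_pi_mul_int_div [NeZero p] {k : ℤ} (hk : (k : ZMod p) = 0) :
    phase (2 * Real.pi * (k / p)) = 1 := by
  have hp : (p : ℝ) ≠ 0 := Nat.cast_ne_zero.2 (NeZero.ne p)
  obtain ⟨m, rfl⟩ := (ZMod.intCast_zmod_eq_zero_iff_dvd k p).1 hk
  rw [phase]
  push_cast
  rw [mul_div_cancel_left₀ _ (by exact_mod_cast hp), Complex.exp_eq_one_iff]
  exact ⟨m, by ring⟩

/-- Put κ = ⌊p/2⌋ and a = y - t. Modulo p one has (t + κ)(x + r) - yr = xy - (a - κ)(x + r), and h(x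
+ r) is b. So the correction phases yield ω^(xy) and the exact phase -(a - κ)b/p, against which the
rounded one is compared. -/
theorem approxAngle_eq [NeZero p] {e : AddChar (ZMod p) ℂ} {h : ℕ}
    (he : ∀ k : ℕ, e k = phase (2 * Real.pi * h / p * k)) (x y r t : ZMod p) :
    phase (approxAngle n p h x.val r.val t.val (y - t).val) =
      e (x * y) * phase (2 * Real.pi * (((y - t).val - (p / 2 : ℕ)) *
        ((2 ^ n * ((h : ZMod p) * (x + r)).val / p : ℕ) : ℝ) / (2 ^ n : ℕ) +
        (y - t).val / (2 * (2 ^ n : ℕ)) -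
        ((y - t).val - (p / 2 : ℕ)) * ((h : ZMod p) * (x + r)).val / p)) := by
  have hp0 : 0 < p := NeZero.pos p
  have hp' : (p : ℝ) ≠ 0 := Nat.cast_ne_zero.2 (NeZero.ne p)
  have h1 : roundMul n p h x.val r.val = 2 ^ n * ((h : ZMod p) * (x + r)).val / p := by
    rw [roundMul, clampVal_of_lt (ZMod.val_lt x), clampVal_of_lt (ZMod.val_lt r),
      ← ZMod.val_natCast]
    simp
  have h2 : shiftVal p (y - t).val t.val = y.val := by
    rw [shiftVal_eq_val (ZMod.val_lt _)]
    simp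
  have h3 : e (x * y) = phase (2 * Real.pi * h / p * (x.val * y.val : ℕ)) := by
    rw [← he]
    simp
  -- The two angles differ by 2π/p times this integer, which vanishes modulo p.
  rw [approxAngle, h1, h2, h3, ← phase_add, ← mul_one (phase (_ + _)),
    ← phase_two_pi_mul_int_div (p := p) (k := h * ((t.val + (p / 2 : ℕ)) * (x.val + r.val) -
      y.val * r.val - x.val * y.val) + ((y - t).val - (p / 2 : ℕ)) *
        ((h : ZMod p) * (x + r)).val), ← phase_add]
  · congr 1
    generalize p / 2 = q
    push_cast
    field_simp
    ring
  · generalize p / 2 = q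
    push_cast
    simp only [ZMod.natCast_zmod_val]
    ring

theorem sum_zmod_val [NeZero p] {M : Type} [AddCommMonoid M] (f : ℕ → M) :
    ∑ a : ZMod p, f a.val = ∑ a ∈ Finset.range p, f a := by
  refine Finset.sum_nbij' ZMod.val (fun a => (a : ZMod p)) ?_ ?_ ?_ ?_ ?_
  · exact fun a _ => Finset.mem_range.2 (ZMod.val_lt a)
  · exact fun a _ => Finset.mem_univ _
  · exact fun a _ => ZMod.natCast_zmod_val a
  · exact fun a ha => by rw [ZMod.val_natCast, Nat.mod_eq_of_lt (Finset.mem_range.1 ha)]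
  · exact fun a _ => rfl

/-- (r, t) ↦ (y - t, h(x + r)) is a bijection. Hence the sum over the shifts is independent of x and
y, which makes the error a scalar. -/
theorem sum_shift_val [NeZero p] {h h' : ℕ} (hh : (h' : ZMod p) * h = 1) (x y : ZMod p)
    (f : ℕ → ℕ → ℂ) : ∑ r : ZMod p, ∑ t : ZMod p, f (y - t).val ((h : ZMod p) * (x + r)).val =
      ∑ a ∈ Finset.range p, ∑ b ∈ Finset.range p, f a b := by
  rw [Finset.sum_comm, ← sum_zmod_val fun a => ∑ b ∈ Finset.range p, f a b,
    ← (Equiv.subLeft y).sum_comp fun a : ZMod p => ∑ b ∈ Finset.range p, f a.val b]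
  refine Finset.sum_congr rfl fun t _ => ?_
  rw [← sum_zmod_val]
  let σ : ZMod p ≃ ZMod p :=
    ⟨fun r => h * (x + r), fun b => h' * b - x, fun r => by
      change (h' : ZMod p) * (h * (x + r)) - x = r
      rw [← mul_assoc, hh]
      ring, fun b => by
      change (h : ZMod p) * (x + (h' * b - x)) = b
      rw [add_sub_cancel, ← mul_assoc, mul_comm (h : ZMod p), hh, one_mul]⟩
  exact σ.sum_comp fun b => f (y - t).val b.val

theorem word1_injective : (word1 : (Fin n → Bool) → Fin 3 × Fin n → Bool).Injective :=
  fun _ _ h => (word3_inj.1 h).1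

/-- The recognition of residues in the first word, the other words being `0`. -/
theorem exists_reach_word1 [NeZero p] (hp : p < 2 ^ n) :
    ∃ π : (Fin 3 × Fin n → Bool) → Bool, Reach (inputBits (Fin 3 × Fin n)) (9 * n + 6) {π} ∧
      ∀ s, π s = true ↔ s ∈ Set.range fun x : ZMod p => word1 (zbits n x) := by
  let w : Fin n ⊕ Fin n → Fin 3 × Fin n := Sum.elim (fun i => (1, i)) fun i => (2, i)
  refine ⟨_, ((Reach.lt_const (Gets.input fun i => ((0 : Fin 3), i))
    (fun s => Nat.ofBits_lt_two_pow _) (NeZero.pos p) hp.le).op and (Reach.forall_false w)).more ?_,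
    fun s => ?_⟩
  · rw [Fintype.card_sum, Fintype.card_fin]
    omega
  · rw [Bool.and_eq_true, decide_eq_true_eq, decide_eq_true_eq, ← mem_range_zbits hp]
    constructor
    · rintro ⟨⟨x, hx⟩, hs⟩
      refine ⟨x, ?_⟩
      rw [← word3_eta s]
      exact word3_inj.2 ⟨hx, funext fun i => (hs (Sum.inl i)).symm,
        funext fun i => (hs (Sum.inr i)).symm⟩
    · rintro ⟨x, rfl⟩
      exact ⟨⟨x, rfl⟩, by rintro (i | i) <;> rfl⟩

/-- The matrix of the Fourier transform modulo `p`. -/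
def dftMatrix [NeZero p] (e : AddChar (ZMod p) ℂ) : Matrix (ZMod p) (ZMod p) ℂ :=
  Matrix.of fun y x => (((Real.sqrt p)⁻¹ : ℝ) : ℂ) * e (x * y)

theorem dftMatrix_isometry [Fact p.Prime] {e : AddChar (ZMod p) ℂ} (he : e.IsPrimitive) :
    (dftMatrix e)ᴴ * dftMatrix e = 1 := by
  have hp : (0 : ℝ) < p := by exact_mod_cast (Fact.out : p.Prime).pos
  ext x x'
  have h1 : ∀ y : ZMod p, star (dftMatrix e y x) * dftMatrix e y x' =
      (((p : ℝ)⁻¹ : ℝ) : ℂ) * e (y * (x' - x)) := by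
    intro y
    rw [dftMatrix, Matrix.of_apply, Matrix.of_apply, star_mul', ← starRingEnd_apply,
      ← starRingEnd_apply, Complex.conj_ofReal, ← AddChar.map_neg_eq_conj, mul_mul_mul_comm,
      ← Complex.ofReal_mul, ← mul_inv, Real.mul_self_sqrt hp.le, ← AddChar.map_add_eq_mul]
    congr 2
    ring
  rw [Matrix.mul_apply]
  simp only [Matrix.conjTranspose_apply, h1]
  rw [← Finset.mul_sum, AddChar.sum_mulShift _ he, Matrix.one_apply, ZMod.card]
  by_cases hx : x = x'
  · subst hx
    simp
  · rw [if_neg hx, if_neg (sub_ne_zero.2 (Ne.symm hx))]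
    simp

theorem prepares_dft_word1 [Fact p.Prime] (hn : 1 ≤ n) (hp : p < 2 ^ n) (hp2 : 2 ^ n ≤ 2 * p)
    {e : AddChar (ZMod p) ℂ} (hprim : e.IsPrimitive) {h h' : ℕ} (hh : (h' : ZMod p) * h = 1)
    (hhp : h < p) (hhp' : h' < p) (he : ∀ k : ℕ, e k = phase (2 * Real.pi * h / p * k)) :
    Prepares (200000000 * n ^ 3) (fun x : ZMod p => word1 (zbits n x))
      (fun x y => dftMatrix e y x) fun _ y => word1 (zbits n y) := by
  have hp0 : 0 < p := NeZero.pos p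
  have hpR : (0 : ℝ) < p := by exact_mod_cast hp0
  obtain ⟨π, hπ, hπe⟩ := exists_reach_word1 (n := n) hp
  have hinj : (fun x : ZMod p => word1 (zbits n x)).Injective :=
    word1_injective.comp (zbits_injective hp)
  refine (Prepares.amplify hinj hinj (prepares_approx hn hp hp2 hh hhp hhp')
    (prepares_shifts hp hp2) (dftMatrix_isometry hprim)
    (half_le_norm_block hp0 hp.le hp2 (norm_sum_phase_ge hp0 hp.le)) ?_ hπ hπ hπe hπe).mono ?_
  · intro y x
    rw [← sum_shift_val hh x y (fun a b => phase (2 * Real.pi * ((a - (p / 2 : ℕ)) *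
      ((2 ^ n * b / p : ℕ) : ℝ) / (2 ^ n : ℕ) + a / (2 * (2 ^ n : ℕ)) -
        (a - (p / 2 : ℕ)) * b / p))), Finset.mul_sum, Finset.sum_mul, Fintype.sum_prod_type]
    refine Finset.sum_congr rfl fun r _ => ?_
    rw [Finset.mul_sum, Finset.sum_mul]
    refine Finset.sum_congr rfl fun t _ => ?_
    have hlt := ZMod.val_lt (y - t)
    have hrev : revVal (revBits n (y - t).val) = (y - t).val := revVal_revBits (hlt.trans hp)
    -- Agreement with the reference state forces the same shifts and a + t = y, hence a = y - t; an
    -- output a ≥ p is left unshifted and cannot equal y.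
    rw [Finset.sum_eq_single ((r, t), revBits n (y - t).val)]
    · rw [if_pos]
      · rw [hrev, approxAngle_eq he, ← starRingEnd_apply, Complex.conj_ofReal, dftMatrix,
          Matrix.of_apply]
        have hsq : Real.sqrt p ≠ 0 := (Real.sqrt_pos.2 hpR).ne'
        have hsqC : ((Real.sqrt p : ℝ) : ℂ) ≠ 0 := by exact_mod_cast hsq
        push_cast
        field_simp
      · refine word3_inj.2 ⟨?_, rfl, rfl⟩
        rw [hrev, shiftVal_eq_val hlt, ZMod.natCast_zmod_val, sub_add_cancel]
        rfl
    · rintro ⟨⟨r', t'⟩, u⟩ - hne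
      rw [if_neg]
      intro hw
      obtain ⟨h1, h2, h3⟩ := word3_inj.1 hw
      obtain rfl := zbits_injective hp h2
      obtain rfl := zbits_injective hp h3
      refine hne (Prod.ext rfl ?_)
      have hval : shiftVal p (revVal u) t.val = y.val := by
        refine (bits_injOn ((ZMod.val_lt y).trans hp) ?_ h1).symm
        by_cases hr : revVal u < p
        · exact ((shiftVal_lt_iff hp0 _ _).2 hr).trans hp
        · rw [shiftVal, if_neg hr]
          exact revVal_lt _
      have hr : revVal u < p := by
        rw [← shiftVal_lt_iff hp0 _ t.val, hval]
        exact ZMod.val_lt y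
      change u = revBits n (y - t).val
      rw [shiftVal_eq_val hr] at hval
      rw [← ZMod.val_injective p hval, add_sub_cancel_right, ZMod.val_natCast, Nat.mod_eq_of_lt hr,
        revBits_revVal]
    · simp
  · have := cubic_bounds hn
    omega

/-- The exact Fourier transform modulo `p` on one word. -/
theorem prepares_dft [Fact p.Prime] (hn : 1 ≤ n) (hp : p < 2 ^ n) (hp2 : 2 ^ n ≤ 2 * p) {ω : ℂ}
    (hω : IsPrimitiveRoot ω p) :
    Prepares (200000002 * n ^ 3) (fun x : ZMod p => zbits n x)
      (fun x y => dftMatrix (AddChar.zmodChar p hω.pow_eq_one) y x) fun _ y => zbits n y := by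
  have hp0 : 0 < p := NeZero.pos p
  obtain ⟨h, hhp, hcop, hexp⟩ := (Complex.isPrimitiveRoot_iff ω p (NeZero.ne p)).1 hω
  have hunit : ((h : ZMod p)⁻¹ * h) = 1 := by
    rw [mul_comm]
    exact ZMod.coe_mul_inv_eq_one h hcop
  have hh : ((((h : ZMod p)⁻¹).val : ℕ) : ZMod p) * h = 1 := by
    rw [ZMod.natCast_zmod_val, hunit]
  have he : ∀ k : ℕ, AddChar.zmodChar p hω.pow_eq_one k = phase (2 * Real.pi * h / p * k) := by
    intro k
    rw [AddChar.zmodChar_apply', ← hexp, ← Complex.exp_nat_mul, phase]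
    congr 1
    push_cast
    ring
  have h1 := prepares_dft_word1 hn hp hp2 (AddChar.zmodChar_primitive_of_primitive_root p hω) hh
    hhp (ZMod.val_lt _) he
  let σ : Fin n ⊕ (Fin 2 × Fin n) → Fin 3 × Fin n :=
    Sum.elim (fun i => (0, i)) fun x => (x.1.succ, x.2)
  have hσ : σ.Bijective := by
    constructor
    · rintro (i | ⟨c, i⟩) (i' | ⟨c', i'⟩) hii
      · exact congrArg Sum.inl (Prod.ext_iff.1 hii).2
      · exact absurd (Prod.ext_iff.1 hii).1.symm (Fin.succ_ne_zero _)
      · exact absurd (Prod.ext_iff.1 hii).1 (Fin.succ_ne_zero _)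
      · have h1 := Fin.succ_injective _ (Prod.ext_iff.1 hii).1
        have h2 : i = i' := (Prod.ext_iff.1 hii).2
        rw [show c = c' from h1, h2]
    · rintro ⟨c, i⟩
      refine Fin.cases ⟨Sum.inl i, rfl⟩ (fun c => ⟨Sum.inr (c, i), rfl⟩) c
  have hpad : ∀ u : Fin n → Bool, word1 u ∘ Equiv.ofBijective σ hσ = pad (Fin 2 × Fin n) u := by
    intro u
    ext (i | ⟨c, i⟩)
    · rfl
    · fin_cases c <;> rfl
  refine (h1.hide (l := 2 * n) (Equiv.ofBijective σ hσ) (fun x => hpad _) (fun x y => hpad _)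
    (by simp)).mono ?_
  have := cubic_bounds hn
  omega

end ExactFourier

/-! ### The Fourier transform of the Heisenberg group -/

section HeisenbergFourier

variable {n p : ℕ}

/-- The state of three words and a flag. -/
def flagged (u v w : Fin n → Bool) (b : Bool) : (Fin 3 × Fin n) ⊕ Unit → Bool :=
  Sum.elim (word3 u v w) fun _ => b

/-- The number in the word `c`. -/
def wordVal (c : Fin 3) (s : (Fin 3 × Fin n) ⊕ Unit → Bool) : ℕ :=
  Nat.ofBits (s ∘ fun i => Sum.inl (c, i))

theorem wordVal_flagged_zero (u v w : Fin n → Bool) (b : Bool) :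
    wordVal 0 (flagged u v w b) = Nat.ofBits u := rfl

theorem wordVal_flagged_one (u v w : Fin n → Bool) (b : Bool) :
    wordVal 1 (flagged u v w b) = Nat.ofBits v := rfl

theorem wordVal_flagged_two (u v w : Fin n → Bool) (b : Bool) :
    wordVal 2 (flagged u v w b) = Nat.ofBits w := rfl

theorem injective_inl_pair (c : Fin 3) :
    (fun i : Fin n => (Sum.inl (c, i) : (Fin 3 × Fin n) ⊕ Unit)).Injective :=
  Sum.inl_injective.comp (injective_pair c)

theorem extend_flagged (c : Fin 3) (t u v w : Fin n → Bool) (b : Bool) :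
    Function.extend (fun i : Fin n => (Sum.inl (c, i) : (Fin 3 × Fin n) ⊕ Unit)) t
      (flagged u v w b) =
      flagged (if c = 0 then t else u) (if c = 1 then t else v) (if c = 2 then t else w) b := by
  rw [flagged, flagged, ← extend_word3]
  ext (⟨d, i⟩ | x)
  · by_cases hd : d = c
    · subst hd
      exact ((injective_inl_pair d).extend_apply _ _ i).trans
        ((injective_pair d).extend_apply _ _ i).symm
    · refine (Function.extend_apply' _ _ _ ?_).trans
        (Function.extend_apply' t (word3 u v w) (d, i) ?_).symm
      · rintro ⟨i', hi'⟩
        exact hd (Prod.ext_iff.1 (Sum.inl_injective hi')).1.symm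
      · rintro ⟨i', hi'⟩
        exact hd (Prod.ext_iff.1 hi').1.symm
  · exact Function.extend_apply' _ _ _ (by rintro ⟨i', hi'⟩; cases hi')

theorem extend_flagged_one (t u v w : Fin n → Bool) (b : Bool) :
    Function.extend (fun i : Fin n => (Sum.inl (1, i) : (Fin 3 × Fin n) ⊕ Unit)) t
      (flagged u v w b) = flagged u t w b := extend_flagged 1 t u v w b

theorem extend_flagged_two (t u v w : Fin n → Bool) (b : Bool) :
    Function.extend (fun i : Fin n => (Sum.inl (2, i) : (Fin 3 × Fin n) ⊕ Unit)) t
      (flagged u v w b) = flagged u v t b := extend_flagged 2 t u v w b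

/-- The qubits of the first word and the flag. -/
def firstAndFlag : Fin n ⊕ Unit → (Fin 3 × Fin n) ⊕ Unit := Sum.map (fun i => (0, i)) id

theorem firstAndFlag_injective : (firstAndFlag (n := n)).Injective :=
  Sum.map_injective.2 ⟨injective_pair 0, Function.injective_id⟩

theorem extend_firstAndFlag (t u v w : Fin n → Bool) (b b' : Bool) :
    Function.extend firstAndFlag (Sum.elim t fun _ => b') (flagged u v w b) =
      flagged t v w b' := by
  ext (⟨d, i⟩ | x)
  · by_cases hd : d = 0
    · subst hd
      exact firstAndFlag_injective.extend_apply _ _ (Sum.inl i)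
    · refine (Function.extend_apply' _ _ _ ?_).trans ?_
      · rintro ⟨i' | x, hi'⟩
        · exact hd (Prod.ext_iff.1 (Sum.inl_injective hi')).1.symm
        · cases hi'
      · fin_cases d
        · exact absurd rfl hd
        · rfl
        · rfl
  · exact firstAndFlag_injective.extend_apply _ _ (Sum.inr x)

theorem Reach.flagged {β : Type} {W : Set (β → Bool)} {k l m r : ℕ} {f g h : β → Fin n → Bool}
    {b : β → Bool} (hf : Reach W k (wordBits f)) (hg : Reach W l (wordBits g))
    (hh : Reach W m (wordBits h)) (hb : Reach W r {b}) :
    Reach W (k + l + m + r) {w | ∃ e, w = fun s => flagged (f s) (g s) (h s) (b s) e} := by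
  refine ((hf.word3 hg hh).union hb).anti ?_
  rintro w ⟨e | x, rfl⟩
  · exact Or.inl ⟨e, rfl⟩
  · exact Or.inr rfl

/-- The product `k y mod p`, or `y` if `k = 0`. -/
def scaleVal (p k y : ℕ) : ℕ := if k < 1 then y else clampVal p k * clampVal p y % p

/-- The quotient `y / k mod p`, or `y` if `k = 0`. -/
def unscaleVal (p k y : ℕ) : ℕ :=
  if k < 1 then y else clampVal p k ^ (p - 2) % p * clampVal p y % p

/-- The sum of two residues. -/
def addVal (p a b : ℕ) : ℕ := (clampVal p a + clampVal p b) % p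

/-- The difference of two residues. -/
def subVal (p a b : ℕ) : ℕ := (clampVal p a + (p - 1) * clampVal p b % p) % p

section Gets

variable (hn : 1 ≤ n) (hp0 : 0 < p) (hp : p < 2 ^ n)
include hn hp0 hp

theorem Gets.scaleVal (c d : Fin 3) : Gets (inputBits ((Fin 3 × Fin n) ⊕ Unit)) (2000 * n ^ 3) n
    fun s => scaleVal p (wordVal c s) (wordVal d s) := by
  have h2 := two_mul_le_two_pow hp
  have hlt : ∀ x, clampVal p x < p := clampVal_lt hp0
  have h3 := (Gets.clampWord hp0 hp fun i => (Sum.inl (c, i) : (Fin 3 × Fin n) ⊕ Unit)).mulMod hp0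
    h2 (fun _ => (hlt _).trans_le (by omega))
    (Gets.clampWord hp0 hp fun i => (Sum.inl (d, i) : (Fin 3 × Fin n) ⊕ Unit)) fun _ => hlt _
  have h4 := Gets.mux ((Gets.word fun i => (Sum.inl (c, i) : (Fin 3 × Fin n) ⊕ Unit)).lt_const
    (fun _ => ofBits_lt_wide _) one_pos Nat.one_le_two_pow)
    (Gets.word fun i => (Sum.inl (d, i) : (Fin 3 × Fin n) ⊕ Unit)) h3
  refine ((h4.le (by omega : n ≤ 2 * n + 2)).more ?_).congr fun s => ?_
  · have := cubic_bounds hn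
    ring_nf at this ⊢
    omega
  · simp only [decide_eq_true_eq]
    rfl

theorem Gets.unscaleVal (c d : Fin 3) :
    Gets (inputBits ((Fin 3 × Fin n) ⊕ Unit)) (5000 * n ^ 3) n
      fun s => unscaleVal p (wordVal c s) (wordVal d s) := by
  have h2 := two_mul_le_two_pow hp
  have hlt : ∀ x, clampVal p x < p := clampVal_lt hp0
  have h3 := ((Gets.clampWord hp0 hp fun i => (Sum.inl (c, i) : (Fin 3 × Fin n) ⊕ Unit)).powMod
    hp0 h2 (fun _ => hlt _) (by omega : p - 2 < 2 ^ n)).mulMod hp0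
    h2 (fun _ => (Nat.mod_lt _ hp0).trans_le (by omega))
    (Gets.clampWord hp0 hp fun i => (Sum.inl (d, i) : (Fin 3 × Fin n) ⊕ Unit)) fun _ => hlt _
  have h4 := Gets.mux ((Gets.word fun i => (Sum.inl (c, i) : (Fin 3 × Fin n) ⊕ Unit)).lt_const
    (fun _ => ofBits_lt_wide _) one_pos Nat.one_le_two_pow)
    (Gets.word fun i => (Sum.inl (d, i) : (Fin 3 × Fin n) ⊕ Unit)) h3
  refine ((h4.le (by omega : n ≤ 2 * n + 2)).more ?_).congr fun s => ?_
  · have := cubic_bounds hn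
    ring_nf at this ⊢
    omega
  · simp only [decide_eq_true_eq]
    rfl

theorem Gets.addVal (c d : Fin 3) : Gets (inputBits ((Fin 3 × Fin n) ⊕ Unit)) (300 * n ^ 3)
    (2 * n + 2) fun s => addVal p (wordVal c s) (wordVal d s) := by
  have hlt : ∀ x, clampVal p x < p := clampVal_lt hp0
  refine ((Gets.clampWord hp0 hp fun i => (Sum.inl (c, i) : (Fin 3 × Fin n) ⊕ Unit)).addMod hp0
    (two_mul_le_two_pow hp) (fun _ => hlt _)
    (Gets.clampWord hp0 hp fun i => (Sum.inl (d, i) : (Fin 3 × Fin n) ⊕ Unit))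
    fun _ => hlt _).more ?_
  have := cubic_bounds hn
  ring_nf at this ⊢
  omega

theorem Gets.subVal (c d : Fin 3) : Gets (inputBits ((Fin 3 × Fin n) ⊕ Unit)) (1500 * n ^ 3)
    (2 * n + 2) fun s => subVal p (wordVal c s) (wordVal d s) := by
  have hlt : ∀ x, clampVal p x < p := clampVal_lt hp0
  refine ((Gets.clampWord hp0 hp fun i => (Sum.inl (c, i) : (Fin 3 × Fin n) ⊕ Unit)).addMod hp0
    (two_mul_le_two_pow hp) (fun _ => hlt _) (Gets.constMul hp0 hp (by omega : p - 1 < p)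
      (Gets.clampWord hp0 hp fun i => (Sum.inl (d, i) : (Fin 3 × Fin n) ⊕ Unit)) fun _ => hlt _)
    fun _ => Nat.mod_lt _ hp0).more ?_
  have := cubic_bounds hn
  ring_nf at this ⊢
  omega

theorem Gets.select (c : Fin 3) {k l : ℕ} {f g : ((Fin 3 × Fin n) ⊕ Unit → Bool) → ℕ}
    (hf : Gets (inputBits _) k (2 * n + 2) f) (hg : Gets (inputBits _) l (2 * n + 2) g) :
    Gets (inputBits ((Fin 3 × Fin n) ⊕ Unit)) (k + l + 100 * n ^ 3) n
      fun s => if wordVal c s < 1 then f s else g s := by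
  have h4 := Gets.mux ((Gets.word fun i => (Sum.inl (c, i) : (Fin 3 × Fin n) ⊕ Unit)).lt_const
    (fun _ => ofBits_lt_wide _) one_pos Nat.one_le_two_pow) hf hg
  refine ((h4.le (by omega : n ≤ 2 * n + 2)).more ?_).congr fun s => ?_
  · have := cubic_bounds hn
    omega
  · simp only [decide_eq_true_eq]
    rfl

theorem Reach.toggle (c : Fin 3) : Reach (inputBits ((Fin 3 × Fin n) ⊕ Unit)) (20 * n ^ 3)
    {fun s => xor (s (Sum.inr ())) (decide (wordVal c s < 1))} := by
  have hflag : (fun s : (Fin 3 × Fin n) ⊕ Unit → Bool => s (Sum.inr ())) ∈ inputBits _ :=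
    ⟨Sum.inr (), rfl⟩
  refine ((Reach.of_mem hflag).op xor ((Gets.input fun i =>
    (Sum.inl (c, i) : (Fin 3 × Fin n) ⊕ Unit)).lt_const
      (fun _ => Nat.ofBits_lt_two_pow _) one_pos Nat.one_le_two_pow)).more ?_
  have := cubic_bounds hn
  omega

end Gets

theorem val_lt_one_iff [NeZero p] (k : ZMod p) : k.val < 1 ↔ k = 0 := by
  rw [Nat.lt_one_iff, ZMod.val_eq_zero]

theorem scaleVal_val [NeZero p] (k y : ZMod p) :
    scaleVal p k.val y.val = (if k = 0 then y else k * y).val := by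
  rw [scaleVal, clampVal_of_lt (ZMod.val_lt _), clampVal_of_lt (ZMod.val_lt _)]
  simp only [val_lt_one_iff]
  split_ifs
  · rfl
  · rw [ZMod.val_mul]

/-- By Fermat's theorem k^(p-2) inverts k ≠ 0. -/
theorem unscaleVal_val [Fact p.Prime] (k y : ZMod p) :
    unscaleVal p k.val (if k = 0 then y else k * y).val = y.val := by
  rw [unscaleVal, clampVal_of_lt (ZMod.val_lt _), clampVal_of_lt (ZMod.val_lt _)]
  simp only [val_lt_one_iff]
  split_ifs with hk
  · rfl
  · have h2 := (Fact.out : p.Prime).two_le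
    rw [← ZMod.val_natCast]
    congr 1
    simp only [Nat.cast_mul, ZMod.natCast_mod, Nat.cast_pow, ZMod.natCast_zmod_val]
    rw [← mul_assoc, ← pow_succ, show p - 2 + 1 = p - 1 by omega, ZMod.pow_card_sub_one_eq_one hk,
      one_mul]

theorem addVal_val [NeZero p] (a b : ZMod p) : addVal p a.val b.val = (a + b).val := by
  rw [addVal, clampVal_of_lt (ZMod.val_lt _), clampVal_of_lt (ZMod.val_lt _), ZMod.val_add]

theorem subVal_val [NeZero p] (a b : ZMod p) : subVal p a.val b.val = (a - b).val := by
  rw [subVal, clampVal_of_lt (ZMod.val_lt _), clampVal_of_lt (ZMod.val_lt _), ← ZMod.val_natCast]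
  congr 1
  simp only [Nat.cast_add, ZMod.natCast_mod, cast_sub_one_mul (NeZero.pos p),
    ZMod.natCast_zmod_val]
  ring

/-- The arrangement of the output words; the flag tells whether the third word is `0`. -/
def arrange (p : ℕ) (s : (Fin 3 × Fin n) ⊕ Unit → Bool) : (Fin 3 × Fin n) ⊕ Unit → Bool :=
  flagged (fun i => s (Sum.inl (2, i)))
    (bits n (if wordVal 2 s < 1 then wordVal 0 s else wordVal 1 s))
    (bits n (if wordVal 2 s < 1 then wordVal 1 s else addVal p (wordVal 0 s) (wordVal 1 s)))
    (xor (s (Sum.inr ())) (decide (wordVal 2 s < 1)))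

/-- The inverse of `arrange`. -/
def unarrange (p : ℕ) (s : (Fin 3 × Fin n) ⊕ Unit → Bool) : (Fin 3 × Fin n) ⊕ Unit → Bool :=
  flagged (bits n (if wordVal 0 s < 1 then wordVal 1 s else subVal p (wordVal 2 s) (wordVal 1 s)))
    (bits n (if wordVal 0 s < 1 then wordVal 2 s else wordVal 1 s)) (fun i => s (Sum.inl (0, i)))
    (xor (s (Sum.inr ())) (decide (wordVal 0 s < 1)))

theorem arrange_flagged [NeZero p] (hp : p < 2 ^ n) (a i k : ZMod p) :
    arrange p (flagged (zbits n a) (zbits n i) (zbits n k) (decide (k = 0))) =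
      flagged (zbits n k) (zbits n (if k = 0 then a else i)) (zbits n (if k = 0 then i else a + i))
        false := by
  simp only [arrange, wordVal_flagged_zero, wordVal_flagged_one, wordVal_flagged_two,
    ofBits_zbits hp, val_lt_one_iff, addVal_val]
  change flagged (zbits n k) _ _ (xor (decide (k = 0)) _) = _
  rw [Bool.xor_self]
  split_ifs <;> rfl

/-- The word k survives the rearrangement and tells which case applies. That is why the flag can be
cleared and later restored. -/
theorem unarrange_flagged [NeZero p] (hp : p < 2 ^ n) (a i k : ZMod p) :
    unarrange p (flagged (zbits n k) (zbits n (if k = 0 then a else i))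
      (zbits n (if k = 0 then i else a + i)) false) =
      flagged (zbits n a) (zbits n i) (zbits n k) (decide (k = 0)) := by
  simp only [unarrange, wordVal_flagged_zero, wordVal_flagged_one, wordVal_flagged_two,
    ofBits_zbits hp, val_lt_one_iff, subVal_val]
  change flagged _ _ (zbits n k) (xor false _) = _
  rw [Bool.false_xor]
  split_ifs
  · rfl
  · rw [add_sub_cancel_right]
    rfl

theorem Prepares.congr_out {D ι α : Type} [Fintype D] [DecidableEq D] [Fintype α] {k : ℕ}
    {enc : ι → D → Bool} {c : ι → α → ℂ} {out out' : ι → α → D → Bool}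
    (h : Prepares k enc c out) (ho : ∀ i a, out i a = out' i a) : Prepares k enc c out' :=
  (funext fun i => funext fun a => ho i a : out = out') ▸ h

/-- The index consists of the transform k of z, the transform of the scaled y, and the final content
of the first word: a transform label of x if k = 0, and x itself otherwise. -/
theorem prepares_heisenberg [Fact p.Prime] (hn : 1 ≤ n) (hp : p < 2 ^ n) (hp2 : 2 ^ n ≤ 2 * p)
    {ω : ℂ} (hω : IsPrimitiveRoot ω p) :
    Prepares (6000000000 * n ^ 3)
      (fun g : Heisenberg p => word3 (zbits n g.x) (zbits n g.y) (zbits n g.z))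
      (fun g (a : ZMod p × ZMod p × ZMod p) =>
        dftMatrix (AddChar.zmodChar p hω.pow_eq_one) a.1 g.z *
        dftMatrix (AddChar.zmodChar p hω.pow_eq_one) a.2.1 (if a.1 = 0 then g.y else a.1 * g.y) *
        if a.1 = 0 then dftMatrix (AddChar.zmodChar p hω.pow_eq_one) a.2.2 g.x
          else if a.2.2 = g.x then 1 else 0)
      fun _ a => word3 (zbits n a.1) (zbits n (if a.1 = 0 then a.2.2 else a.2.1))
        (zbits n (if a.1 = 0 then a.2.1 else a.2.2 + a.2.1)) := by
  have hp0 : 0 < p := NeZero.pos p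
  have hd := prepares_dft hn hp hp2 hω
  have h1 := (Prepares.refl fun g : Heisenberg p =>
    flagged (zbits n g.x) (zbits n g.y) (zbits n g.z) false).branch hd (injective_inl_pair 2)
    (fun g _ => g.z) fun _ _ => rfl
  simp only [extend_flagged_two] at h1
  have h2 := h1.inPlace
    (f := fun s => flagged (fun i => s (Sum.inl (0, i)))
      (bits n (scaleVal p (wordVal 2 s) (wordVal 1 s))) (fun i => s (Sum.inl (2, i)))
      (xor (s (Sum.inr ())) (decide (wordVal 2 s < 1))))
    (g := fun s => flagged (fun i => s (Sum.inl (0, i)))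
      (bits n (unscaleVal p (wordVal 2 s) (wordVal 1 s))) (fun i => s (Sum.inl (2, i)))
      (xor (s (Sum.inr ())) (decide (wordVal 2 s < 1))))
    (.flagged (.wordBits_input _) (.wordBits_bits (.scaleVal hn hp0 hp _ _)) (.wordBits_input _)
      (.toggle hn hp0 hp 2))
    (.flagged (.wordBits_input _) (.wordBits_bits (.unscaleVal hn hp0 hp _ _)) (.wordBits_input _)
      (.toggle hn hp0 hp 2)) (by
    rintro g ⟨-, k⟩
    change flagged (zbits n g.x) (bits n (unscaleVal p (Nat.ofBits (zbits n k)) (Nat.ofBits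
      (bits n (scaleVal p (Nat.ofBits (zbits n k)) (Nat.ofBits (zbits n g.y))))))) (zbits n k)
      (xor (xor false (decide (Nat.ofBits (zbits n k) < 1)))
        (decide (Nat.ofBits (zbits n k) < 1))) = _
    rw [ofBits_zbits hp, ofBits_zbits hp, scaleVal_val,
      ofBits_bits ((ZMod.val_lt _).trans hp), unscaleVal_val, Bool.xor_assoc, Bool.xor_self,
      Bool.xor_false]
    rfl)
  have h2' := h2.congr_out (out' := fun g a => flagged (zbits n g.x)
      (zbits n (if a.2 = 0 then g.y else a.2 * g.y)) (zbits n a.2) (decide (a.2 = 0))) fun g a => by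
    change (flagged (zbits n g.x) (bits n (scaleVal p (Nat.ofBits (zbits n a.2))
      (Nat.ofBits (zbits n g.y)))) (zbits n a.2)
      (xor false (decide (Nat.ofBits (zbits n a.2) < 1)))) = _
    rw [ofBits_zbits hp, ofBits_zbits hp, scaleVal_val, Bool.false_xor]
    simp only [val_lt_one_iff]
    rfl
  have h3 := h2'.branch hd (injective_inl_pair 1)
    (fun g a => if a.2 = 0 then g.y else a.2 * g.y) fun _ _ => rfl
  simp only [extend_flagged_one] at h3
  -- The flag set by the scaling step controls the transform of x.
  have h4 := h3.branch hd.ctrl firstAndFlag_injective (fun g a => (g.x, decide (a.1.2 = 0)))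
    fun g a => by
      ext (i | u) <;> rfl
  simp only [extend_firstAndFlag] at h4
  have h5 := h4.inPlace (f := arrange p) (g := unarrange p)
    (.flagged (.wordBits_input _)
      (.wordBits_bits (.select hn hp0 hp _ (.word _) (.word _)))
      (.wordBits_bits (.select hn hp0 hp _ (.word _) (.addVal hn hp0 hp _ _)))
      (.toggle hn hp0 hp 2))
    (.flagged (.wordBits_bits (.select hn hp0 hp _ (.word _) (.subVal hn hp0 hp _ _)))
      (.wordBits_bits (.select hn hp0 hp _ (.word _) (.word _))) (.wordBits_input _)
      (.toggle hn hp0 hp 0)) fun g a => by rw [arrange_flagged hp, unarrange_flagged hp]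
  have h5' := h5.congr_out fun g a => arrange_flagged hp _ _ _
  have h6 := h5'.hide (l := 1) (Equiv.refl _) (fun g => rfl) (fun g a => rfl) (by simp)
  refine (h6.mono ?_).congr fun g => ?_
  -- The count is dominated by the controlled transform, 24 · 200000002 n³.
  · simp only [Fintype.card_sum, Fintype.card_prod, Fintype.card_fin, Fintype.card_unit]
    have := cubic_bounds hn
    omega
  · simp only [Fintype.sum_prod_type, Fintype.sum_unique, one_mul, decide_eq_true_eq]

end HeisenbergFourier

/-! ### The encoded transform of the group and the logarithmic bound -/

section MainTheorem

variable {p : ℕ}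

/-- The operation as a circuit with numbered ancillas. -/
theorem Prepares.exists_circuit {D ι α : Type} [Fintype D] [DecidableEq D] [Fintype α] {k : ℕ}
    {enc : ι → D → Bool} {c : ι → α → ℂ} {out : ι → α → D → Bool} (h : Prepares k enc c out) :
    ∃ (m : ℕ) (C : List (Gate (D ⊕ Fin m))), C.length ≤ k ∧ ∀ i, circuitMatrix C *ᵥ
      ket (pad (Fin m) (enc i)) = ∑ a, c i a • ket (pad (Fin m) (out i a)) := by
  obtain ⟨A, _, _, M, -, ⟨B, _, _, C, hC, hM⟩, h⟩ := h
  let σ : A ⊕ B ≃ Fin (Fintype.card (A ⊕ B)) := Fintype.equivFin _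
  let j : (D ⊕ A) ⊕ B → D ⊕ Fin (Fintype.card (A ⊕ B)) :=
    fun x => Sum.map id σ (Equiv.sumAssoc D A B x)
  have hj : j.Injective := (Sum.map_injective.2 ⟨Function.injective_id, σ.injective⟩).comp
    (Equiv.sumAssoc D A B).injective
  refine ⟨_, C.map (Gate.map j hj), by simpa using hC, fun i => ?_⟩
  have h1 : circuitMatrix C *ᵥ ket (pad B (pad A (enc i))) =
      ∑ a, c i a • ket (pad B (pad A (out i a))) := by
    rw [hM, ← ketMap_mulVec_ket (pad B), h, map_sum]
    simp only [map_smul, ketMap_ket]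
  rw [circuitMatrix_map, liftMat_mulVec_of hj _ (S := Finset.univ) (c := c i)
    (w := fun a => pad B (pad A (out i a)))]
  · refine Finset.sum_congr rfl fun a _ => ?_
    congr 2
    ext (d | q)
    · exact hj.extend_apply _ _ (Sum.inl (Sum.inl d))
    · obtain ⟨x, rfl⟩ := σ.surjective q
      rcases x with a' | b
      · exact hj.extend_apply _ _ (Sum.inl (Sum.inr a'))
      · exact hj.extend_apply _ _ (Sum.inr b)
  · rw [← h1]
    congr 2
    ext ((d | a) | b) <;> rfl

namespace Heisenberg

theorem encodeTriple_eq_pad [NeZero p] (m : ℕ) (v : Fin 3 → ZMod p) :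
    encodeTriple m v = pad (Fin m) (word3 (zbits (wordSize p) (v 0)) (zbits (wordSize p) (v 1))
      (zbits (wordSize p) (v 2))) := by
  ext (⟨c, i⟩ | x)
  · fin_cases c <;> rfl
  · rfl

theorem sum_fourierLabel [NeZero p] {M : Type} [AddCommMonoid M]
    (f : FourierLabel (IrrepIndex (p := p)) → M) :
    ∑ l, f l = (∑ a : ZMod p, ∑ b : ZMod p, f ⟨Sum.inl (a, b), ((), ())⟩) +
      ∑ k : (ZMod p)ˣ, ∑ i : ZMod p, ∑ j : ZMod p, f ⟨Sum.inr k, (i, j)⟩ := by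
  rw [Fintype.sum_sigma, Fintype.sum_sum_type, Fintype.sum_prod_type]
  congr 1
  · refine Finset.sum_congr rfl fun a _ => Finset.sum_congr rfl fun b _ => ?_
    exact (Fintype.sum_prod_type (α₁ := Unit) (α₂ := Unit)
      fun x => f ⟨Sum.inl (a, b), x⟩).trans (by simp; rfl)
  · refine Finset.sum_congr rfl fun k _ => ?_
    exact Fintype.sum_prod_type (α₁ := ZMod p) (α₂ := ZMod p) fun x => f ⟨Sum.inr k, x⟩

theorem sum_zmod_eq_zero_add_units [Fact p.Prime] {M : Type} [AddCommMonoid M] (f : ZMod p → M) :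
    ∑ k, f k = f 0 + ∑ k : (ZMod p)ˣ, f k := by
  classical
  rw [← Finset.add_sum_erase _ _ (Finset.mem_univ (0 : ZMod p))]
  congr 1
  refine (Finset.sum_bij (fun (k : (ZMod p)ˣ) _ => (k : ZMod p)) ?_ ?_ ?_ ?_).symm
  · exact fun k _ => Finset.mem_erase.2 ⟨k.ne_zero, Finset.mem_univ _⟩
  · exact fun a _ b _ h => Units.ext h
  · exact fun k hk => ⟨Units.mk0 k (Finset.mem_erase.1 hk).1, Finset.mem_univ _, rfl⟩
  · exact fun _ _ => rfl

/-- The entry in row 0 of the transform of z carries no phase and supplies the third factor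
p^(-1/2). -/
theorem qftMatrix_chi [Fact p.Prime] {ω : ℂ} (hω : IsPrimitiveRoot ω p) (a b : ZMod p)
    (g : Heisenberg p) : qftMatrix (irrep ω hω.pow_eq_one) ⟨Sum.inl (a, b), ((), ())⟩ g =
      dftMatrix (AddChar.zmodChar p hω.pow_eq_one) 0 g.z *
        dftMatrix (AddChar.zmodChar p hω.pow_eq_one) b g.y *
        dftMatrix (AddChar.zmodChar p hω.pow_eq_one) a g.x := by
  have h1 : qftMatrix (irrep ω hω.pow_eq_one) ⟨Sum.inl (a, b), ((), ())⟩ g =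
      (Real.sqrt ((Fintype.card Unit : ℝ) / (Nat.card (Heisenberg p) : ℝ)) : ℂ) *
        AddChar.zmodChar p hω.pow_eq_one (a * g.x + b * g.y) := rfl
  have hsq : Real.sqrt ((Fintype.card Unit : ℝ) / (Nat.card (Heisenberg p) : ℝ)) =
      (Real.sqrt p)⁻¹ * (Real.sqrt p)⁻¹ * (Real.sqrt p)⁻¹ := by
    rw [Nat.card_eq_fintype_card, card_eq, Fintype.card_unit, Nat.cast_one, one_div, Real.sqrt_inv,
      ← mul_inv, ← mul_inv, ← Real.sqrt_mul (Nat.cast_nonneg p),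
      ← Real.sqrt_mul (mul_self_nonneg _)]
    push_cast
    congr 3
    ring
  rw [h1, hsq, dftMatrix, Matrix.of_apply, Matrix.of_apply, Matrix.of_apply, mul_zero,
    AddChar.map_zero_eq_one, AddChar.map_add_eq_mul, mul_comm a, mul_comm b]
  push_cast
  ring

theorem qftMatrix_rho [Fact p.Prime] {ω : ℂ} (hω : IsPrimitiveRoot ω p) (k : (ZMod p)ˣ)
    (i j : ZMod p) (g : Heisenberg p) :
    qftMatrix (irrep ω hω.pow_eq_one) ⟨Sum.inr k, (i, j)⟩ g =
      if j = i + g.x then dftMatrix (AddChar.zmodChar p hω.pow_eq_one) k g.z *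
        dftMatrix (AddChar.zmodChar p hω.pow_eq_one) i (k * g.y) else 0 := by
  have h1 : qftMatrix (irrep ω hω.pow_eq_one) ⟨Sum.inr k, (i, j)⟩ g =
      (Real.sqrt ((Fintype.card (ZMod p) : ℝ) / (Nat.card (Heisenberg p) : ℝ)) : ℂ) *
        if j = i + g.x then AddChar.zmodChar p hω.pow_eq_one (k * g.z) *
          AddChar.zmodChar p hω.pow_eq_one (k * g.y * i) else 0 := rfl
  have hp : (0 : ℝ) < p := by exact_mod_cast (Fact.out : p.Prime).pos
  have hsq : Real.sqrt ((Fintype.card (ZMod p) : ℝ) / (Nat.card (Heisenberg p) : ℝ)) =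
      (Real.sqrt p)⁻¹ * (Real.sqrt p)⁻¹ := by
    rw [Nat.card_eq_fintype_card, card_eq, ZMod.card, ← mul_inv, Real.mul_self_sqrt hp.le,
      Real.sqrt_eq_iff_mul_self_eq (by positivity) (by positivity)]
    push_cast
    field_simp
  rw [h1, hsq, mul_ite, mul_zero]
  refine if_congr Iff.rfl ?_ rfl
  rw [dftMatrix, Matrix.of_apply, Matrix.of_apply, mul_comm (k : ZMod p) g.z]
  push_cast
  ring

theorem exists_computes_qft [Fact p.Prime] {ω : ℂ} (hω : IsPrimitiveRoot ω p) :
    ∃ (m : ℕ) (C : List (Gate (Register p m))),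
      Computes C (qftMatrix (irrep ω hω.pow_eq_one)) ∧
        C.length ≤ 6000000000 * wordSize p ^ 3 := by
  have hp := (Fact.out : p.Prime).two_le
  have hn : 1 ≤ wordSize p := Nat.size_pos.2 (by omega)
  have hlt : p < 2 ^ wordSize p := Nat.lt_size_self p
  have hle : 2 ^ wordSize p ≤ 2 * p := by
    have : 2 ^ (wordSize p - 1) ≤ p := Nat.lt_size.1 (Nat.sub_lt hn one_pos)
    calc 2 ^ wordSize p = 2 * 2 ^ (wordSize p - 1) := by
          rw [← pow_succ']
          congr 1
          omega
      _ ≤ 2 * p := by omega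
  have h0 := (prepares_heisenberg hn hlt hle hω).congr
    (c' := fun g l => qftMatrix (irrep ω hω.pow_eq_one) l g)
    (out' := fun _ l => word3 (zbits (wordSize p) (labelTriple l 0))
      (zbits (wordSize p) (labelTriple l 1)) (zbits (wordSize p) (labelTriple l 2)))
    (fun g => by
    rw [Fintype.sum_prod_type, sum_zmod_eq_zero_add_units, sum_fourierLabel]
    congr 1
    · rw [Fintype.sum_prod_type, Finset.sum_comm]
      refine Finset.sum_congr rfl fun a _ => Finset.sum_congr rfl fun b _ => ?_
      rw [qftMatrix_chi hω]
      simp only [if_true]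
      rfl
    · refine Finset.sum_congr rfl fun k _ => ?_
      rw [Fintype.sum_prod_type]
      refine Finset.sum_congr rfl fun i _ => ?_
      simp only [if_neg k.ne_zero]
      -- For k ≠ 0 both sums collapse: the first word still holds x, and row i of ρ_k has a single
      -- nonzero entry, in column i + x.
      rw [Finset.sum_eq_single g.x, Finset.sum_eq_single (i + g.x)]
      · rw [if_pos rfl, mul_one, add_comm g.x]
        exact congrArg (· • _) ((qftMatrix_rho hω k i (i + g.x) g).trans (if_pos rfl)).symm
      · intro j _ hj
        exact (congrArg (· • _) ((qftMatrix_rho hω k i j g).trans (if_neg hj))).trans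
          (zero_smul ℂ _)
      · simp
      · intro a _ ha
        rw [if_neg ha, mul_zero, zero_smul]
      · simp)
  obtain ⟨m, C, hC, h⟩ := h0.exists_circuit
  refine ⟨m, C, fun g => ?_, hC⟩
  simp only [encodeTriple_eq_pad]
  exact h g

/-- The word size is at most log₂ p + 1, and 1 ≤ log₂ p. -/
theorem wordSize_le_log (hp : 2 ≤ p) : (wordSize p : ℝ) ≤ 2 / Real.log 2 * Real.log p := by
  have h2 : 0 < Real.log 2 := Real.log_pos (by norm_num)
  have h1 : 2 ^ (wordSize p - 1) ≤ p := by
    have : 0 < wordSize p := Nat.size_pos.2 (by omega)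
    exact Nat.lt_size.1 (Nat.sub_lt this one_pos)
  have h3 : ((wordSize p - 1 : ℕ) : ℝ) * Real.log 2 ≤ Real.log p := by
    rw [← Real.log_pow]
    exact Real.log_le_log (by positivity) (by exact_mod_cast h1)
  have h4 : Real.log 2 ≤ Real.log p := Real.log_le_log (by norm_num) (by exact_mod_cast hp)
  have h5 : (wordSize p : ℝ) ≤ ((wordSize p - 1 : ℕ) : ℝ) + 1 := by
    exact_mod_cast (by omega : wordSize p ≤ wordSize p - 1 + 1)
  rw [div_mul_eq_mul_div, le_div_iff₀ h2]
  nlinarith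

end Heisenberg

end MainTheorem

end

theorem mainTheorem6 :
    ∃ K : ℝ, ∀ (p : ℕ) [Fact p.Prime] (ω : ℂ) (hω : IsPrimitiveRoot ω p),
      IsCompleteIrreps (Heisenberg.irrep ω hω.pow_eq_one) ∧
      (Heisenberg.NInfty p).Normal ∧
      (∀ (r : Heisenberg.IrrepName p), ∀ g ∈ Heisenberg.NInfty p,
        (Heisenberg.irrep ω hω.pow_eq_one r g :
          Matrix (Heisenberg.IrrepIndex r) (Heisenberg.IrrepIndex r) ℂ).IsDiag) ∧
      ∃ (m : ℕ) (C : List (Gate (Heisenberg.Register p m))),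
        Heisenberg.Computes C (qftMatrix (Heisenberg.irrep ω hω.pow_eq_one)) ∧
        (C.length : ℝ) ≤ K * Real.log p ^ 3 := by
  refine ⟨6000000000 * (2 / Real.log 2) ^ 3, fun p _ ω hω =>
    ⟨Heisenberg.irrep_isCompleteIrreps ω hω, Heisenberg.nInfty_normal,
      fun r g hg => Heisenberg.irrep_isDiag ω _ r g hg, ?_⟩⟩
  obtain ⟨m, C, hC, hlen⟩ := Heisenberg.exists_computes_qft hω
  refine ⟨m, C, hC, ?_⟩
  have h := Heisenberg.wordSize_le_log (Fact.out : p.Prime).two_le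
  calc (C.length : ℝ) ≤ 6000000000 * (Heisenberg.wordSize p : ℝ) ^ 3 := by exact_mod_cast hlen
    _ ≤ 6000000000 * (2 / Real.log 2 * Real.log p) ^ 3 := by gcongr
    _ = _ := by rw [mul_pow, mul_assoc]
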